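/- Let $k$ be a field, $H$ a Hopf algebra over $k$ with antipode $S$ (not assumed bijective), $L$ and $R$ unital associative $k$-algebras. Sweedler notation is $\Delta(h)=h_{(1)}\otimes h_{(2)}$. **Yetter–Drinfeld data.** A *left-right Yetter–Drinfeld module algebra* $(L,\blacktriangleright,\rho)$ consists of a left $H$-module structure $\blacktriangleright$ on $L$ and a right $H$-comodule structure $\rho(a)=a_{[0]}\otimes a_{[1]}$ on $L$ with $h\blacktriangleright(ab)=(h_{(1)}\blacktriangleright a)(h_{(2)}\blacktriangleright b)$, $h\blacktriangleright 1=\epsilon(h)1$, $\rho(ab)=a_{[0]}b_{[0]}\otimes b_{[1]}a_{[1]}$, $\rho(1)=1\otimes 1$ and $(h_{(1)}\blacktriangleright a_{[0]})\otimes h_{(2)}a_{[1]}=(h_{(2)}\blacktriangleright a)_{[0]}\otimes(h_{(2)}\blacktriangleright a)_{[1]}h_{(1)}$; it is *braided commutative* if $x_{[0]}(x_{[1]}\blacktriangleright a)=ax$. A *right-left Yetter–Drinfeld module algebra* $(R,\blacktriangleleft,\lambda)$ consists of a right $H$-module structure $\blacktriangleleft$ and a left $H$-comodule structure $\lambda(a)=a_{[-1]}\otimes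 a_{[0]}$ on $R$ with $(ab)\blacktriangleleft h=(a\blacktriangleleft h_{(1)})(b\blacktriangleleft h_{(2)})$, $1\blacktriangleleft h=\epsilon(h)1$, $\lambda(ab)=b_{[-1]}a_{[-1]}\otimes a_{[0]}b_{[0]}$, $\lambda(1)=1\otimes1$ and $a_{[-1]}h_{(1)}\otimes(a_{[0]}\blacktriangleleft h_{(2)})=h_{(2)}(a\blacktriangleleft h_{(1)})_{[-1]}\otimes(a\blacktriangleleft h_{(1)})_{[0]}$; it is *braided commutative* if $(a\blacktriangleleft y_{[-1]})y_{[0]}=ya$. The smash product $L\sharp H$ is $L\otimes H$ with product $(a\sharp h)(b\sharp g)=a(h_{(1)}\blacktriangleright b)\sharp h_{(2)}g$, and $H\sharp R$ is $H\otimes R$ with product $(h\sharp a)(g\sharp b)=hg_{(1)}\sharp(a\blacktriangleleft g_{(2)})b$. Both contain $H$, and $L$ respectively $R$, as subalgebras, and a dot denotes the product in them; $\rho$ and $\lambda$ are also viewed as maps $L\to L\sharp H$ and $R\to H\sharp R$. **Symmetric Hopf algebroids.** A *left bialgebroid* over an algebra $A$ with total algebra $K$ consists of an algebra homomorphism $\alpha:A\to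 K$ and an algebra antihomomorphism $\beta:A\to K$ with commuting images, and a coassociative counital comonoid structure $\Delta:K\to K\otimes_AK$, $\epsilon:K\to A$ in $A$-bimodules, where $a.x.b=\alpha(a)\beta(b)x$, such that $x\otimes(g\otimes h)\mapsto\Delta(x)(g\otimes h)$ induces a left unital action of $K$ on $K\otimes_AK$, and $x\otimes a\mapsto\epsilon(x\alpha(a))$ is a left unital action of $K$ on $A$. A *right bialgebroid* is defined symmetrically, with $b.x.a=x\alpha(a)\beta(b)$ and right unital actions $(g\otimes h)\otimes x\mapsto(g\otimes h)\Delta(x)$ and $a\otimes x\mapsto\epsilon(\alpha(a)x)$. A *symmetric Hopf algebroid* with base algebras $L$, $R$ and total algebra $K$ consists of a left bialgebroid $(\alpha_L,\beta_L,\Delta_L,\epsilon_L)$ over $L$ and a right bialgebroid $(\alpha_R,\beta_R,\Delta_R,\epsilon_R)$ over $R$, both with total algebra $K$, and an algebra antihomomorphism $\tau:K\to K$ such that $\alpha_L\epsilon_L\beta_R=\beta_R$, $\beta_L\epsilon_L\alpha_R=\alpha_R$, $\alpha_R\epsilon_R\beta_L=\beta_L$, $\beta_R\epsilon_R\alpha_L=\alpha_L$,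 $(\Delta_R\otimes_L\mathrm{id})\Delta_L=(\mathrm{id}\otimes_R\Delta_L)\Delta_R$, $(\Delta_L\otimes_R\mathrm{id})\Delta_R=(\mathrm{id}\otimes_L\Delta_R)\Delta_L$, $\tau\beta_L=\alpha_L$, $\tau\beta_R=\alpha_R$, $\mu(\tau\otimes\mathrm{id})\Delta_L=\alpha_R\epsilon_R$ and $\mu(\mathrm{id}\otimes\tau)\Delta_R=\alpha_L\epsilon_L$, where $\mu$ is the multiplication of $K$. **Theorem.** Let $(L,\blacktriangleright,\rho)$ and $(R,\blacktriangleleft,\lambda)$ be a left-right and a right-left braided commutative Yetter–Drinfeld $H$-module algebra, and let $\theta:R\to L$ be an algebra antiisomorphism such that $$\theta(y\blacktriangleleft f)=Sf\blacktriangleright\theta(y),\qquad \theta(y)_{[0]}\otimes\theta(y)_{[1]}=\theta(y_{[0]})\otimes S(y_{[-1]})\qquad(y\in R,\ f\in H).$$ Then: 1. The map $\bar\Psi:H\sharp R\to L\sharp H$, $\bar\Psi(f\sharp y)=f\cdot\theta(y)_{[0]}\sharp\theta(y)_{[1]}$, is an algebra isomorphism with inverse $\bar\Psi^{-1}(x\sharp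 f)=\theta^{-1}(x_{[0]})\cdot S(x_{[1]})f$. Moreover $\bar\Psi(1\sharp R)=\operatorname{Im}\rho$ and $\bar\Psi^{-1}(L\sharp1)=\operatorname{Im}\lambda$. 2. The map $\bar\Phi:H\sharp R\to L\sharp H$, $\bar\Phi(f\sharp y)=\theta(y)\sharp Sf$, is an algebra antihomomorphism. The linear maps $\tau$ on $L\sharp H$ and $\tau'$ on $H\sharp R$ given below satisfy $\tau\circ\bar\Psi=\bar\Psi\circ\tau'=\bar\Phi$, and they are algebra antihomomorphisms. 3. $L\sharp H$ and $H\sharp R$, with the following structure maps, are symmetric Hopf algebroids with base algebras $L$ and $R$, and $\bar\Psi$ carries every structure map of $H\sharp R$ to the corresponding one of $L\sharp H$. On $L\sharp H$: $$\alpha_L(x)=x\sharp1,\quad \beta_L(x)=x_{[0]}\sharp x_{[1]},\quad \Delta_L(x\sharp f)=x\sharp f_{(1)}\otimes_L1\sharp f_{(2)},\quad \epsilon_L(x\sharp f)=\epsilon(f)x,$$ $$\alpha_R(y)=\rho(\theta(y))=\theta(y_{[0]})\sharp S(y_{[-1]}),\quad \beta_R(y)=(y_{[-1]}\blacktriangleright\theta(y_{[0]}))\sharp1,$$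 $$\Delta_R(x\sharp f)=x\sharp f_{(1)}\otimes_R1\sharp f_{(2)},\quad \epsilon_R(x\sharp f)=\theta^{-1}(x_{[0]})\blacktriangleleft(S(x_{[1]})f),$$ $$\tau(x\sharp f)=Sf\,S^2(x_{[1]})\cdot x_{[0]}.$$ On $H\sharp R$: $$\alpha'_L(x)=\theta^{-1}(x_{[0]})\cdot S(x_{[1]}),\quad \beta'_L(x)=1\sharp\theta^{-1}(x),\quad \Delta'_L(f\sharp y)=f_{(1)}\sharp1\otimes_Lf_{(2)}\sharp y,\quad \epsilon'_L(f\sharp y)=f\blacktriangleright\theta(y),$$ $$\alpha'_R(y)=1\sharp y,\quad \beta'_R(y)=y_{[-1]}\sharp y_{[0]},\quad \Delta'_R(f\sharp y)=f_{(1)}\sharp1\otimes_Rf_{(2)}\sharp y,\quad \epsilon'_R(f\sharp y)=\epsilon(f)y,$$ $$\tau'(f\sharp y)=y_{[0]}\cdot S^2(y_{[-1]})Sf.$$ 4. $\theta=\epsilon_L\circ\alpha_R=\epsilon'_L\circ\alpha'_R$ and $\theta^{-1}=\epsilon_R\circ\beta_L=\epsilon'_R\circ\beta'_L$. -/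

import Mathlib

open scoped TensorProduct

noncomputable section

/-! ### Balanced tensor products over noncommutative algebras -/

section Balanced

variable {k : Type*} [CommRing k] {M N P Q : Type*}
  [AddCommGroup M] [Module k M] [AddCommGroup N] [Module k N]
  [AddCommGroup P] [Module k P] [AddCommGroup Q] [Module k Q] {A B : Type*}

/-- The relations `(m · a) ⊗ n = m ⊗ (a · n)`, for a right action `r` of `A` on `M` and a left
action `l` of `A` on `N`, both by `k`-linear maps. -/
def balRel (r : A → M →ₗ[k] M) (l : A → N →ₗ[k] N) : Submodule k (M ⊗[k] N) :=
  Submodule.span k {t | ∃ (a : A) (m : M) (n : N), t = r a m ⊗ₜ[k] n - m ⊗ₜ[k] l a n}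

/-- The tensor product `M ⊗_A N`. -/
abbrev BalTensor (r : A → M →ₗ[k] M) (l : A → N →ₗ[k] N) : Type _ :=
  (M ⊗[k] N) ⧸ balRel r l

namespace BalTensor

variable (r : A → M →ₗ[k] M) (l : A → N →ₗ[k] N)

/-- The projection `M ⊗ N → M ⊗_A N`. -/
def mk : M ⊗[k] N →ₗ[k] BalTensor r l := (balRel r l).mkQ

variable {r l}

theorem mk_surjective : Function.Surjective (mk r l) := Submodule.mkQ_surjective _

theorem mk_balance (a : A) (m : M) (n : N) :
    mk r l (r a m ⊗ₜ n) = mk r l (m ⊗ₜ l a n) := by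
  rw [← sub_eq_zero, ← map_sub]
  exact (Submodule.Quotient.mk_eq_zero _).2 (Submodule.subset_span ⟨a, m, n, rfl⟩)

/-- The map on `M ⊗_A N` induced by a balanced map on `M ⊗ N`. -/
def lift (f : M ⊗[k] N →ₗ[k] Q) (hf : ∀ a m n, f (r a m ⊗ₜ n) = f (m ⊗ₜ l a n)) :
    BalTensor r l →ₗ[k] Q :=
  (balRel r l).liftQ f (by
    rw [balRel, Submodule.span_le]
    rintro _ ⟨a, m, n, rfl⟩
    simp [hf])

@[simp] theorem lift_mk (f : M ⊗[k] N →ₗ[k] Q) (hf) (t : M ⊗[k] N) :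
    lift (r := r) (l := l) f hf (mk r l t) = f t := rfl

end BalTensor

/-- The relations defining `M ⊗_A N ⊗_B P`. -/
def tripleRel (r : A → M →ₗ[k] M) (l : A → N →ₗ[k] N) (r' : B → N →ₗ[k] N)
    (l' : B → P →ₗ[k] P) : Submodule k (M ⊗[k] (N ⊗[k] P)) :=
  Submodule.span k
    ({t | ∃ (a : A) (m : M) (n : N) (p : P),
        t = r a m ⊗ₜ[k] (n ⊗ₜ[k] p) - m ⊗ₜ[k] (l a n ⊗ₜ[k] p)} ∪
     {t | ∃ (b : B) (m : M) (n : N) (p : P),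
        t = m ⊗ₜ[k] (r' b n ⊗ₜ[k] p) - m ⊗ₜ[k] (n ⊗ₜ[k] l' b p)})

/-- The tensor product `M ⊗_A N ⊗_B P`, where `N` carries commuting actions `l` (left, of `A`)
and `r'` (right, of `B`). -/
abbrev TripleTensor (r : A → M →ₗ[k] M) (l : A → N →ₗ[k] N) (r' : B → N →ₗ[k] N)
    (l' : B → P →ₗ[k] P) : Type _ :=
  (M ⊗[k] (N ⊗[k] P)) ⧸ tripleRel r l r' l'

namespace TripleTensor

variable (r : A → M →ₗ[k] M) (l : A → N →ₗ[k] N) (r' : B → N →ₗ[k] N) (l' : B → P →ₗ[k] P)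

/-- The projection `M ⊗ (N ⊗ P) → M ⊗_A N ⊗_B P`. -/
def mk : M ⊗[k] (N ⊗[k] P) →ₗ[k] TripleTensor r l r' l' := (tripleRel r l r' l').mkQ

variable {r l r' l'}

theorem mk_balance_left (a : A) (m : M) (n : N) (p : P) :
    mk r l r' l' (r a m ⊗ₜ (n ⊗ₜ p)) = mk r l r' l' (m ⊗ₜ (l a n ⊗ₜ p)) := by
  rw [← sub_eq_zero, ← map_sub]
  exact (Submodule.Quotient.mk_eq_zero _).2 (Submodule.subset_span (Or.inl ⟨a, m, n, p, rfl⟩))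

theorem mk_balance_right (b : B) (m : M) (n : N) (p : P) :
    mk r l r' l' (m ⊗ₜ (r' b n ⊗ₜ p)) = mk r l r' l' (m ⊗ₜ (n ⊗ₜ l' b p)) := by
  rw [← sub_eq_zero, ← map_sub]
  exact (Submodule.Quotient.mk_eq_zero _).2 (Submodule.subset_span (Or.inr ⟨b, m, n, p, rfl⟩))

variable (r l r' l')

/-- The map `(M ⊗_A N) ⊗ P → M ⊗_A N ⊗_B P`, in curried form. -/
def ofLeft : BalTensor r l →ₗ[k] P →ₗ[k] TripleTensor r l r' l' :=
  BalTensor.lift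
    (TensorProduct.curry (mk r l r' l' ∘ₗ (TensorProduct.assoc k M N P).toLinearMap))
    (fun a m n => by
      ext p
      simpa using mk_balance_left (r' := r') (l' := l') a m n p)

/-- The map `M ⊗ (N ⊗_B P) → M ⊗_A N ⊗_B P`, in curried form. -/
def ofRight : M →ₗ[k] BalTensor r' l' →ₗ[k] TripleTensor r l r' l' :=
  (BalTensor.lift (TensorProduct.curry (mk r l r' l')).flip
    (fun b n p => by
      ext m
      simpa using mk_balance_right (r := r) (l := l) b m n p)).flip

@[simp] theorem ofLeft_mk (m : M) (n : N) (p : P) :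
    ofLeft r l r' l' (BalTensor.mk r l (m ⊗ₜ n)) p = mk r l r' l' (m ⊗ₜ (n ⊗ₜ p)) := rfl

@[simp] theorem ofRight_mk (m : M) (t : N ⊗[k] P) :
    ofRight r l r' l' m (BalTensor.mk r' l' t) = mk r l r' l' (m ⊗ₜ t) := rfl

end TripleTensor

end Balanced

/-! ### Bialgebroids -/

section Bialgebroids

/-- A homomorphism `source` and an antihomomorphism `target` from the base algebra `A` to the
total algebra `K` whose images commute. -/
structure SourceTarget (k A K : Type*) [Field k] [Ring A] [Algebra k A] [Ring K]
    [Algebra k K] where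
  source : A →ₐ[k] K
  target : A →ₐ[k] Kᵐᵒᵖ
  commute : ∀ a b : A, source a * (target b).unop = (target b).unop * source a

namespace SourceTarget

variable {k A K : Type*} [Field k] [Ring A] [Algebra k A] [Ring K] [Algebra k K]
  (B : SourceTarget k A K)

/-- The target map as a map into `K` (an antihomomorphism). -/
def tgt (a : A) : K := (B.target a).unop

/-- `α(a) k` -/
abbrev srcL (a : A) : K →ₗ[k] K := LinearMap.mulLeft k (B.source a)
/-- `β(a) k` -/
abbrev tgtL (a : A) : K →ₗ[k] K := LinearMap.mulLeft k (B.tgt a)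
/-- `k α(a)` -/
abbrev srcR (a : A) : K →ₗ[k] K := LinearMap.mulRight k (B.source a)
/-- `k β(a)` -/
abbrev tgtR (a : A) : K →ₗ[k] K := LinearMap.mulRight k (B.tgt a)

/-- `K ⊗_A K` for the bimodule structure `a . k . b = α(a) β(b) k`. -/
abbrev LTensor : Type _ := BalTensor B.tgtL B.srcL

/-- `K ⊗_A K` for the bimodule structure `b . k . a = k α(a) β(b)`. -/
abbrev RTensor : Type _ := BalTensor B.srcR B.tgtR

/-- The projection `K ⊗ K → K ⊗_A K` (left version). -/
def lmk : K ⊗[k] K →ₗ[k] B.LTensor := BalTensor.mk B.tgtL B.srcL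

/-- The projection `K ⊗ K → K ⊗_A K` (right version). -/
def rmk : K ⊗[k] K →ₗ[k] B.RTensor := BalTensor.mk B.srcR B.tgtR

/-- The bimodule structure of `K ⊗_A K` (left version): `a . (g ⊗ h) . b = α(a) g ⊗ β(b) h`. -/
def lBimod (a b : A) : B.LTensor →ₗ[k] B.LTensor :=
  BalTensor.lift (B.lmk ∘ₗ TensorProduct.map (B.srcL a) (B.tgtL b)) (fun c m n => by
    have h1 : B.source a * (B.tgt c * m) = B.tgt c * (B.source a * m) := by
      rw [← mul_assoc, ← mul_assoc]; congr 1; exact B.commute a c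
    have h2 : B.tgt b * (B.source c * n) = B.source c * (B.tgt b * n) := by
      rw [← mul_assoc, ← mul_assoc]; congr 1; exact (B.commute c b).symm
    simp only [LinearMap.comp_apply, TensorProduct.map_tmul, LinearMap.mulLeft_apply, h1, h2]
    exact BalTensor.mk_balance (r := B.tgtL) (l := B.srcL) c _ _)

/-- The bimodule structure of `K ⊗_A K` (right version): `b . (g ⊗ h) . a = g β(b) ⊗ h α(a)`. -/
def rBimod (b a : A) : B.RTensor →ₗ[k] B.RTensor :=
  BalTensor.lift (B.rmk ∘ₗ TensorProduct.map (B.tgtR b) (B.srcR a)) (fun c m n => by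
    have h1 : m * B.source c * B.tgt b = m * B.tgt b * B.source c := by
      rw [mul_assoc, mul_assoc]; congr 1; exact B.commute c b
    have h2 : n * B.tgt c * B.source a = n * B.source a * B.tgt c := by
      rw [mul_assoc, mul_assoc]; congr 1; exact (B.commute a c).symm
    simp only [LinearMap.comp_apply, TensorProduct.map_tmul, LinearMap.mulRight_apply, h1, h2]
    exact BalTensor.mk_balance (r := B.srcR) (l := B.tgtR) c _ _)

/-- The right multiplication `(p ⊗ q)(g ⊗ h) = p g ⊗ q h` of `K ⊗_A K` (left version) by
`K ⊗ K`. -/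
def lMul : B.LTensor →ₗ[k] K ⊗[k] K →ₗ[k] B.LTensor :=
  BalTensor.lift ((LinearMap.mul k (K ⊗[k] K)).compr₂ B.lmk) (fun c m n => by
    refine TensorProduct.ext' fun g h => ?_
    simp only [LinearMap.compr₂_apply, LinearMap.mul_apply', LinearMap.mulLeft_apply,
      Algebra.TensorProduct.tmul_mul_tmul, mul_assoc]
    exact BalTensor.mk_balance (r := B.tgtL) (l := B.srcL) c _ _)

/-- The left multiplication `(g ⊗ h)(p ⊗ q) = g p ⊗ h q` of `K ⊗_A K` (right version) by
`K ⊗ K`; `B.rMul x t` is `t x`. -/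
def rMul : B.RTensor →ₗ[k] K ⊗[k] K →ₗ[k] B.RTensor :=
  BalTensor.lift ((LinearMap.mul k (K ⊗[k] K)).flip.compr₂ B.rmk) (fun c m n => by
    refine TensorProduct.ext' fun g h => ?_
    simp only [LinearMap.compr₂_apply, LinearMap.flip_apply, LinearMap.mul_apply',
      LinearMap.mulRight_apply, Algebra.TensorProduct.tmul_mul_tmul, ← mul_assoc]
    exact BalTensor.mk_balance (r := B.srcR) (l := B.tgtR) c _ _)

@[simp] theorem lBimod_mk (a b : A) (g h : K) :
    B.lBimod a b (B.lmk (g ⊗ₜ h)) = B.lmk ((B.source a * g) ⊗ₜ (B.tgt b * h)) := rfl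

@[simp] theorem rBimod_mk (b a : A) (g h : K) :
    B.rBimod b a (B.rmk (g ⊗ₜ h)) = B.rmk ((g * B.tgt b) ⊗ₜ (h * B.source a)) := rfl

@[simp] theorem lMul_mk (s t : K ⊗[k] K) : B.lMul (B.lmk s) t = B.lmk (s * t) := rfl

@[simp] theorem rMul_mk (s t : K ⊗[k] K) : B.rMul (B.rmk s) t = B.rmk (t * s) := rfl

theorem tgt_one : B.tgt 1 = 1 := by simp [tgt]

/-- Induction principle on `K ⊗_A K` (left version). -/
@[elab_as_elim] theorem lInd {p : B.LTensor → Prop} (x : B.LTensor) (h0 : p 0)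
    (hm : ∀ g h, p (B.lmk (g ⊗ₜ h))) (ha : ∀ x y, p x → p y → p (x + y)) : p x := by
  obtain ⟨t, rfl⟩ := BalTensor.mk_surjective x
  induction t with
  | zero => simpa using h0
  | tmul g h => exact hm g h
  | add s t hs ht => rw [map_add]; exact ha _ _ hs ht

/-- Induction principle on `K ⊗_A K` (right version). -/
@[elab_as_elim] theorem rInd {p : B.RTensor → Prop} (x : B.RTensor) (h0 : p 0)
    (hm : ∀ g h, p (B.rmk (g ⊗ₜ h))) (ha : ∀ x y, p x → p y → p (x + y)) : p x := by
  obtain ⟨t, rfl⟩ := BalTensor.mk_surjective x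
  induction t with
  | zero => simpa using h0
  | tmul g h => exact hm g h
  | add s t hs ht => rw [map_add]; exact ha _ _ hs ht

end SourceTarget

variable (k A K : Type*) [Field k] [Ring A] [Algebra k A] [Ring K] [Algebra k K]

/-- Source, target, and `A`-bimodule maps `Δ : K → K ⊗_A K`, `ε : K → A`, for the bimodule
structure `a . k . b = α(a) β(b) k`. -/
structure LeftCoringData extends SourceTarget k A K where
  comul : K →ₗ[k] toSourceTarget.LTensor
  counit : K →ₗ[k] A
  comul_bimod : ∀ a b x, comul (source a * toSourceTarget.tgt b * x) =
    toSourceTarget.lBimod a b (comul x)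
  counit_bimod : ∀ a b x, counit (source a * toSourceTarget.tgt b * x) = a * counit x * b

/-- Source, target, and `A`-bimodule maps `Δ : K → K ⊗_A K`, `ε : K → A`, for the bimodule
structure `b . k . a = k α(a) β(b)`. -/
structure RightCoringData extends SourceTarget k A K where
  comul : K →ₗ[k] toSourceTarget.RTensor
  counit : K →ₗ[k] A
  comul_bimod : ∀ b a x, comul (x * source a * toSourceTarget.tgt b) =
    toSourceTarget.rBimod b a (comul x)
  counit_bimod : ∀ b a x, counit (x * source a * toSourceTarget.tgt b) = b * counit x * a

variable {k A K}

namespace LeftCoringData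

variable (D : LeftCoringData k A K)

/-- `K ⊗_A K ⊗_A K` -/
abbrev Triple : Type _ := TripleTensor D.tgtL D.srcL D.tgtL D.srcL

/-- `Δ ⊗_A id : K ⊗_A K → K ⊗_A K ⊗_A K` -/
def comulId : D.LTensor →ₗ[k] D.Triple :=
  BalTensor.lift
    (TensorProduct.lift (TripleTensor.ofLeft D.tgtL D.srcL D.tgtL D.srcL ∘ₗ D.comul))
    (fun a m n => by
      have h := D.comul_bimod 1 a m
      rw [map_one, one_mul] at h
      simp only [TensorProduct.lift.tmul, LinearMap.comp_apply, LinearMap.mulLeft_apply, h]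
      refine D.lInd (D.comul m) (by simp) (fun g h => ?_) (fun x y hx hy => by simp [hx, hy])
      rw [D.lBimod_mk, map_one, one_mul]
      exact TripleTensor.mk_balance_right (r := D.tgtL) (l := D.srcL) (r' := D.tgtL)
        (l' := D.srcL) a g h n)

/-- `id ⊗_A Δ : K ⊗_A K → K ⊗_A K ⊗_A K` -/
def idComul : D.LTensor →ₗ[k] D.Triple :=
  BalTensor.lift
    (TensorProduct.lift ((TripleTensor.ofRight D.tgtL D.srcL D.tgtL D.srcL).compl₂ D.comul))
    (fun a m n => by
      have h := D.comul_bimod a 1 n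
      rw [D.tgt_one, mul_one] at h
      simp only [TensorProduct.lift.tmul, LinearMap.compl₂_apply, LinearMap.mulLeft_apply, h]
      refine D.lInd (D.comul n) (by simp) (fun g h => ?_) (fun x y hx hy => by simp [hx, hy])
      rw [D.lBimod_mk, D.tgt_one, one_mul]
      exact TripleTensor.mk_balance_left (r := D.tgtL) (l := D.srcL) (r' := D.tgtL)
        (l' := D.srcL) a m g h)

/-- `ε ⊗_A id : K ⊗_A K → A ⊗_A K = K`, `g ⊗ h ↦ ε(g) . h = α(ε(g)) h`. -/
def counitId : D.LTensor →ₗ[k] K :=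
  BalTensor.lift
    (LinearMap.mul' k K ∘ₗ TensorProduct.map (D.source.toLinearMap ∘ₗ D.counit) LinearMap.id)
    (fun a m n => by
      have h := D.counit_bimod 1 a m
      rw [map_one, one_mul, one_mul] at h
      simp [h, mul_assoc])

/-- `id ⊗_A ε : K ⊗_A K → K ⊗_A A = K`, `g ⊗ h ↦ g . ε(h) = β(ε(h)) g`. -/
def idCounit : D.LTensor →ₗ[k] K :=
  BalTensor.lift
    (TensorProduct.lift (((LinearMap.mul k K) ∘ₗ (MulOpposite.opLinearEquiv k).symm.toLinearMap ∘ₗ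
      D.target.toLinearMap ∘ₗ D.counit).flip))
    (fun a m n => by
      have h := D.counit_bimod a 1 n
      rw [D.tgt_one, mul_one, mul_one] at h
      simp [h, mul_assoc, SourceTarget.tgt])

end LeftCoringData

namespace RightCoringData

variable (D : RightCoringData k A K)

/-- `K ⊗_A K ⊗_A K` -/
abbrev Triple : Type _ := TripleTensor D.srcR D.tgtR D.srcR D.tgtR

/-- `Δ ⊗_A id : K ⊗_A K → K ⊗_A K ⊗_A K` -/
def comulId : D.RTensor →ₗ[k] D.Triple :=
  BalTensor.lift
    (TensorProduct.lift (TripleTensor.ofLeft D.srcR D.tgtR D.srcR D.tgtR ∘ₗ D.comul))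
    (fun a m n => by
      have h := D.comul_bimod 1 a m
      rw [D.tgt_one, mul_one] at h
      simp only [TensorProduct.lift.tmul, LinearMap.comp_apply, LinearMap.mulRight_apply, h]
      refine D.rInd (D.comul m) (by simp) (fun g h => ?_) (fun x y hx hy => by simp [hx, hy])
      rw [D.rBimod_mk, D.tgt_one, mul_one]
      exact TripleTensor.mk_balance_right (r := D.srcR) (l := D.tgtR) (r' := D.srcR)
        (l' := D.tgtR) a g h n)

/-- `id ⊗_A Δ : K ⊗_A K → K ⊗_A K ⊗_A K` -/
def idComul : D.RTensor →ₗ[k] D.Triple :=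
  BalTensor.lift
    (TensorProduct.lift ((TripleTensor.ofRight D.srcR D.tgtR D.srcR D.tgtR).compl₂ D.comul))
    (fun a m n => by
      have h := D.comul_bimod a 1 n
      rw [map_one, mul_one] at h
      simp only [TensorProduct.lift.tmul, LinearMap.compl₂_apply, LinearMap.mulRight_apply, h]
      refine D.rInd (D.comul n) (by simp) (fun g h => ?_) (fun x y hx hy => by simp [hx, hy])
      rw [D.rBimod_mk, map_one, mul_one]
      exact TripleTensor.mk_balance_left (r := D.srcR) (l := D.tgtR) (r' := D.srcR)
        (l' := D.tgtR) a m g h)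

/-- `ε ⊗_A id : K ⊗_A K → A ⊗_A K = K`, `g ⊗ h ↦ ε(g) . h = h β(ε(g))`. -/
def counitId : D.RTensor →ₗ[k] K :=
  BalTensor.lift
    (TensorProduct.lift ((LinearMap.mul k K).flip ∘ₗ
      (MulOpposite.opLinearEquiv k).symm.toLinearMap ∘ₗ D.target.toLinearMap ∘ₗ D.counit))
    (fun a m n => by
      have h := D.counit_bimod 1 a m
      rw [D.tgt_one, mul_one, one_mul] at h
      simp [h, mul_assoc, SourceTarget.tgt])

/-- `id ⊗_A ε : K ⊗_A K → K ⊗_A A = K`, `g ⊗ h ↦ g . ε(h) = g α(ε(h))`. -/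
def idCounit : D.RTensor →ₗ[k] K :=
  BalTensor.lift
    (LinearMap.mul' k K ∘ₗ TensorProduct.map LinearMap.id (D.source.toLinearMap ∘ₗ D.counit))
    (fun a m n => by
      have h := D.counit_bimod a 1 n
      rw [map_one, mul_one, mul_one] at h
      simp [h, mul_assoc])

end RightCoringData

variable (k A K)

/-- A left bialgebroid with base algebra `A` and total algebra `K`. -/
structure LeftBialgebroid extends LeftCoringData k A K where
  coassoc : ∀ x, toLeftCoringData.comulId (comul x) = toLeftCoringData.idComul (comul x)
  counit_comul : ∀ x, toLeftCoringData.counitId (comul x) = x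
  comul_counit : ∀ x, toLeftCoringData.idCounit (comul x) = x
  /-- `x ⊗ (g ⊗ h) ↦ Δ(x)(g ⊗ h)` factors through `K ⊗ (K ⊗_A K)` and is a left unital action. -/
  comul_action : ∃ T : K →ₐ[k] Module.End k toSourceTarget.LTensor,
    ∀ x t, T x (toSourceTarget.lmk t) = toSourceTarget.lMul (comul x) t
  /-- `x ⊗ a ↦ ε(x α(a))` is a left unital action of `K` on `A`. -/
  counit_action_one : ∀ a, counit (1 * source a) = a
  counit_action_mul : ∀ x y a, counit (x * y * source a) =
    counit (x * source (counit (y * source a)))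

/-- A right bialgebroid with base algebra `A` and total algebra `K`. -/
structure RightBialgebroid extends RightCoringData k A K where
  coassoc : ∀ x, toRightCoringData.comulId (comul x) = toRightCoringData.idComul (comul x)
  counit_comul : ∀ x, toRightCoringData.counitId (comul x) = x
  comul_counit : ∀ x, toRightCoringData.idCounit (comul x) = x
  /-- `(g ⊗ h) ⊗ x ↦ (g ⊗ h)Δ(x)` factors through `(K ⊗_A K) ⊗ K` and is a right unital
  action. -/
  comul_action : ∃ T : K →ₐ[k] (Module.End k toSourceTarget.RTensor)ᵐᵒᵖ,
    ∀ x t, (T x).unop (toSourceTarget.rmk t) = toSourceTarget.rMul (comul x) t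
  /-- `a ⊗ x ↦ ε(α(a) x)` is a right unital action of `K` on `A`. -/
  counit_action_one : ∀ a, counit (source a * 1) = a
  counit_action_mul : ∀ x y a, counit (source a * (x * y)) =
    counit (source (counit (source a * x)) * y)

variable {k A K}

namespace LeftBialgebroid

variable (D : LeftBialgebroid k A K)

theorem comul_one : D.comul 1 = D.lmk (1 ⊗ₜ 1) := by
  obtain ⟨T, hT⟩ := D.comul_action
  have h := hT 1 (1 ⊗ₜ 1)
  rw [map_one, ← Algebra.TensorProduct.one_def] at h
  obtain ⟨s, hs⟩ := BalTensor.mk_surjective (D.comul 1)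
  change D.lmk s = _ at hs
  rw [← hs] at h ⊢
  rw [D.lMul_mk, mul_one] at h
  exact h.symm

theorem comul_mul_of (x y : K) (t : K ⊗[k] K) (hy : D.comul y = D.lmk t) :
    D.comul (x * y) = D.lMul (D.comul x) t := by
  obtain ⟨T, hT⟩ := D.comul_action
  have key : ∀ z, T z (D.lmk 1) = D.comul z := fun z => by
    obtain ⟨s, hs⟩ := BalTensor.mk_surjective (D.comul z)
    change D.lmk s = _ at hs
    rw [hT, ← hs, D.lMul_mk, mul_one]
  rw [← key, map_mul, Module.End.mul_apply, key, hy, hT]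

theorem comul_mul_source (x : K) (a : A) :
    D.comul (x * D.source a) = D.lMul (D.comul x) (D.source a ⊗ₜ 1) :=
  D.comul_mul_of _ _ _ (by
    have h := D.comul_bimod a 1 1
    simpa [D.tgt_one, D.comul_one] using h)

theorem comul_mul_target (x : K) (a : A) :
    D.comul (x * D.tgt a) = D.lMul (D.comul x) (1 ⊗ₜ D.tgt a) :=
  D.comul_mul_of _ _ _ (by
    have h := D.comul_bimod 1 a 1
    simpa [D.comul_one] using h)

end LeftBialgebroid

namespace RightBialgebroid

variable (D : RightBialgebroid k A K)

theorem comul_one : D.comul 1 = D.rmk (1 ⊗ₜ 1) := by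
  obtain ⟨T, hT⟩ := D.comul_action
  have h := hT 1 (1 ⊗ₜ 1)
  rw [map_one, ← Algebra.TensorProduct.one_def] at h
  obtain ⟨s, hs⟩ := BalTensor.mk_surjective (D.comul 1)
  change D.rmk s = _ at hs
  rw [← hs] at h ⊢
  rw [D.rMul_mk, one_mul] at h
  exact h.symm

theorem comul_mul_of (x y : K) (t : K ⊗[k] K) (hx : D.comul x = D.rmk t) :
    D.comul (x * y) = D.rMul (D.comul y) t := by
  obtain ⟨T, hT⟩ := D.comul_action
  have key : ∀ z, (T z).unop (D.rmk 1) = D.comul z := fun z => by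
    obtain ⟨s, hs⟩ := BalTensor.mk_surjective (D.comul z)
    change D.rmk s = _ at hs
    rw [hT, ← hs, D.rMul_mk, one_mul]
  rw [← key, map_mul, MulOpposite.unop_mul, Module.End.mul_apply, key, hx, hT]

theorem comul_source_mul (x : K) (a : A) :
    D.comul (D.source a * x) = D.rMul (D.comul x) (1 ⊗ₜ D.source a) :=
  D.comul_mul_of _ _ _ (by
    have h := D.comul_bimod 1 a 1
    simpa [D.tgt_one, D.comul_one] using h)

theorem comul_target_mul (x : K) (a : A) :
    D.comul (D.tgt a * x) = D.rMul (D.comul x) (D.tgt a ⊗ₜ 1) :=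
  D.comul_mul_of _ _ _ (by
    have h := D.comul_bimod a 1 1
    simpa [D.comul_one] using h)

end RightBialgebroid

end Bialgebroids

/-! ### Symmetric Hopf algebroids -/

section HopfAlgebroids

variable (k L R K : Type*) [Field k] [Ring L] [Algebra k L] [Ring R] [Algebra k R]
  [Ring K] [Algebra k K]

/-- A left `L`-bialgebroid and a right `R`-bialgebroid with the same total algebra, and an
antihomomorphism, with the compatibilities between sources, targets, counits and the
antihomomorphism. -/
structure HopfAlgebroidData where
  left : LeftBialgebroid k L K
  right : RightBialgebroid k R K
  antipode : K →ₐ[k] Kᵐᵒᵖ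
  sourceL_counitL_targetR : ∀ y, left.source (left.counit (right.tgt y)) = right.tgt y
  targetL_counitL_sourceR : ∀ y, left.tgt (left.counit (right.source y)) = right.source y
  sourceR_counitR_targetL : ∀ x, right.source (right.counit (left.tgt x)) = left.tgt x
  targetR_counitR_sourceL : ∀ x, right.tgt (right.counit (left.source x)) = left.source x
  antipode_targetL : ∀ x, (antipode (left.tgt x)).unop = left.source x
  antipode_targetR : ∀ y, (antipode (right.tgt y)).unop = right.source y

variable {k L R K}

namespace HopfAlgebroidData

variable (D : HopfAlgebroidData k L R K)

/-- The antipode as a linear map `K → K`. -/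
def antipodeLin : K →ₗ[k] K :=
  (MulOpposite.opLinearEquiv k).symm.toLinearMap ∘ₗ D.antipode.toLinearMap

/-- `K ⊗_R K ⊗_L K` -/
abbrev TripleRL : Type _ := TripleTensor D.right.srcR D.right.tgtR D.left.tgtL D.left.srcL

/-- `K ⊗_L K ⊗_R K` -/
abbrev TripleLR : Type _ := TripleTensor D.left.tgtL D.left.srcL D.right.srcR D.right.tgtR

/-- `Δ_R ⊗_L id : K ⊗_L K → K ⊗_R K ⊗_L K` -/
def comulRId : D.left.LTensor →ₗ[k] D.TripleRL :=
  BalTensor.lift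
    (TensorProduct.lift
      (TripleTensor.ofLeft D.right.srcR D.right.tgtR D.left.tgtL D.left.srcL ∘ₗ D.right.comul))
    (fun a m n => by
      simp only [TensorProduct.lift.tmul, LinearMap.comp_apply, LinearMap.mulLeft_apply]
      rw [← D.sourceR_counitR_targetL, D.right.comul_source_mul, D.sourceR_counitR_targetL]
      refine D.right.rInd (D.right.comul m) (by simp) (fun g h => ?_)
        (fun x y hx hy => by simp only [map_add, LinearMap.add_apply, hx, hy])
      rw [SourceTarget.rMul_mk, Algebra.TensorProduct.tmul_mul_tmul, one_mul]
      exact TripleTensor.mk_balance_right (r := D.right.srcR) (l := D.right.tgtR)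
        (r' := D.left.tgtL) (l' := D.left.srcL) a g h n)

/-- `id ⊗_R Δ_L : K ⊗_R K → K ⊗_R K ⊗_L K` -/
def idComulL : D.right.RTensor →ₗ[k] D.TripleRL :=
  BalTensor.lift
    (TensorProduct.lift
      ((TripleTensor.ofRight D.right.srcR D.right.tgtR D.left.tgtL D.left.srcL).compl₂
        D.left.comul))
    (fun a m n => by
      simp only [TensorProduct.lift.tmul, LinearMap.compl₂_apply, LinearMap.mulRight_apply]
      rw [← D.sourceL_counitL_targetR, D.left.comul_mul_source, D.sourceL_counitL_targetR]
      refine D.left.lInd (D.left.comul n) (by simp) (fun g h => ?_)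
        (fun x y hx hy => by simp only [map_add, LinearMap.add_apply, hx, hy])
      rw [SourceTarget.lMul_mk, Algebra.TensorProduct.tmul_mul_tmul, mul_one]
      exact TripleTensor.mk_balance_left (r := D.right.srcR) (l := D.right.tgtR)
        (r' := D.left.tgtL) (l' := D.left.srcL) a m g h)

/-- `Δ_L ⊗_R id : K ⊗_R K → K ⊗_L K ⊗_R K` -/
def comulLId : D.right.RTensor →ₗ[k] D.TripleLR :=
  BalTensor.lift
    (TensorProduct.lift
      (TripleTensor.ofLeft D.left.tgtL D.left.srcL D.right.srcR D.right.tgtR ∘ₗ D.left.comul))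
    (fun a m n => by
      simp only [TensorProduct.lift.tmul, LinearMap.comp_apply, LinearMap.mulRight_apply]
      rw [← D.targetL_counitL_sourceR, D.left.comul_mul_target, D.targetL_counitL_sourceR]
      refine D.left.lInd (D.left.comul m) (by simp) (fun g h => ?_)
        (fun x y hx hy => by simp only [map_add, LinearMap.add_apply, hx, hy])
      rw [SourceTarget.lMul_mk, Algebra.TensorProduct.tmul_mul_tmul, mul_one]
      exact TripleTensor.mk_balance_right (r := D.left.tgtL) (l := D.left.srcL)
        (r' := D.right.srcR) (l' := D.right.tgtR) a g h n)

/-- `id ⊗_L Δ_R : K ⊗_L K → K ⊗_L K ⊗_R K` -/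
def idComulR : D.left.LTensor →ₗ[k] D.TripleLR :=
  BalTensor.lift
    (TensorProduct.lift
      ((TripleTensor.ofRight D.left.tgtL D.left.srcL D.right.srcR D.right.tgtR).compl₂
        D.right.comul))
    (fun a m n => by
      simp only [TensorProduct.lift.tmul, LinearMap.compl₂_apply, LinearMap.mulLeft_apply]
      rw [← D.targetR_counitR_sourceL, D.right.comul_target_mul, D.targetR_counitR_sourceL]
      refine D.right.rInd (D.right.comul n) (by simp) (fun g h => ?_)
        (fun x y hx hy => by simp only [map_add, LinearMap.add_apply, hx, hy])
      rw [SourceTarget.rMul_mk, Algebra.TensorProduct.tmul_mul_tmul, one_mul]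
      exact TripleTensor.mk_balance_left (r := D.left.tgtL) (l := D.left.srcL)
        (r' := D.right.srcR) (l' := D.right.tgtR) a m g h)

/-- `μ ∘ (τ ⊗ id) : K ⊗_L K → K`, `g ⊗ h ↦ τ(g) h`. -/
def mulAntipodeId : D.left.LTensor →ₗ[k] K :=
  BalTensor.lift (LinearMap.mul' k K ∘ₗ TensorProduct.map D.antipodeLin LinearMap.id)
    (fun a m n => by
      simp [antipodeLin, D.antipode_targetL, mul_assoc])

/-- `μ ∘ (id ⊗ τ) : K ⊗_R K → K`, `g ⊗ h ↦ g τ(h)`. -/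
def mulIdAntipode : D.right.RTensor →ₗ[k] K :=
  BalTensor.lift (LinearMap.mul' k K ∘ₗ TensorProduct.map LinearMap.id D.antipodeLin)
    (fun a m n => by
      simp [antipodeLin, D.antipode_targetR, mul_assoc])

end HopfAlgebroidData

variable (k L R K)

/-- A symmetric Hopf algebroid with total algebra `K`, left base algebra `L` and right base
algebra `R`. -/
structure SymmetricHopfAlgebroid extends HopfAlgebroidData k L R K where
  mixed_coassoc_RL : ∀ x, toHopfAlgebroidData.comulRId (left.comul x) =
    toHopfAlgebroidData.idComulL (right.comul x)
  mixed_coassoc_LR : ∀ x, toHopfAlgebroidData.comulLId (right.comul x) =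
    toHopfAlgebroidData.idComulR (left.comul x)
  antipode_comulL : ∀ x, toHopfAlgebroidData.mulAntipodeId (left.comul x) =
    right.source (right.counit x)
  antipode_comulR : ∀ x, toHopfAlgebroidData.mulIdAntipode (right.comul x) =
    left.source (left.counit x)

variable {k L R K} {K' : Type*} [Ring K'] [Algebra k K']

/-- An algebra isomorphism `Ψ : K' → K` identifies two symmetric Hopf algebroids over the same
base algebras: all structure maps correspond to each other under `Ψ`. -/
structure SymmetricHopfAlgebroid.IdentifiedBy (S' : SymmetricHopfAlgebroid k L R K')
    (S : SymmetricHopfAlgebroid k L R K) (Ψ : K' ≃ₐ[k] K) : Prop where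
  sourceL : ∀ x, Ψ (S'.left.source x) = S.left.source x
  targetL : ∀ x, Ψ (S'.left.tgt x) = S.left.tgt x
  counitL : ∀ z, S.left.counit (Ψ z) = S'.left.counit z
  comulL : ∀ z, S.left.comul (Ψ z) =
    BalTensor.lift (S.left.lmk ∘ₗ TensorProduct.map Ψ.toLinearMap Ψ.toLinearMap)
      (fun a m n => by
        simp only [LinearMap.comp_apply, TensorProduct.map_tmul, LinearMap.mulLeft_apply,
          AlgEquiv.toLinearMap_apply, map_mul, targetL, sourceL]
        exact BalTensor.mk_balance (r := S.left.tgtL) (l := S.left.srcL) a _ _)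
      (S'.left.comul z)
  sourceR : ∀ y, Ψ (S'.right.source y) = S.right.source y
  targetR : ∀ y, Ψ (S'.right.tgt y) = S.right.tgt y
  counitR : ∀ z, S.right.counit (Ψ z) = S'.right.counit z
  comulR : ∀ z, S.right.comul (Ψ z) =
    BalTensor.lift (S.right.rmk ∘ₗ TensorProduct.map Ψ.toLinearMap Ψ.toLinearMap)
      (fun a m n => by
        simp only [LinearMap.comp_apply, TensorProduct.map_tmul, LinearMap.mulRight_apply,
          AlgEquiv.toLinearMap_apply, map_mul, targetR, sourceR]
        exact BalTensor.mk_balance (r := S.right.srcR) (l := S.right.tgtR) a _ _)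
      (S'.right.comul z)
  antipode : ∀ z, S.antipodeLin (Ψ z) = Ψ (S'.antipodeLin z)

end HopfAlgebroids

/-! ### Module algebras, smash products, Yetter-Drinfeld module algebras -/

section Smash

variable (k H : Type*) [Field k] [Ring H] [Bialgebra k H]

/-- A left `H`-module algebra structure on `L`; `act h a` is `h ▸ a`. -/
structure LeftModuleAlgebra (L : Type*) [Ring L] [Algebra k L] where
  act : H →ₗ[k] L →ₗ[k] L
  one_act : ∀ a, act 1 a = a
  mul_act : ∀ g h a, act (g * h) a = act g (act h a)
  /-- `h ▸ (a b) = (h₁ ▸ a)(h₂ ▸ b)` -/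
  act_mul : ∀ h a b, act h (a * b) =
    LinearMap.mul' k L (TensorProduct.map (act.flip a) (act.flip b) (Coalgebra.comul h))
  act_one : ∀ h, act h 1 = (Coalgebra.counit h : k) • (1 : L)

/-- A right `H`-module algebra structure on `R`; `act a h` is `a ◂ h`. -/
structure RightModuleAlgebra (R : Type*) [Ring R] [Algebra k R] where
  act : R →ₗ[k] H →ₗ[k] R
  act_one : ∀ a, act a 1 = a
  act_mul : ∀ a g h, act a (g * h) = act (act a g) h
  /-- `(a b) ◂ h = (a ◂ h₁)(b ◂ h₂)` -/
  mul_act : ∀ a b h, act (a * b) h =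
    LinearMap.mul' k R (TensorProduct.map (act a) (act b) (Coalgebra.comul h))
  one_act : ∀ h, act 1 h = (Coalgebra.counit h : k) • (1 : R)

variable {k H}

namespace LeftModuleAlgebra

variable {L : Type*} [Ring L] [Algebra k L] (X : LeftModuleAlgebra k H L)

/-- The smash product `L ♯ H`, with underlying vector space `L ⊗ H`. -/
def Smash (_ : LeftModuleAlgebra k H L) : Type _ := L ⊗[k] H

instance : AddCommGroup X.Smash := inferInstanceAs (AddCommGroup (L ⊗[k] H))
instance : Module k X.Smash := inferInstanceAs (Module k (L ⊗[k] H))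

/-- An element of `L ⊗ H` as an element of `L ♯ H`. -/
def ofTensor : L ⊗[k] H ≃ₗ[k] X.Smash := LinearEquiv.refl k _

/-- `a ♯ h` -/
def tmul : L →ₗ[k] H →ₗ[k] X.Smash := (TensorProduct.mk k L H).compr₂ X.ofTensor.toLinearMap

/-- The operator `b ⊗ g ↦ (h₁ ▸ b) ⊗ h₂ g`. -/
def hopfOp : H →ₗ[k] Module.End k (L ⊗[k] H) :=
  TensorProduct.map₂ X.act (LinearMap.mul k H) ∘ₗ Coalgebra.comul

/-- The operator `b ⊗ g ↦ a b ⊗ g`. -/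
def algOp (_ : LeftModuleAlgebra k H L) : L →ₗ[k] Module.End k (L ⊗[k] H) :=
  LinearMap.rTensorHom H ∘ₗ LinearMap.mul k L

/-- The multiplication `(a ⊗ h)(b ⊗ g) = a (h₁ ▸ b) ⊗ h₂ g`. -/
def mulLin : L ⊗[k] H →ₗ[k] L ⊗[k] H →ₗ[k] L ⊗[k] H :=
  TensorProduct.lift ((LinearMap.mul k (Module.End k (L ⊗[k] H))).compl₁₂ X.algOp X.hopfOp)

theorem mulLin_tmul (a : L) (h : H) (t : L ⊗[k] H) :
    X.mulLin (a ⊗ₜ h) t = X.algOp a (X.hopfOp h t) := rfl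

theorem hopfOp_mul (g h : H) : X.hopfOp (g * h) = X.hopfOp g * X.hopfOp h := by
  refine TensorProduct.ext' fun c f => ?_
  simp only [hopfOp, LinearMap.comp_apply, Bialgebra.comul_mul, Module.End.mul_apply]
  generalize (Coalgebra.comul g : H ⊗[k] H) = s
  generalize (Coalgebra.comul h : H ⊗[k] H) = t
  induction s with
  | zero => simp
  | add x y hx hy => simp only [add_mul, map_add, LinearMap.add_apply, hx, hy]
  | tmul x y =>
    induction t with
    | zero => simp
    | add x y hx hy => simp only [mul_add, map_add, LinearMap.add_apply, hx, hy]
    | tmul z w => simp [X.mul_act, mul_assoc]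

theorem hopfOp_one : X.hopfOp 1 = 1 := by
  refine TensorProduct.ext' fun c f => ?_
  simp [hopfOp, X.one_act, Algebra.TensorProduct.one_def]

theorem algOp_mul (a b : L) : X.algOp (a * b) = X.algOp a * X.algOp b := by
  refine TensorProduct.ext' fun c f => ?_
  simp [algOp, mul_assoc]

theorem algOp_one : X.algOp 1 = 1 := by
  refine TensorProduct.ext' fun c f => ?_
  simp [algOp]

theorem mulLin_algOp (a : L) (s : L ⊗[k] H) : X.mulLin (X.algOp a s) = X.algOp a * X.mulLin s := by
  induction s with
  | zero => simp
  | add x y hx hy => simp only [map_add, mul_add, hx, hy]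
  | tmul b g =>
    refine LinearMap.ext fun t => ?_
    change X.mulLin ((a * b) ⊗ₜ g) t = _
    rw [mulLin_tmul, algOp_mul]
    rfl

theorem mulLin_hopfOp (h : H) (s : L ⊗[k] H) :
    X.mulLin (X.hopfOp h s) = X.hopfOp h * X.mulLin s := by
  induction s with
  | zero => simp
  | add x y hx hy => simp only [map_add, mul_add, hx, hy]
  | tmul b g =>
    suffices key : ∀ t, X.mulLin (X.hopfOp h (b ⊗ₜ 1)) t = X.hopfOp h (X.algOp b t) by
      refine LinearMap.ext fun t => ?_
      refine Eq.trans ?_ (key (X.hopfOp g t))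
      simp only [hopfOp, LinearMap.comp_apply]
      generalize (Coalgebra.comul h : H ⊗[k] H) = u
      induction u with
      | zero => simp
      | add x y hx hy => simp only [map_add, LinearMap.add_apply, hx, hy]
      | tmul x y =>
        simp only [TensorProduct.map₂_apply_tmul, TensorProduct.map_tmul, LinearMap.mul_apply',
          mul_one, mulLin_tmul, hopfOp_mul]
        rfl
    intro t
    induction t with
    | zero => simp
    | add x y hx hy => simp only [map_add, hx, hy]
    | tmul c f =>
      let F : H ⊗[k] (H ⊗[k] H) →ₗ[k] L ⊗[k] H :=
        TensorProduct.map (LinearMap.mul' k L ∘ₗ TensorProduct.map (X.act.flip b) (X.act.flip c))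
          (LinearMap.mulRight k f) ∘ₗ (TensorProduct.assoc k H H H).symm.toLinearMap
      have h1 : X.mulLin (X.hopfOp h (b ⊗ₜ 1)) (c ⊗ₜ f) =
          F (Coalgebra.comul.lTensor H (Coalgebra.comul h)) := by
        simp only [hopfOp, LinearMap.comp_apply]
        generalize (Coalgebra.comul h : H ⊗[k] H) = u
        induction u with
        | zero => simp
        | add x y hx hy => simp only [map_add, LinearMap.add_apply, hx, hy]
        | tmul x y =>
          simp only [TensorProduct.map₂_apply_tmul, TensorProduct.map_tmul, LinearMap.mul_apply',
            mul_one, mulLin_tmul, LinearMap.lTensor_tmul, hopfOp, LinearMap.comp_apply]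
          generalize (Coalgebra.comul y : H ⊗[k] H) = v
          induction v with
          | zero => simp
          | add x y hx hy =>
            simp only [map_add, LinearMap.add_apply, TensorProduct.tmul_add, hx, hy]
          | tmul z w => simp [F, algOp]
      have h2 : X.hopfOp h (X.algOp b (c ⊗ₜ f)) =
          F (TensorProduct.assoc k H H H (Coalgebra.comul.rTensor H (Coalgebra.comul h))) := by
        simp only [hopfOp, LinearMap.comp_apply]
        generalize (Coalgebra.comul h : H ⊗[k] H) = u
        induction u with
        | zero => simp
        | add x y hx hy => simp only [map_add, LinearMap.add_apply, hx, hy]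
        | tmul x y => simp [F, algOp, X.act_mul]
      rw [h1, h2, Coalgebra.coassoc_apply]

theorem mulLin_assoc (s t u : L ⊗[k] H) :
    X.mulLin (X.mulLin s t) u = X.mulLin s (X.mulLin t u) := by
  induction s with
  | zero => simp
  | add x y hx hy => simp only [map_add, LinearMap.add_apply, hx, hy]
  | tmul a h => rw [mulLin_tmul, mulLin_algOp, mulLin_hopfOp]; rfl

theorem one_mulLin (t : L ⊗[k] H) : X.mulLin (1 ⊗ₜ 1) t = t := by
  rw [mulLin_tmul, hopfOp_one, algOp_one]; rfl

theorem mulLin_one (t : L ⊗[k] H) : X.mulLin t (1 ⊗ₜ 1) = t := by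
  induction t with
  | zero => simp
  | add x y hx hy => simp only [map_add, LinearMap.add_apply, hx, hy]
  | tmul a h =>
    have : X.hopfOp h (1 ⊗ₜ 1) = 1 ⊗ₜ h := by
      have h1 : (1 : L) ⊗ₜ[k] h = TensorProduct.map (Algebra.linearMap k L) LinearMap.id
          (Coalgebra.counit.rTensor H (Coalgebra.comul (R := k) h)) := by
        rw [Coalgebra.rTensor_counit_comul]; simp
      rw [h1]
      simp only [hopfOp, LinearMap.comp_apply]
      generalize (Coalgebra.comul h : H ⊗[k] H) = u
      induction u with
      | zero => simp
      | add x y hx hy => simp only [map_add, LinearMap.add_apply, hx, hy]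
      | tmul x y => simp [X.act_one, Algebra.algebraMap_eq_smul_one]
    rw [mulLin_tmul, this]
    simp [algOp]

instance : Ring X.Smash :=
  { (inferInstance : AddCommGroup X.Smash) with
    mul := fun s t => X.mulLin s t
    one := X.tmul 1 1
    mul_assoc := X.mulLin_assoc
    one_mul := X.one_mulLin
    mul_one := X.mulLin_one
    left_distrib := fun s t u => map_add (X.mulLin s) t u
    right_distrib := fun s t u => LinearMap.map_add₂ X.mulLin s t u
    zero_mul := fun t => LinearMap.map_zero₂ X.mulLin t
    mul_zero := fun s => map_zero (X.mulLin s) }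

instance : Algebra k X.Smash :=
  Algebra.ofModule (fun c s t => LinearMap.map_smul₂ X.mulLin c s t)
    (fun c s t => map_smul (X.mulLin s) c t)

/-- The embedding `L → L ♯ H`, `a ↦ a ♯ 1`. -/
def inAlg : L →ₗ[k] X.Smash := X.tmul.flip 1

/-- The embedding `H → L ♯ H`, `h ↦ 1 ♯ h`. -/
def inHopf : H →ₗ[k] X.Smash := X.tmul 1

end LeftModuleAlgebra

namespace RightModuleAlgebra

variable {R : Type*} [Ring R] [Algebra k R] (Y : RightModuleAlgebra k H R)

/-- The smash product `H ♯ R`, with underlying vector space `H ⊗ R`. -/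
def Smash (_ : RightModuleAlgebra k H R) : Type _ := H ⊗[k] R

instance : AddCommGroup Y.Smash := inferInstanceAs (AddCommGroup (H ⊗[k] R))
instance : Module k Y.Smash := inferInstanceAs (Module k (H ⊗[k] R))

/-- An element of `H ⊗ R` as an element of `H ♯ R`. -/
def ofTensor : H ⊗[k] R ≃ₗ[k] Y.Smash := LinearEquiv.refl k _

/-- `h ♯ a` -/
def tmul : H →ₗ[k] R →ₗ[k] Y.Smash := (TensorProduct.mk k H R).compr₂ Y.ofTensor.toLinearMap

/-- The operator `g ⊗ a ↦ g h₁ ⊗ (a ◂ h₂)`. -/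
def hopfOp : H →ₗ[k] Module.End k (H ⊗[k] R) :=
  (TensorProduct.map₂ (LinearMap.mul k H) Y.act).flip ∘ₗ Coalgebra.comul

/-- The operator `g ⊗ b ↦ g ⊗ b a`. -/
def algOp (_ : RightModuleAlgebra k H R) : R →ₗ[k] Module.End k (H ⊗[k] R) :=
  LinearMap.lTensorHom H ∘ₗ (LinearMap.mul k R).flip

/-- The multiplication `(g ⊗ b)(h ⊗ a) = g h₁ ⊗ (b ◂ h₂) a`, with the right factor as the first
argument: `Y.rmulLin t s` is `s t`. -/
def rmulLin : H ⊗[k] R →ₗ[k] H ⊗[k] R →ₗ[k] H ⊗[k] R :=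
  TensorProduct.lift
    ((LinearMap.mul k (Module.End k (H ⊗[k] R))).flip.compl₁₂ Y.hopfOp Y.algOp)

theorem rmulLin_tmul (h : H) (a : R) (s : H ⊗[k] R) :
    Y.rmulLin (h ⊗ₜ a) s = Y.algOp a (Y.hopfOp h s) := rfl

theorem hopfOp_mul (g h : H) : Y.hopfOp (g * h) = Y.hopfOp h * Y.hopfOp g := by
  refine TensorProduct.ext' fun f c => ?_
  simp only [hopfOp, LinearMap.comp_apply, Bialgebra.comul_mul, Module.End.mul_apply,
    LinearMap.flip_apply]
  generalize (Coalgebra.comul g : H ⊗[k] H) = s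
  generalize (Coalgebra.comul h : H ⊗[k] H) = t
  induction s with
  | zero => simp
  | add x y hx hy => simp only [add_mul, map_add, LinearMap.add_apply, hx, hy]
  | tmul x y =>
    induction t with
    | zero => simp
    | add x y hx hy => simp only [mul_add, map_add, hx, hy]
    | tmul z w => simp [Y.act_mul, mul_assoc]

theorem hopfOp_one : Y.hopfOp 1 = 1 := by
  refine TensorProduct.ext' fun f c => ?_
  simp [hopfOp, Y.act_one, Algebra.TensorProduct.one_def]

theorem algOp_mul (a b : R) : Y.algOp (a * b) = Y.algOp b * Y.algOp a := by
  refine TensorProduct.ext' fun f c => ?_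
  simp [algOp, mul_assoc]

theorem algOp_one : Y.algOp 1 = 1 := by
  refine TensorProduct.ext' fun f c => ?_
  simp [algOp]

theorem rmulLin_algOp (a : R) (t : H ⊗[k] R) :
    Y.rmulLin (Y.algOp a t) = Y.algOp a * Y.rmulLin t := by
  induction t with
  | zero => simp
  | add x y hx hy => simp only [map_add, mul_add, hx, hy]
  | tmul g b =>
    refine LinearMap.ext fun s => ?_
    change Y.rmulLin (g ⊗ₜ (b * a)) s = _
    rw [rmulLin_tmul, algOp_mul]
    rfl

theorem rmulLin_hopfOp (h : H) (t : H ⊗[k] R) :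
    Y.rmulLin (Y.hopfOp h t) = Y.hopfOp h * Y.rmulLin t := by
  induction t with
  | zero => simp
  | add x y hx hy => simp only [map_add, mul_add, hx, hy]
  | tmul g b =>
    suffices key : ∀ s, Y.rmulLin (Y.hopfOp h (1 ⊗ₜ b)) s = Y.hopfOp h (Y.algOp b s) by
      refine LinearMap.ext fun s => ?_
      refine Eq.trans ?_ (key (Y.hopfOp g s))
      simp only [hopfOp, LinearMap.comp_apply, LinearMap.flip_apply]
      generalize (Coalgebra.comul h : H ⊗[k] H) = u
      induction u with
      | zero => simp
      | add x y hx hy => simp only [map_add, LinearMap.add_apply, hx, hy]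
      | tmul x y =>
        simp only [TensorProduct.map₂_apply_tmul, TensorProduct.map_tmul, LinearMap.mul_apply',
          one_mul, rmulLin_tmul, hopfOp_mul]
        rfl
    intro s
    induction s with
    | zero => simp
    | add x y hx hy => simp only [map_add, hx, hy]
    | tmul f c =>
      let F : H ⊗[k] (H ⊗[k] H) →ₗ[k] H ⊗[k] R :=
        TensorProduct.map (LinearMap.mulLeft k f)
          (LinearMap.mul' k R ∘ₗ TensorProduct.map (Y.act c) (Y.act b))
      have h1 : Y.rmulLin (Y.hopfOp h (1 ⊗ₜ b)) (f ⊗ₜ c) =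
          F (TensorProduct.assoc k H H H (Coalgebra.comul.rTensor H (Coalgebra.comul h))) := by
        simp only [hopfOp, LinearMap.comp_apply, LinearMap.flip_apply]
        generalize (Coalgebra.comul h : H ⊗[k] H) = u
        induction u with
        | zero => simp
        | add x y hx hy => simp only [map_add, LinearMap.add_apply, hx, hy]
        | tmul x y =>
          simp only [TensorProduct.map₂_apply_tmul, TensorProduct.map_tmul, LinearMap.mul_apply',
            one_mul, rmulLin_tmul, LinearMap.rTensor_tmul, hopfOp, LinearMap.comp_apply,
            LinearMap.flip_apply]
          generalize (Coalgebra.comul x : H ⊗[k] H) = v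
          induction v with
          | zero => simp
          | add x y hx hy =>
            simp only [map_add, TensorProduct.add_tmul, hx, hy]
          | tmul z w => simp [F, algOp]
      have h2 : Y.hopfOp h (Y.algOp b (f ⊗ₜ c)) =
          F (Coalgebra.comul.lTensor H (Coalgebra.comul h)) := by
        simp only [hopfOp, LinearMap.comp_apply, LinearMap.flip_apply]
        generalize (Coalgebra.comul h : H ⊗[k] H) = u
        induction u with
        | zero => simp
        | add x y hx hy => simp only [map_add, hx, hy]
        | tmul x y => simp [F, algOp, Y.mul_act]
      rw [h1, h2, Coalgebra.coassoc_apply]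

theorem rmulLin_assoc (s t u : H ⊗[k] R) :
    Y.rmulLin u (Y.rmulLin t s) = Y.rmulLin (Y.rmulLin u t) s := by
  induction u with
  | zero => simp
  | add x y hx hy => simp only [map_add, LinearMap.add_apply, hx, hy]
  | tmul h a => rw [rmulLin_tmul, rmulLin_tmul, rmulLin_algOp, rmulLin_hopfOp]; rfl

theorem rmulLin_one (s : H ⊗[k] R) : Y.rmulLin (1 ⊗ₜ 1) s = s := by
  rw [rmulLin_tmul, hopfOp_one, algOp_one]; rfl

theorem one_rmulLin (t : H ⊗[k] R) : Y.rmulLin t (1 ⊗ₜ 1) = t := by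
  induction t with
  | zero => simp
  | add x y hx hy => simp only [map_add, LinearMap.add_apply, hx, hy]
  | tmul h a =>
    have : Y.hopfOp h (1 ⊗ₜ 1) = h ⊗ₜ 1 := by
      have h1 : h ⊗ₜ[k] (1 : R) = TensorProduct.map LinearMap.id (Algebra.linearMap k R)
          (Coalgebra.counit.lTensor H (Coalgebra.comul (R := k) h)) := by
        rw [Coalgebra.lTensor_counit_comul]; simp
      rw [h1]
      simp only [hopfOp, LinearMap.comp_apply, LinearMap.flip_apply]
      generalize (Coalgebra.comul h : H ⊗[k] H) = u
      induction u with
      | zero => simp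
      | add x y hx hy => simp only [map_add, hx, hy]
      | tmul x y => simp [Y.one_act, Algebra.algebraMap_eq_smul_one]
    rw [rmulLin_tmul, this]
    simp [algOp]

instance : Ring Y.Smash :=
  { (inferInstance : AddCommGroup Y.Smash) with
    mul := fun s t => Y.rmulLin t s
    one := Y.tmul 1 1
    mul_assoc := Y.rmulLin_assoc
    one_mul := Y.one_rmulLin
    mul_one := Y.rmulLin_one
    left_distrib := fun s t u => LinearMap.map_add₂ Y.rmulLin t u s
    right_distrib := fun s t u => map_add (Y.rmulLin u) s t
    zero_mul := fun t => map_zero (Y.rmulLin t)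
    mul_zero := fun s => LinearMap.map_zero₂ Y.rmulLin s }

instance : Algebra k Y.Smash :=
  Algebra.ofModule (fun c s t => map_smul (Y.rmulLin t) c s)
    (fun c s t => LinearMap.map_smul₂ Y.rmulLin c t s)

/-- The embedding `R → H ♯ R`, `a ↦ 1 ♯ a`. -/
def inAlg : R →ₗ[k] Y.Smash := Y.tmul 1

/-- The embedding `H → H ♯ R`, `h ↦ h ♯ 1`. -/
def inHopf : H →ₗ[k] Y.Smash := Y.tmul.flip 1

end RightModuleAlgebra

variable (k H)

/-- A left-right Yetter-Drinfeld module algebra structure on `L`: a left `H`-module algebra with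
a right `H`-coaction `a ↦ a_[0] ⊗ a_[1]`. -/
structure LeftRightYetterDrinfeld (L : Type*) [Ring L] [Algebra k L] extends
    LeftModuleAlgebra k H L where
  coact : L →ₗ[k] L ⊗[k] H
  coact_coassoc : ∀ a, TensorProduct.assoc k L H H (coact.rTensor H (coact a)) =
    Coalgebra.comul.lTensor L (coact a)
  coact_counit : ∀ a, TensorProduct.rid k L (Coalgebra.counit.lTensor L (coact a)) = a
  /-- `(h₁ ▸ a_[0]) ⊗ h₂ a_[1] = (h₂ ▸ a)_[0] ⊗ (h₂ ▸ a)_[1] h₁` -/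
  yetter_drinfeld : ∀ h a,
    TensorProduct.map₂ act (LinearMap.mul k H) (Coalgebra.comul h) (coact a) =
      TensorProduct.lift ((LinearMap.lTensorHom L ∘ₗ (LinearMap.mul k H).flip).compl₂
        (coact ∘ₗ act.flip a)) (Coalgebra.comul h)
  /-- `(a b)_[0] ⊗ (a b)_[1] = a_[0] b_[0] ⊗ b_[1] a_[1]` -/
  coact_mul : ∀ a b, coact (a * b) =
    TensorProduct.map₂ (LinearMap.mul k L) (LinearMap.mul k H).flip (coact a) (coact b)
  coact_one : coact 1 = 1 ⊗ₜ 1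

/-- A right-left Yetter-Drinfeld module algebra structure on `R`: a right `H`-module algebra with
a left `H`-coaction `a ↦ a_[-1] ⊗ a_[0]`. -/
structure RightLeftYetterDrinfeld (R : Type*) [Ring R] [Algebra k R] extends
    RightModuleAlgebra k H R where
  coact : R →ₗ[k] H ⊗[k] R
  coact_coassoc : ∀ a, TensorProduct.assoc k H H R (Coalgebra.comul.rTensor R (coact a)) =
    coact.lTensor H (coact a)
  coact_counit : ∀ a, TensorProduct.lid k R (Coalgebra.counit.rTensor R (coact a)) = a
  /-- `a_[-1] h₁ ⊗ (a_[0] ◂ h₂) = h₂ (a ◂ h₁)_[-1] ⊗ (a ◂ h₁)_[0]` -/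
  yetter_drinfeld : ∀ h a,
    TensorProduct.map₂ (LinearMap.mul k H) act (coact a) (Coalgebra.comul h) =
      TensorProduct.lift ((LinearMap.rTensorHom R ∘ₗ LinearMap.mul k H).compl₂
        (coact ∘ₗ act a)).flip (Coalgebra.comul h)
  /-- `(a b)_[-1] ⊗ (a b)_[0] = b_[-1] a_[-1] ⊗ a_[0] b_[0]` -/
  coact_mul : ∀ a b, coact (a * b) =
    TensorProduct.map₂ (LinearMap.mul k H).flip (LinearMap.mul k R) (coact a) (coact b)
  coact_one : coact 1 = 1 ⊗ₜ 1

variable {k H}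

/-- `x_[0] (x_[1] ▸ a) = a x` -/
def LeftRightYetterDrinfeld.BraidedCommutative {L : Type*} [Ring L] [Algebra k L]
    (X : LeftRightYetterDrinfeld k H L) : Prop :=
  ∀ a x, LinearMap.mul' k L ((X.act.flip a).lTensor L (X.coact x)) = a * x

/-- `(a ◂ y_[-1]) y_[0] = y a` -/
def RightLeftYetterDrinfeld.BraidedCommutative {R : Type*} [Ring R] [Algebra k R]
    (Y : RightLeftYetterDrinfeld k H R) : Prop :=
  ∀ a y, LinearMap.mul' k R ((Y.act a).rTensor R (Y.coact y)) = y * a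

end Smash

section Compatibility

/-- The coaction as a map `ρ : L → L ♯ H`, `a ↦ a_[0] ♯ a_[1]`. -/
def LeftRightYetterDrinfeld.rho {k H L : Type*} [Field k] [Ring H] [Bialgebra k H] [Ring L]
    [Algebra k L] (X : LeftRightYetterDrinfeld k H L) : L →ₗ[k] X.Smash :=
  X.ofTensor.toLinearMap ∘ₗ X.coact

/-- The coaction as a map `λ : R → H ♯ R`, `a ↦ a_[-1] ♯ a_[0]`. -/
def RightLeftYetterDrinfeld.lam {k H R : Type*} [Field k] [Ring H] [Bialgebra k H] [Ring R]
    [Algebra k R] (Y : RightLeftYetterDrinfeld k H R) : R →ₗ[k] Y.Smash :=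
  Y.ofTensor.toLinearMap ∘ₗ Y.coact

variable {k H L R : Type*} [Field k] [Ring H] [HopfAlgebra k H] [Ring L] [Algebra k L]
  [Ring R] [Algebra k R]

/-- An algebra antiisomorphism `R → L` as a linear bijection. -/
def antiLin (θ : R ≃ₐ[k] Lᵐᵒᵖ) : R ≃ₗ[k] L :=
  θ.toLinearEquiv.trans (MulOpposite.opLinearEquiv k).symm

/-- Compatibility of the structures on `L` and `R` via an antiisomorphism `θ : R → L`. -/
structure CompatibleVia (X : LeftRightYetterDrinfeld k H L) (Y : RightLeftYetterDrinfeld k H R)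
    (θ : R ≃ₐ[k] Lᵐᵒᵖ) : Prop where
  /-- `θ(y ◂ f) = S f ▸ θ(y)` -/
  act : ∀ y f, antiLin θ (Y.act y f) = X.act (HopfAlgebra.antipode k f) (antiLin θ y)
  /-- `θ(y)_[0] ⊗ θ(y)_[1] = θ(y_[0]) ⊗ S(y_[-1])` -/
  coact : ∀ y, X.coact (antiLin θ y) =
    TensorProduct.map (antiLin θ).toLinearMap (HopfAlgebra.antipode k)
      (TensorProduct.comm k H R (Y.coact y))

end Compatibility

end

noncomputable section

/-! ### Sweedler sums -/

section Sweedler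

variable {k : Type*} [CommRing k] {M N P Q M' N' : Type*}
  [AddCommGroup M] [Module k M] [AddCommGroup N] [Module k N]
  [AddCommGroup P] [Module k P] [AddCommGroup Q] [Module k Q]
  [AddCommGroup M'] [Module k M'] [AddCommGroup N'] [Module k N']

/-! The whole argument takes place inside a single algebra `K` that factors in two ways. A left
factorization presents `K` by subalgebras L and H with the rule h a = (h₁ ▸ a) h₂ and with
multiplication L ⊗ H → K bijective. Put ρ(x) = x_[0] x_[1] in `K`. Braided commutativity says that
ρ(x) commutes with L, whence ρ is antimultiplicative and may serve as a target map. The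
Yetter-Drinfeld condition says h ρ(x) = ρ(h₂ ▸ x) h₁, which is exactly what makes left
multiplication by h₁ ⊗ h₂ well defined on K ⊗_L K. This gives an action of `K` on K ⊗_L K, and Δ(z)
is z applied to the class of 1 ⊗ 1. The mirror image gives a right bialgebroid from any
factorization of `K` as H ♯ R.

The antiisomorphism θ turns a left factorization into a right one on the same `K`: the copy of R is
y ↦ ρ(θ(y)) (`inR_mul_inH`). The isomorphism Ψ is the resulting map out of H ♯ R. Its inverse sends
x to θ⁻¹(x_[0]) S(x_[1]); the two composites cancel by the antipode identities, so only S and never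
its inverse occurs.

By construction the image of α_R is the image of ρ = β_L. Conversely the target λ(y) = y_[-1]
ρ(θ(y_[0])) of the right structure unfolds to an adjoint action and equals y_[-1] ▸ θ(y_[0]) ∈ L
(`toRight_lam`). Every element of L arises in this way (`targetAct_targetActInv`), so β_R and α_L
have the same image too. These two coincidences give the source-target-counit identities and show
that Δ_R(x f) is represented by the same tensor x f₁ ⊗ f₂ as Δ_L(x f). Mixed coassociativity is then
coassociativity of H. The antipode is f y ↦ θ(y) S(f), and its axioms reduce to those of S when each
is read in the factorization where the relevant element of L or R is inert.

The structure on H ♯ R is the same construction applied to the factorization pulled back along Ψ, so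
compatibility with Ψ is naturality.

Sweedler sums are taken over one chosen presentation of each tensor. Arbitrary functions may be
summed and sums interchanged freely; multilinearity is required only when one tensor is replaced by
another. -/

/-- The sum `∑ F mᵢ nᵢ` for a chosen presentation `∑ mᵢ ⊗ nᵢ` of a tensor. -/
def sweedler (t : M ⊗[k] N) (F : M → N → P) : P :=
  ∑ p ∈ (TensorProduct.exists_finset t).choose, F p.1 p.2

theorem map_sweedler {A B G : Type*} [AddCommGroup A] [AddCommGroup B] [FunLike G A B]
    [AddMonoidHomClass G A B]
    (f : G) (t : M ⊗[k] N) (F : M → N → A) :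
    f (sweedler t F) = sweedler t fun m n => f (F m n) :=
  map_sum f _ _

/-- The chosen presentation sums to `t`, so a linear summand forgets the choice. This is the bridge
between bundled axioms and Sweedler sums. -/
theorem sweedler_linear (T : M ⊗[k] N →ₗ[k] P) (t : M ⊗[k] N) :
    sweedler t (fun m n => T (m ⊗ₜ n)) = T t := by
  conv_rhs => rw [(TensorProduct.exists_finset t).choose_spec]
  rw [map_sum]
  rfl

theorem sweedler_comm {P : Type*} [AddCommGroup P] (t : M ⊗[k] N) (s : M' ⊗[k] N')
    (F : M → N → M' → N' → P) :
    (sweedler t fun a b => sweedler s fun c d => F a b c d) =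
      sweedler s fun c d => sweedler t fun a b => F a b c d :=
  Finset.sum_comm

theorem mul_sweedler {A : Type*} [Ring A] (z : A) (t : M ⊗[k] N) (F : M → N → A) :
    z * sweedler t F = sweedler t fun m n => z * F m n :=
  Finset.mul_sum _ _ _

theorem sweedler_mul {A : Type*} [Ring A] (z : A) (t : M ⊗[k] N) (F : M → N → A) :
    sweedler t F * z = sweedler t fun m n => F m n * z :=
  Finset.sum_mul _ _ _

theorem tmul_sweedler (z : P) (t : M ⊗[k] N) (F : M → N → Q) :
    z ⊗ₜ[k] sweedler t F = sweedler t fun m n => z ⊗ₜ F m n :=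
  TensorProduct.tmul_sum _ _ _

theorem sweedler_tmul (z : P) (t : M ⊗[k] N) (F : M → N → Q) :
    sweedler t F ⊗ₜ[k] z = sweedler t fun m n => F m n ⊗ₜ z :=
  TensorProduct.sum_tmul _ _ _

theorem sweedler_apply (z : P) (t : M ⊗[k] N) (F : M → N → P →ₗ[k] Q) :
    sweedler t F z = sweedler t fun m n => F m n z :=
  LinearMap.sum_apply _ _ _

theorem sweedler_smul (c : k) (t : M ⊗[k] N) (F : M → N → P) :
    sweedler t (fun m n => c • F m n) = c • sweedler t F :=
  (Finset.smul_sum).symm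

theorem sweedler_congr {P : Type*} [AddCommGroup P] {t : M ⊗[k] N}
    {F G : M → N → P} (h : ∀ m n, F m n = G m n) : sweedler t F = sweedler t G :=
  Finset.sum_congr rfl fun _ _ => h _ _

variable (k) in
/-- Bilinearity of an unbundled function. -/
structure IsBilin (F : M → N → P) : Prop where
  add_left : ∀ a b c, F (a + b) c = F a c + F b c
  smul_left : ∀ (r : k) a c, F (r • a) c = r • F a c
  add_right : ∀ a b c, F a (b + c) = F a b + F a c
  smul_right : ∀ (r : k) a c, F a (r • c) = r • F a c

variable (k) in
/-- Trilinearity of an unbundled function. -/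
structure IsTrilin (F : M → N → M' → P) : Prop where
  left : ∀ c, IsBilin k fun a b => F a b c
  right : ∀ a, IsBilin k fun b c => F a b c

/-- The bilinear map given by an unbundled one. -/
def IsBilin.toLin {F : M → N → P} (h : IsBilin k F) : M ⊗[k] N →ₗ[k] P :=
  TensorProduct.lift (LinearMap.mk₂ k F h.1 h.2 h.3 h.4)

theorem IsBilin.sweedler_eq {F : M → N → P} (h : IsBilin k F) (t : M ⊗[k] N) :
    sweedler t F = h.toLin t :=
  sweedler_linear h.toLin t

theorem IsBilin.sweedler_tmul_eq {F : M → N → P} (h : IsBilin k F) (m : M) (n : N) :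
    sweedler (m ⊗ₜ[k] n) F = F m n := by
  rw [h.sweedler_eq]; rfl

theorem IsBilin.sweedler_sweedler {F : M → N → P} (h : IsBilin k F) (t : M' ⊗[k] N')
    (f : M' → N' → M ⊗[k] N) :
    sweedler (sweedler t f) F = sweedler t fun a b => sweedler (f a b) F := by
  simp only [h.sweedler_eq, map_sweedler]

theorem IsBilin.sweedler_map {F : M → N → P} (h : IsBilin k F) (f : M' →ₗ[k] M)
    (g : N' →ₗ[k] N) (t : M' ⊗[k] N') :
    sweedler (TensorProduct.map f g t) F = sweedler t fun a b => F (f a) (g b) := by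
  rw [h.sweedler_eq]
  exact (sweedler_linear (h.toLin ∘ₗ TensorProduct.map f g) t).symm

theorem IsBilin.sweedler_swap {F : M → N → P} (h : IsBilin k F) (t : N ⊗[k] M) :
    sweedler (TensorProduct.comm k N M t) F = sweedler t fun b a => F a b := by
  rw [h.sweedler_eq]
  exact (sweedler_linear (h.toLin ∘ₗ (TensorProduct.comm k N M).toLinearMap) t).symm

/-- The linear map on a triple tensor product given by an unbundled trilinear map. -/
def IsTrilin.toLin {F : M → N → M' → P} (h : IsTrilin k F) : M ⊗[k] (N ⊗[k] M') →ₗ[k] P :=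
  TensorProduct.lift
    { toFun := fun a => (h.right a).toLin
      map_add' := fun a b => TensorProduct.ext' fun c d => (h.left d).add_left a b c
      map_smul' := fun r a => TensorProduct.ext' fun c d => (h.left d).smul_left r a c }

/-- An iterated sum uses a separate presentation for each inner tensor. Trilinearity removes this
dependence and leaves a linear map applied to a nested tensor, where coassociativity can be
rewritten; `IsTrilin.sweedler_left` treats the other bracketing. -/
theorem IsTrilin.sweedler_right {F : M → N → M' → P} (h : IsTrilin k F) (t : M ⊗[k] N')
    (f : N' →ₗ[k] N ⊗[k] M') :
    (sweedler t fun a b => sweedler (f b) fun c d => F a c d) = h.toLin (f.lTensor M t) := by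
  rw [← LinearMap.comp_apply, ← sweedler_linear]
  exact sweedler_congr fun a b => (h.right a).sweedler_eq (f b)

theorem IsTrilin.sweedler_left {F : M → N → M' → P} (h : IsTrilin k F) (t : N' ⊗[k] M')
    (f : N' →ₗ[k] M ⊗[k] N) :
    (sweedler t fun a b => sweedler (f a) fun c d => F c d b) =
      h.toLin (TensorProduct.assoc k M N M' (f.rTensor M' t)) := by
  refine Eq.trans ?_ (sweedler_linear
    (h.toLin ∘ₗ (TensorProduct.assoc k M N M').toLinearMap ∘ₗ f.rTensor M') t)
  refine sweedler_congr fun a b => ?_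
  refine Eq.trans ?_ (sweedler_linear (h.toLin ∘ₗ (TensorProduct.assoc k M N M').toLinearMap ∘ₗ
    (TensorProduct.mk k _ _).flip b) (f a))
  rfl

end Sweedler

/-! ### Coassociativity, counit and antipode identities as Sweedler sums -/

section SweedlerHopf

variable {k H : Type*} [Field k] [Ring H]

open Coalgebra HopfAlgebra

section Coalg

variable {C M : Type*} [AddCommGroup C] [Module k C] [Coalgebra k C] [AddCommGroup M] [Module k M]

theorem sweedler_coassoc (F : C → C → C → M) (h : C)
    -- Both sides choose different presentations, so trilinearity is indispensable. The default
    -- proof covers summands built from linear maps, products and tensors.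
    (hF : IsTrilin k F := by
      constructor <;> intro _ <;> constructor <;> intros <;>
        simp [TensorProduct.tmul_add, TensorProduct.add_tmul, mul_add, add_mul,
          ← TensorProduct.smul_tmul', TensorProduct.tmul_smul]) :
    (sweedler (comul (R := k) h) fun a b => sweedler (comul (R := k) a) fun c d => F c d b) =
      sweedler (comul (R := k) h) fun a b => sweedler (comul (R := k) b) fun c d => F a c d := by
  rw [hF.sweedler_left, hF.sweedler_right, coassoc_apply]

theorem sweedler_counit_left (f : C →ₗ[k] M) (h : C) :
    (sweedler (comul (R := k) h) fun a b => counit (R := k) a • f b) = f h := by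
  refine (sweedler_linear (f ∘ₗ (TensorProduct.lid k C).toLinearMap ∘ₗ
    (counit (R := k) (A := C)).rTensor C) (comul (R := k) h)) |> Eq.trans ?_ |>.trans ?_
  · exact sweedler_congr fun a b => by simp
  · simp [rTensor_counit_comul]

theorem sweedler_counit_right (f : C →ₗ[k] M) (h : C) :
    (sweedler (comul (R := k) h) fun a b => counit (R := k) b • f a) = f h := by
  refine (sweedler_linear (f ∘ₗ (TensorProduct.rid k C).toLinearMap ∘ₗ
    (counit (R := k) (A := C)).lTensor C) (comul (R := k) h)) |> Eq.trans ?_ |>.trans ?_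
  · exact sweedler_congr fun a b => by simp
  · simp [lTensor_counit_comul]

end Coalg

/-- Serves to unfold the axioms stated with `TensorProduct.map₂`, namely the Yetter-Drinfeld
condition and multiplicativity of the coactions. -/
theorem map₂_eq_sweedler {M N P M' N' P' : Type*}
    [AddCommGroup M] [Module k M] [AddCommGroup N] [Module k N] [AddCommGroup P] [Module k P]
    [AddCommGroup M'] [Module k M'] [AddCommGroup N'] [Module k N'] [AddCommGroup P'] [Module k P']
    (f : M →ₗ[k] N →ₗ[k] P) (g : M' →ₗ[k] N' →ₗ[k] P') (s : M ⊗[k] M') (t : N ⊗[k] N') :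
    TensorProduct.map₂ f g s t =
      sweedler s fun a b => sweedler t fun c d => f a c ⊗ₜ[k] g b d := by
  rw [← sweedler_linear (TensorProduct.map₂ f g), sweedler_apply]
  refine sweedler_congr fun a b => ?_
  rw [← sweedler_linear (TensorProduct.map₂ f g (a ⊗ₜ b))]
  rfl

variable [HopfAlgebra k H] {M : Type*} [AddCommGroup M] [Module k M]

theorem sweedler_antipode_mul (f : H →ₗ[k] M) (h : H) :
    (sweedler (comul (R := k) h) fun a b => f (antipode k a * b)) = counit (R := k) h • f 1 := by
  refine (sweedler_linear (f ∘ₗ LinearMap.mul' k H ∘ₗ (antipode k).rTensor H)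
    (comul (R := k) h)).trans ?_
  simp [Algebra.algebraMap_eq_smul_one]

theorem sweedler_mul_antipode (f : H →ₗ[k] M) (h : H) :
    (sweedler (comul (R := k) h) fun a b => f (a * antipode k b)) = counit (R := k) h • f 1 := by
  refine (sweedler_linear (f ∘ₗ LinearMap.mul' k H ∘ₗ (antipode k).lTensor H)
    (comul (R := k) h)).trans ?_
  simp [Algebra.algebraMap_eq_smul_one]

/-- `S(h₂) ⊗ S(h₁)` -/
def antipodeCop (k H : Type*) [Field k] [Ring H] [HopfAlgebra k H] : H →ₗ[k] H ⊗[k] H :=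
  TensorProduct.map (antipode k) (antipode k) ∘ₗ (TensorProduct.comm k H H).toLinearMap ∘ₗ comul

theorem antipodeCop_eq (h : H) : antipodeCop k H h =
    sweedler (comul (R := k) h) fun a b => antipode k b ⊗ₜ[k] antipode k a :=
  (sweedler_linear (TensorProduct.map (antipode k) (antipode k) ∘ₗ
    (TensorProduct.comm k H H).toLinearMap) (comul (R := k) h)).symm

theorem comul_eq_sweedler (h : H) :
    (comul (R := k) h : H ⊗[k] H) = sweedler (comul (R := k) h) fun a b => a ⊗ₜ[k] b :=
  (sweedler_linear LinearMap.id (comul (R := k) h)).symm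

/-- `antipodeCop` is a left convolution inverse of Δ: in S(h₂)h₃ ⊗ S(h₁)h₄ the first leg cancels,
and then the second. -/
theorem sweedler_antipodeCop_mul_comul (h : H) :
    (sweedler (comul (R := k) h) fun a b => antipodeCop k H a * comul (R := k) b) =
      counit (R := k) h • 1 := by
  simp only [antipodeCop_eq, sweedler_mul]
  rw [sweedler_coassoc (F := fun c d b => (antipode k d ⊗ₜ[k] antipode k c) * comul (R := k) b)]
  have key : ∀ c r : H, (sweedler (comul (R := k) r) fun d b =>
      (antipode k d ⊗ₜ[k] antipode k c) * comul (R := k) b) = 1 ⊗ₜ (antipode k c * r) := by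
    intro c r
    have h1 : ∀ d b : H, (antipode k d ⊗ₜ[k] antipode k c) * comul (R := k) b =
        sweedler (comul (R := k) b) fun e f => (antipode k d * e) ⊗ₜ[k] (antipode k c * f) := by
      intro d b
      conv_lhs => rw [comul_eq_sweedler b, mul_sweedler]
      simp only [Algebra.TensorProduct.tmul_mul_tmul]
    simp only [h1]
    rw [← sweedler_coassoc (F := fun d e f => (antipode k d * e) ⊗ₜ[k] (antipode k c * f))]
    have h2 : ∀ m f : H, (sweedler (comul (R := k) m) fun d e =>
        (antipode k d * e) ⊗ₜ[k] (antipode k c * f)) =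
        counit (R := k) m • ((1 : H) ⊗ₜ[k] (antipode k c * f)) := fun m f =>
      sweedler_antipode_mul ((TensorProduct.mk k H H).flip (antipode k c * f)) m
    simp only [h2]
    exact sweedler_counit_left (TensorProduct.mk k H H 1 ∘ₗ LinearMap.mulLeft k (antipode k c)) r
  simp only [key]
  exact sweedler_antipode_mul (TensorProduct.mk k H H 1) h

/-- Uniqueness of convolution inverses in Hom(H, H ⊗ H). Since Δ is multiplicative, Δ ∘ S is a right
inverse of Δ, while `antipodeCop` is a left inverse; bracketing their triple product with Δ in both
ways identifies them. -/
theorem comul_antipode (h : H) : comul (R := k) (antipode k h) = antipodeCop k H h := by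
  have h1 : ∀ q : H, (sweedler (comul (R := k) q) fun c d =>
      comul (R := k) c * comul (R := k) (antipode k d)) =
      counit (R := k) q • (1 : H ⊗[k] H) := fun q => by
    simp only [← Bialgebra.comul_mul]
    simpa using sweedler_mul_antipode (comul (R := k) (A := H)) q
  have h2 := sweedler_coassoc (k := k) (F := fun p c d : H =>
    antipodeCop k H p * comul (R := k) c * comul (R := k) (antipode k d)) h
  simp only [mul_assoc, ← mul_sweedler, h1] at h2
  simp only [← mul_assoc, ← sweedler_mul, sweedler_antipodeCop_mul_comul] at h2
  simp only [smul_mul_assoc, one_mul, mul_smul_comm, mul_one] at h2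
  exact ((sweedler_counit_left (comul (R := k) ∘ₗ antipode k) h).symm.trans h2).trans
    (sweedler_counit_right (antipodeCop k H) h)

theorem sweedler_comul_antipode {F : H → H → M} (hF : IsBilin k F) (h : H) :
    sweedler (comul (R := k) (antipode k h)) F =
      sweedler (comul (R := k) h) fun a b => F (antipode k b) (antipode k a) := by
  rw [comul_antipode, antipodeCop_eq, hF.sweedler_sweedler]
  exact sweedler_congr fun a b => hF.sweedler_tmul_eq _ _

end SweedlerHopf

/-! ### Factorizations of an algebra as a smash product `L ♯ H` -/

section LeftFactorization

open Coalgebra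

variable {k H L : Type*} [Field k] [Ring H] [Bialgebra k H] [Ring L] [Algebra k L]

theorem sweedler_coact_coassoc (X : LeftRightYetterDrinfeld k H L) {N : Type*}
    [AddCommGroup N] [Module k N] (F : L → H → H → N) (x : L)
    (hF : IsTrilin k F := by
      constructor <;> intro _ <;> constructor <;> intros <;>
        simp [TensorProduct.tmul_add, TensorProduct.add_tmul, mul_add, add_mul,
          ← TensorProduct.smul_tmul', TensorProduct.tmul_smul]) :
    (sweedler (X.coact x) fun v b => sweedler (X.coact v) fun u a => F u a b) =
      sweedler (X.coact x) fun u h => sweedler (comul (R := k) h) fun a b => F u a b := by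
  rw [hF.sweedler_left, hF.sweedler_right, X.coact_coassoc]

/-- Subalgebras `L` and `H` of `K` that present `K` as the smash product `L ♯ H`. -/
structure LeftSmashFactorization (X : LeftModuleAlgebra k H L) (K : Type*) [Ring K]
    [Algebra k K] where
  inL : L →ₐ[k] K
  inH : H →ₐ[k] K
  inH_mul_inL : ∀ h a, inH h * inL a =
    sweedler (comul (R := k) h) fun h₁ h₂ => inL (X.act h₁ a) * inH h₂
  bijective : Function.Bijective (TensorProduct.lift
    ((LinearMap.mul k K).compl₁₂ inL.toLinearMap inH.toLinearMap))

namespace LeftSmashFactorization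

variable {K : Type*} [Ring K] [Algebra k K]

section Basic

variable {X : LeftModuleAlgebra k H L} (M : LeftSmashFactorization X K)

/-- The bijection `L ⊗ H → K`, `a ⊗ h ↦ a h`. -/
def equiv : L ⊗[k] H ≃ₗ[k] K := LinearEquiv.ofBijective _ M.bijective

theorem equiv_tmul (a : L) (h : H) : M.equiv (a ⊗ₜ h) = M.inL a * M.inH h := rfl

theorem equiv_symm_mul (a : L) (h : H) : M.equiv.symm (M.inL a * M.inH h) = a ⊗ₜ h := by
  rw [← equiv_tmul, LinearEquiv.symm_apply_apply]

theorem lin_ext {N : Type*} [AddCommGroup N] [Module k N] {f g : K →ₗ[k] N}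
    (h : ∀ a b, f (M.inL a * M.inH b) = g (M.inL a * M.inH b)) : f = g := by
  have : f ∘ₗ M.equiv.toLinearMap = g ∘ₗ M.equiv.toLinearMap := TensorProduct.ext' h
  refine LinearMap.ext fun z => ?_
  obtain ⟨t, rfl⟩ := M.equiv.surjective z
  exact LinearMap.congr_fun this t

/-- The universal property of the smash product. -/
def desc {B : Type*} [Ring B] [Algebra k B] (p : L →ₐ[k] B) (q : H →ₐ[k] B)
    (hpq : ∀ h a, q h * p a =
      sweedler (comul (R := k) h) fun h₁ h₂ => p (X.act h₁ a) * q h₂) : K →ₐ[k] B :=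
  let f : K →ₗ[k] B := TensorProduct.lift
    ((LinearMap.mul k B).compl₁₂ p.toLinearMap q.toLinearMap) ∘ₗ M.equiv.symm.toLinearMap
  have hf : ∀ a h, f (M.inL a * M.inH h) = p a * q h := fun a h => by
    simp [f, equiv_symm_mul]
  -- Multiplicativity is an equality of bilinear maps, so products (a h)(b g) suffice. In source and
  -- target alike these are straightened by the same rule for moving h past b.
  AlgHom.ofLinearMap f (by simpa using hf 1 1) (by
    suffices (LinearMap.mul k K).compr₂ f = (LinearMap.mul k B).compl₁₂ f f from fun z w =>
      LinearMap.congr_fun₂ this z w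
    refine M.lin_ext fun a h => M.lin_ext fun b g => ?_
    simp only [LinearMap.compr₂_apply, LinearMap.compl₁₂_apply, LinearMap.mul_apply', hf]
    have h1 : M.inL a * M.inH h * (M.inL b * M.inH g) =
        sweedler (comul (R := k) h) fun h₁ h₂ => M.inL (a * X.act h₁ b) * M.inH (h₂ * g) := by
      rw [mul_assoc, ← mul_assoc (M.inH h), M.inH_mul_inL, sweedler_mul, mul_sweedler]
      simp only [map_mul, mul_assoc]
    have h2 : p a * q h * (p b * q g) =
        sweedler (comul (R := k) h) fun h₁ h₂ => p (a * X.act h₁ b) * q (h₂ * g) := by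
      rw [mul_assoc, ← mul_assoc (q h), hpq, sweedler_mul, mul_sweedler]
      simp only [map_mul, mul_assoc]
    rw [h1, h2, map_sweedler]
    simp only [hf])

theorem desc_mul {B : Type*} [Ring B] [Algebra k B] (p : L →ₐ[k] B) (q : H →ₐ[k] B) (hpq)
    (a : L) (h : H) : M.desc p q hpq (M.inL a * M.inH h) = p a * q h := by
  change (TensorProduct.lift _) (M.equiv.symm _) = _
  rw [equiv_symm_mul]
  rfl

end Basic

variable {X : LeftRightYetterDrinfeld k H L} (M : LeftSmashFactorization X.toLeftModuleAlgebra K)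

/-- The coaction `a ↦ a_[0] a_[1]` as a map `L → K`. -/
def rho : L →ₗ[k] K := M.equiv.toLinearMap ∘ₗ X.coact

theorem rho_eq (x : L) : M.rho x = sweedler (X.coact x) fun u h => M.inL u * M.inH h :=
  (sweedler_linear M.equiv.toLinearMap (X.coact x)).symm

theorem rho_one : M.rho 1 = 1 := by simp [rho, X.coact_one, equiv_tmul]

/-- Moving a to the left gives x_[0] (x_[1] ▸ a) x_[2]. Coassociativity of the coaction groups the
first two factors, and braided commutativity replaces them by a x_[0]. -/
theorem rho_mul_inL (hX : X.BraidedCommutative) (x a : L) :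
    M.rho x * M.inL a = M.inL a * M.rho x := by
  simp only [rho_eq, sweedler_mul, mul_sweedler, mul_assoc, M.inH_mul_inL]
  rw [← sweedler_coact_coassoc X (fun u c d => M.inL u * (M.inL (X.act c a) * M.inH d))]
  refine sweedler_congr fun v b => ?_
  simp only [← mul_assoc, ← map_mul, ← sweedler_mul, ← map_sweedler]
  congr 2
  rw [← hX a v]
  exact sweedler_linear (LinearMap.mul' k L ∘ₗ (X.act.flip a).lTensor L) (X.coact v)

/-- Because ρ(y) commutes with L, ρ(y) x_[0] x_[1] = x_[0] ρ(y) x_[1] = x_[0] y_[0] y_[1] x_[1]. The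
reversed order in the H-leg is the one in `coact_mul`. -/
theorem rho_mul (hX : X.BraidedCommutative) (x y : L) :
    M.rho (x * y) = M.rho y * M.rho x := by
  conv_rhs => rw [M.rho_eq x, mul_sweedler]
  simp only [← mul_assoc, M.rho_mul_inL hX]
  rw [show M.rho (x * y) = M.equiv (X.coact (x * y)) from rfl, X.coact_mul, map₂_eq_sweedler,
    map_sweedler]
  refine sweedler_congr fun u h => ?_
  rw [map_sweedler, rho_eq, mul_sweedler, sweedler_mul]
  simp [equiv_tmul, mul_assoc]

/-- The Yetter-Drinfeld condition. -/
theorem inH_mul_rho (h : H) (x : L) : M.inH h * M.rho x =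
    sweedler (comul (R := k) h) fun h₁ h₂ => M.rho (X.act h₂ x) * M.inH h₁ := by
  have h1 := congrArg M.equiv (X.yetter_drinfeld h x)
  rw [map₂_eq_sweedler, sweedler_comm, ← sweedler_linear (TensorProduct.lift _)] at h1
  simp only [map_sweedler] at h1
  refine (Eq.trans ?_ h1).trans ?_
  · rw [rho_eq, mul_sweedler]
    refine sweedler_congr fun u g => ?_
    rw [← mul_assoc, M.inH_mul_inL, sweedler_mul]
    simp [equiv_tmul, mul_assoc]
  · refine sweedler_congr fun p q => ?_
    change M.equiv ((LinearMap.mulRight k p).lTensor L (X.coact (X.act q x))) = _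
    rw [rho_eq, sweedler_mul, ← sweedler_linear ((LinearMap.mulRight k p).lTensor L), map_sweedler]
    simp [equiv_tmul, mul_assoc]

end LeftSmashFactorization
end LeftFactorization

/-! ### The left bialgebroid over L of a factorization L ♯ H -/

section LeftBialgebroidConstruction

open Coalgebra

/-- The endomorphism `t ↦ u t` of `K ⊗_A K`, for `u` with `u (β(a) m ⊗ n) = u (m ⊗ α(a) n)`. -/
def SourceTarget.lEnd {k A K : Type*} [Field k] [Ring A] [Algebra k A] [Ring K] [Algebra k K]
    (B : SourceTarget k A K) (u : K ⊗[k] K)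
    (hu : ∀ a m n, B.lmk (u * ((B.tgt a * m) ⊗ₜ n)) = B.lmk (u * (m ⊗ₜ (B.source a * n)))) :
    Module.End k B.LTensor :=
  BalTensor.lift (B.lmk ∘ₗ LinearMap.mulLeft k u) hu

theorem SourceTarget.lEnd_ext {k A K N : Type*} [Field k] [Ring A] [Algebra k A] [Ring K]
    [Algebra k K] [AddCommGroup N] [Module k N] {B : SourceTarget k A K} {f g : B.LTensor →ₗ[k] N}
    (h : ∀ t, f (B.lmk t) = g (B.lmk t)) : f = g := by
  refine LinearMap.ext fun x => ?_
  obtain ⟨t, rfl⟩ := BalTensor.mk_surjective x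
  exact h t

variable {k H L : Type*} [Field k] [Ring H] [Bialgebra k H] [Ring L] [Algebra k L]

namespace LeftSmashFactorization

variable {K : Type*} [Ring K] [Algebra k K] {X : LeftRightYetterDrinfeld k H L}
  (M : LeftSmashFactorization X.toLeftModuleAlgebra K) (hX : X.BraidedCommutative)

/-- The source `a ↦ a` and the target `a ↦ a_[0] a_[1]`. -/
def sourceTarget : SourceTarget k L K where
  source := M.inL
  target := AlgHom.ofLinearMap ((MulOpposite.opLinearEquiv k).toLinearMap ∘ₗ M.rho)
    (by simp [M.rho_one]) (fun x y => by simp [M.rho_mul hX])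
  commute a b := (M.rho_mul_inL hX b a).symm

theorem sourceTarget_source (a : L) : (M.sourceTarget hX).source a = M.inL a := rfl

theorem sourceTarget_tgt (a : L) : (M.sourceTarget hX).tgt a = M.rho a := rfl

/-- `h ↦ h₁ ⊗ h₂ ∈ K ⊗ K` -/
def comulH : H →ₐ[k] K ⊗[k] K :=
  (Algebra.TensorProduct.map M.inH M.inH).comp (Bialgebra.comulAlgHom k H)

theorem comulH_eq (h : H) : M.comulH h =
    sweedler (comul (R := k) h) fun a b => M.inH a ⊗ₜ M.inH b :=
  (sweedler_linear (Algebra.TensorProduct.map M.inH M.inH).toLinearMap (comul (R := k) h)).symm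

theorem lmk_balance (a : L) (m n : K) : (M.sourceTarget hX).lmk ((M.rho a * m) ⊗ₜ n) =
    (M.sourceTarget hX).lmk (m ⊗ₜ (M.inL a * n)) :=
  BalTensor.mk_balance (r := (M.sourceTarget hX).tgtL) (l := (M.sourceTarget hX).srcL) a m n

/-- This is where the Yetter-Drinfeld condition enters: h₁ρ(a) ⊗ h₂ = ρ(h₂ ▸ a)h₁ ⊗ h₃, balancing
turns this into h₁ ⊗ (h₂ ▸ a)h₃, and the second leg is h₂ a. -/
theorem comulH_balance (h : H) (a : L) (m n : K) :
    (M.sourceTarget hX).lmk (M.comulH h * ((M.rho a * m) ⊗ₜ n)) =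
      (M.sourceTarget hX).lmk (M.comulH h * (m ⊗ₜ (M.inL a * n))) := by
  simp only [comulH_eq, sweedler_mul, Algebra.TensorProduct.tmul_mul_tmul, ← mul_assoc,
    M.inH_mul_rho, M.inH_mul_inL, map_sweedler, sweedler_tmul, tmul_sweedler]
  rw [sweedler_coassoc fun c d b => (M.sourceTarget hX).lmk
    ((M.rho (X.act d a) * M.inH c * m) ⊗ₜ (M.inH b * n))]
  simp only [mul_assoc, lmk_balance]

/-- The element x passes through ρ(a) by `rho_mul_inL`, after which the relation is the defining
one. -/
theorem inL_balance (x a : L) (m n : K) :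
    (M.sourceTarget hX).lmk ((M.inL x ⊗ₜ 1) * ((M.rho a * m) ⊗ₜ n)) =
      (M.sourceTarget hX).lmk ((M.inL x ⊗ₜ 1) * (m ⊗ₜ (M.inL a * n))) := by
  simp only [Algebra.TensorProduct.tmul_mul_tmul, one_mul, ← mul_assoc, ← M.rho_mul_inL hX]
  simp only [mul_assoc, lmk_balance]

/-- Left multiplication by `a ⊗ 1` on `K ⊗_L K`. -/
def algMul (x : L) : Module.End k (M.sourceTarget hX).LTensor :=
  (M.sourceTarget hX).lEnd (M.inL x ⊗ₜ 1) (M.inL_balance hX x)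

theorem algMul_lmk (x : L) (t : K ⊗[k] K) : M.algMul hX x ((M.sourceTarget hX).lmk t) =
    (M.sourceTarget hX).lmk ((M.inL x ⊗ₜ 1) * t) := rfl

/-- Left multiplication by `h₁ ⊗ h₂` on `K ⊗_L K`. -/
def hopfMul (h : H) : Module.End k (M.sourceTarget hX).LTensor :=
  (M.sourceTarget hX).lEnd (M.comulH h) (M.comulH_balance hX h)

theorem hopfMul_lmk (h : H) (t : K ⊗[k] K) : M.hopfMul hX h ((M.sourceTarget hX).lmk t) =
    (M.sourceTarget hX).lmk (M.comulH h * t) := rfl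

/-- The left action of `K` on `K ⊗_L K`. -/
def action : K →ₐ[k] Module.End k (M.sourceTarget hX).LTensor :=
  M.desc
    (AlgHom.ofLinearMap
      { toFun := M.algMul hX
        map_add' := fun x y => SourceTarget.lEnd_ext fun t => by
          simp [algMul_lmk, TensorProduct.add_tmul, add_mul]
        map_smul' := fun c x => SourceTarget.lEnd_ext fun t => by
          simp [algMul_lmk, ← TensorProduct.smul_tmul'] }
      (SourceTarget.lEnd_ext fun t => by
        simp [algMul_lmk, ← Algebra.TensorProduct.one_def])
      (fun x y => SourceTarget.lEnd_ext fun t => by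
        simp [algMul_lmk, ← mul_assoc]))
    (AlgHom.ofLinearMap
      { toFun := M.hopfMul hX
        map_add' := fun x y => SourceTarget.lEnd_ext fun t => by
          simp [hopfMul_lmk, add_mul]
        map_smul' := fun c x => SourceTarget.lEnd_ext fun t => by
          simp [hopfMul_lmk] }
      (SourceTarget.lEnd_ext fun t => by simp [hopfMul_lmk])
      (fun x y => SourceTarget.lEnd_ext fun t => by simp [hopfMul_lmk, mul_assoc]))
    (fun h a => SourceTarget.lEnd_ext fun t => by
      rw [sweedler_apply]
      simp only [AlgHom.ofLinearMap_apply, LinearMap.coe_mk, AddHom.coe_mk, Module.End.mul_apply,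
        algMul_lmk, hopfMul_lmk, ← mul_assoc]
      simp only [← map_sweedler, ← sweedler_mul]
      -- The cross relation of the two actions already holds in K ⊗ K: (h₁ ⊗ h₂)(a ⊗ 1) = (h₁ ▸ a ⊗
      -- 1)(h₂ ⊗ h₃).
      congr 2
      simp only [comulH_eq, sweedler_mul, mul_sweedler, Algebra.TensorProduct.tmul_mul_tmul,
        mul_one, one_mul, M.inH_mul_inL, sweedler_tmul]
      exact sweedler_coassoc (fun c d b => (M.inL (X.act c a) * M.inH d) ⊗ₜ M.inH b) h)

theorem action_lmk (x : L) (h : H) (t : K ⊗[k] K) :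
    M.action hX (M.inL x * M.inH h) ((M.sourceTarget hX).lmk t) =
      (M.sourceTarget hX).lmk ((M.inL x ⊗ₜ 1) * M.comulH h * t) := by
  rw [action, desc_mul, mul_assoc]
  rfl

/-- `Δ(a h) = a h₁ ⊗ h₂` -/
def comulL : K →ₗ[k] (M.sourceTarget hX).LTensor :=
  (M.action hX).toLinearMap.flip ((M.sourceTarget hX).lmk 1)

theorem comulL_mul_mul (x : L) (h : H) : M.comulL hX (M.inL x * M.inH h) =
    (M.sourceTarget hX).lmk ((M.inL x ⊗ₜ 1) * M.comulH h) := by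
  refine (M.action_lmk hX x h 1).trans ?_
  rw [mul_one]

theorem comulL_eq (x : L) (h : H) : M.comulL hX (M.inL x * M.inH h) =
    sweedler (comul (R := k) h) fun a b =>
      (M.sourceTarget hX).lmk ((M.inL x * M.inH a) ⊗ₜ M.inH b) := by
  simp [comulL_mul_mul, comulH_eq, mul_sweedler, map_sweedler]

/-- Left multiplication by Δ(z) is thus an algebra action already at hand, which settles the axiom
`comul_action`. -/
theorem action_eq (z : K) (t : K ⊗[k] K) : M.action hX z ((M.sourceTarget hX).lmk t) =
    (M.sourceTarget hX).lMul (M.comulL hX z) t := by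
  suffices (M.action hX).toLinearMap.flip ((M.sourceTarget hX).lmk t) =
      ((M.sourceTarget hX).lMul.flip t) ∘ₗ M.comulL hX from LinearMap.congr_fun this z
  refine M.lin_ext fun x h => ?_
  refine (M.action_lmk hX x h t).trans ?_
  rw [LinearMap.comp_apply, comulL_mul_mul]
  rfl

theorem comulL_inL_mul (x : L) (z : K) : M.comulL hX (M.inL x * z) =
    (M.sourceTarget hX).lBimod x 1 (M.comulL hX z) := by
  suffices M.comulL hX ∘ₗ LinearMap.mulLeft k (M.inL x) =
      (M.sourceTarget hX).lBimod x 1 ∘ₗ M.comulL hX from LinearMap.congr_fun this z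
  refine M.lin_ext fun y h => ?_
  simp only [LinearMap.comp_apply, LinearMap.mulLeft_apply]
  rw [← mul_assoc, ← map_mul, comulL_eq, comulL_eq, map_sweedler]
  simp [sourceTarget_source, sourceTarget_tgt, M.rho_one, mul_assoc]

/-- For z = y h, Δ(ρ(x) z) is y x_[0] x_[1] h₁ ⊗ x_[2] h₂. The first leg contains ρ(x_[0]), which
commutes with y and crosses the tensor sign as x_[0]. There it meets the remaining H-factor and
rebuilds ρ(x). -/
theorem comulL_rho_mul (x : L) (z : K) : M.comulL hX (M.rho x * z) =
    (M.sourceTarget hX).lBimod 1 x (M.comulL hX z) := by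
  suffices M.comulL hX ∘ₗ LinearMap.mulLeft k (M.rho x) =
      (M.sourceTarget hX).lBimod 1 x ∘ₗ M.comulL hX from LinearMap.congr_fun this z
  refine M.lin_ext fun y h => ?_
  simp only [LinearMap.comp_apply, LinearMap.mulLeft_apply]
  rw [← mul_assoc, M.rho_mul_inL hX, comulL_eq, map_sweedler]
  have h1 : M.inL y * M.rho x * M.inH h =
      sweedler (X.coact x) fun u g => M.inL (y * u) * M.inH (g * h) := by
    rw [rho_eq, mul_sweedler, sweedler_mul]
    simp [mul_assoc]
  rw [h1, map_sweedler]
  have h2 : ∀ u g, M.comulL hX (M.inL (y * u) * M.inH (g * h)) =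
      sweedler (comul (R := k) g) fun c d => (M.sourceTarget hX).lmk
        ((M.inL (y * u) ⊗ₜ 1) * (M.inH c ⊗ₜ M.inH d) * M.comulH h) := fun u g => by
    rw [comulL_mul_mul, map_mul M.comulH, comulH_eq M g, sweedler_mul, mul_sweedler, map_sweedler]
    simp only [mul_assoc]
  simp only [h2]
  rw [← sweedler_coact_coassoc X fun u c d => (M.sourceTarget hX).lmk
        ((M.inL (y * u) ⊗ₜ 1) * (M.inH c ⊗ₜ M.inH d) * M.comulH h)]
  have h3 : ∀ v d, (sweedler (X.coact v) fun u c => (M.sourceTarget hX).lmk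
        ((M.inL (y * u) ⊗ₜ 1) * (M.inH c ⊗ₜ M.inH d) * M.comulH h)) =
      sweedler (comul (R := k) h) fun a b => (M.sourceTarget hX).lmk
        ((M.inL y * M.inH a) ⊗ₜ (M.inL v * M.inH d * M.inH b)) := fun v d => by
    have : ∀ a b, (M.sourceTarget hX).lmk
          ((M.inL y * M.inH a) ⊗ₜ (M.inL v * M.inH d * M.inH b)) =
        sweedler (X.coact v) fun u c => (M.sourceTarget hX).lmk
          ((M.inL (y * u) ⊗ₜ 1) * (M.inH c ⊗ₜ M.inH d) * (M.inH a ⊗ₜ M.inH b)) := fun a b => by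
      -- Balancing over L trades v on the right for ρ(v) on the left, and ρ(v) then moves past y.
      rw [mul_assoc (M.inL v), ← lmk_balance, ← mul_assoc (M.rho v), M.rho_mul_inL hX, rho_eq,
        mul_sweedler, sweedler_mul, sweedler_tmul, map_sweedler]
      simp [mul_assoc]
    simp only [this]
    rw [sweedler_comm]
    refine sweedler_congr fun u c => ?_
    rw [comulH_eq, mul_sweedler, map_sweedler]
  simp only [h3]
  rw [sweedler_comm]
  refine sweedler_congr fun a b => ?_
  rw [SourceTarget.lBimod_mk, sourceTarget_source, sourceTarget_tgt, map_one, one_mul, rho_eq,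
    sweedler_mul, tmul_sweedler, map_sweedler]

/-- `ε(a h) = ε(h) a` -/
def counitL : K →ₗ[k] L :=
  (TensorProduct.rid k L).toLinearMap ∘ₗ (counit (R := k) (A := H)).lTensor L ∘ₗ
    M.equiv.symm.toLinearMap

theorem counitL_mul (x : L) (h : H) :
    M.counitL (M.inL x * M.inH h) = counit (R := k) h • x := by
  simp [counitL, equiv_symm_mul]

theorem counitL_rho (x : L) : M.counitL (M.rho x) = x := by
  simp [counitL, rho, X.coact_counit]

/-- The action of `K` on `L`, `(a h) · x = a (h ▸ x)`. -/
def actionBase : K →ₐ[k] Module.End k L :=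
  M.desc (Algebra.lmul k L)
    (AlgHom.ofLinearMap X.act (LinearMap.ext X.one_act)
      (fun g h => LinearMap.ext (X.mul_act g h)))
    (fun h a => LinearMap.ext fun b => by
      rw [sweedler_apply]
      refine (X.act_mul h a b).trans ?_
      exact (sweedler_linear (LinearMap.mul' k L ∘ₗ TensorProduct.map (X.act.flip a)
        (X.act.flip b)) (comul (R := k) h)).symm)

theorem actionBase_mul (x : L) (h : H) (a : L) :
    M.actionBase (M.inL x * M.inH h) a = x * X.act h a := by
  rw [actionBase, desc_mul]
  rfl

/-- The action axiom for the counit thereby reduces to multiplicativity of `actionBase`. -/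
theorem counitL_mul_inL (z : K) (a : L) : M.counitL (z * M.inL a) = M.actionBase z a := by
  suffices M.counitL ∘ₗ LinearMap.mulRight k (M.inL a) = M.actionBase.toLinearMap.flip a from
    LinearMap.congr_fun this z
  refine M.lin_ext fun x h => ?_
  refine Eq.trans ?_ (M.actionBase_mul x h a).symm
  rw [LinearMap.comp_apply, LinearMap.mulRight_apply, mul_assoc, M.inH_mul_inL, mul_sweedler,
    map_sweedler]
  simp only [← mul_assoc, ← map_mul, counitL_mul]
  exact sweedler_counit_right (LinearMap.mulLeft k x ∘ₗ X.act.flip a) h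

theorem counitL_inL_mul (a : L) (z : K) : M.counitL (M.inL a * z) = a * M.counitL z := by
  suffices M.counitL ∘ₗ LinearMap.mulLeft k (M.inL a) = LinearMap.mulLeft k a ∘ₗ M.counitL from
    LinearMap.congr_fun this z
  refine M.lin_ext fun x h => ?_
  simp only [LinearMap.comp_apply, LinearMap.mulLeft_apply]
  rw [← mul_assoc, ← map_mul, counitL_mul, counitL_mul, mul_smul_comm]

include hX in
-- In ρ(a) x h the factor ρ(a) passes x. The counit of H is multiplicative and ε(a_[1]) a_[0] = a,
-- so a ends up on the right of x.
theorem counitL_rho_mul (a : L) (z : K) : M.counitL (M.rho a * z) = M.counitL z * a := by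
  suffices M.counitL ∘ₗ LinearMap.mulLeft k (M.rho a) = LinearMap.mulRight k a ∘ₗ M.counitL from
    LinearMap.congr_fun this z
  refine M.lin_ext fun x h => ?_
  simp only [LinearMap.comp_apply, LinearMap.mulLeft_apply, LinearMap.mulRight_apply]
  rw [← mul_assoc, M.rho_mul_inL hX, mul_assoc, counitL_inL_mul, counitL_mul, rho_eq, sweedler_mul,
    map_sweedler, smul_mul_assoc]
  simp only [mul_assoc, ← map_mul, counitL_mul, Bialgebra.counit_mul]
  have h1 : (sweedler (X.coact a) fun (u : L) (g : H) => counit (R := k) g • u) = a := by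
    conv_rhs => rw [← X.coact_counit a]
    exact sweedler_linear ((TensorProduct.rid k L).toLinearMap ∘ₗ
      (counit (R := k) (A := H)).lTensor L) (X.coact a)
  have h2 : ∀ (u : L) (g : H), (counit (R := k) g * counit (R := k) h) • u =
      counit (R := k) h • (counit (R := k) g • u : L) := fun u g => by
    rw [smul_smul, mul_comm]
  simp only [h2]
  rw [sweedler_smul, h1, mul_smul_comm]

/-- The `L`-coring `L ♯ H`. -/
abbrev leftCoring : LeftCoringData k L K where
  toSourceTarget := M.sourceTarget hX
  comul := M.comulL hX
  counit := M.counitL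
  comul_bimod a b z := by
    rw [sourceTarget_source, sourceTarget_tgt, mul_assoc, comulL_inL_mul, comulL_rho_mul]
    refine (M.sourceTarget hX).lInd (M.comulL hX z) (by simp) (fun g h => ?_)
      (fun x y hx hy => by simp only [map_add, hx, hy])
    simp [SourceTarget.tgt_one]
  counit_bimod a b z := by
    rw [sourceTarget_source, sourceTarget_tgt, mul_assoc, counitL_inL_mul, counitL_rho_mul M hX,
      mul_assoc]

/-- Both sides are represented by x h₁ ⊗ h₂ ⊗ h₃, so this is coassociativity of H. -/
theorem leftCoring_coassoc : (M.leftCoring hX).comulId ∘ₗ M.comulL hX =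
    (M.leftCoring hX).idComul ∘ₗ M.comulL hX := by
  refine M.lin_ext fun x h => ?_
  simp only [LinearMap.comp_apply, comulL_eq, map_sweedler]
  have h1 : ∀ a b, (M.leftCoring hX).comulId
      ((M.sourceTarget hX).lmk ((M.inL x * M.inH a) ⊗ₜ M.inH b)) =
      sweedler (comul (R := k) a) fun c d => TripleTensor.mk _ _ _ _
        ((M.inL x * M.inH c) ⊗ₜ[k] (M.inH d ⊗ₜ[k] M.inH b)) := fun a b => by
    change TripleTensor.ofLeft _ _ _ _ (M.comulL hX (M.inL x * M.inH a)) (M.inH b) = _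
    rw [comulL_eq, map_sweedler, sweedler_apply]
    rfl
  have h2 : ∀ a b, (M.leftCoring hX).idComul
      ((M.sourceTarget hX).lmk ((M.inL x * M.inH a) ⊗ₜ M.inH b)) =
      sweedler (comul (R := k) b) fun c d => TripleTensor.mk _ _ _ _
        ((M.inL x * M.inH a) ⊗ₜ[k] (M.inH c ⊗ₜ[k] M.inH d)) := fun a b => by
    change TripleTensor.ofRight _ _ _ _ (M.inL x * M.inH a) (M.comulL hX (M.inH b)) = _
    rw [← one_mul (M.inH b), ← map_one M.inL, comulL_eq, map_sweedler]
    simp only [map_one, one_mul]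
    rfl
  simp only [h1, h2]
  exact sweedler_coassoc (fun c d b => TripleTensor.mk _ _ _ _
    ((M.inL x * M.inH c) ⊗ₜ[k] (M.inH d ⊗ₜ[k] M.inH b))) h

theorem leftCoring_counitId : (M.leftCoring hX).counitId ∘ₗ M.comulL hX = LinearMap.id := by
  refine M.lin_ext fun x h => ?_
  simp only [LinearMap.comp_apply, comulL_eq, map_sweedler]
  have h1 : ∀ a b, (M.leftCoring hX).counitId
      ((M.sourceTarget hX).lmk ((M.inL x * M.inH a) ⊗ₜ M.inH b)) =
      counit (R := k) a • (M.inL x * M.inH b) := fun a b => by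
    change M.inL (M.counitL (M.inL x * M.inH a)) * M.inH b = _
    rw [counitL_mul, map_smul, smul_mul_assoc]
  simp only [h1]
  exact sweedler_counit_left (LinearMap.mulLeft k (M.inL x) ∘ₗ M.inH.toLinearMap) h

theorem leftCoring_idCounit : (M.leftCoring hX).idCounit ∘ₗ M.comulL hX = LinearMap.id := by
  refine M.lin_ext fun x h => ?_
  simp only [LinearMap.comp_apply, comulL_eq, map_sweedler]
  have h1 : ∀ a b, (M.leftCoring hX).idCounit
      ((M.sourceTarget hX).lmk ((M.inL x * M.inH a) ⊗ₜ M.inH b)) =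
      counit (R := k) b • (M.inL x * M.inH a) := fun a b => by
    change M.rho (M.counitL (M.inH b)) * (M.inL x * M.inH a) = _
    rw [← one_mul (M.inH b), ← map_one M.inL, counitL_mul, map_smul, rho_one, smul_mul_assoc,
      one_mul]
  simp only [h1]
  exact sweedler_counit_right (LinearMap.mulLeft k (M.inL x) ∘ₗ M.inH.toLinearMap) h

/-- The left bialgebroid `L ♯ H` over `L`. -/
abbrev leftBialgebroid : LeftBialgebroid k L K where
  toLeftCoringData := M.leftCoring hX
  coassoc := LinearMap.congr_fun (M.leftCoring_coassoc hX)
  counit_comul := LinearMap.congr_fun (M.leftCoring_counitId hX)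
  comul_counit := LinearMap.congr_fun (M.leftCoring_idCounit hX)
  comul_action := ⟨M.action hX, M.action_eq hX⟩
  counit_action_one a := by
    change M.counitL (1 * M.inL a) = a
    simpa using M.counitL_mul a 1
  counit_action_mul x y a := by
    change M.counitL (x * y * M.inL a) = M.counitL (x * M.inL (M.counitL (y * M.inL a)))
    simp only [counitL_mul_inL, map_mul, Module.End.mul_apply]

end LeftSmashFactorization

end LeftBialgebroidConstruction

/-! ### Factorizations of an algebra as a smash product `H ♯ R` -/

section RightFactorization

open Coalgebra

theorem unop_sweedler {k M N A : Type*} [CommRing k] [AddCommGroup M] [Module k M]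
    [AddCommGroup N] [Module k N] [AddCommGroup A] (t : M ⊗[k] N) (F : M → N → Aᵐᵒᵖ) :
    (sweedler t F).unop = sweedler t fun m n => (F m n).unop :=
  map_sweedler MulOpposite.opAddEquiv.symm t F

variable {k H R : Type*} [Field k] [Ring H] [Bialgebra k H] [Ring R] [Algebra k R]

theorem sweedler_coact_coassoc' (Y : RightLeftYetterDrinfeld k H R) {N : Type*}
    [AddCommGroup N] [Module k N] (F : H → H → R → N) (x : R)
    (hF : IsTrilin k F := by
      constructor <;> intro _ <;> constructor <;> intros <;>
        simp [TensorProduct.tmul_add, TensorProduct.add_tmul, mul_add, add_mul,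
          ← TensorProduct.smul_tmul', TensorProduct.tmul_smul]) :
    (sweedler (Y.coact x) fun b v => sweedler (Y.coact v) fun a u => F b a u) =
      sweedler (Y.coact x) fun h u => sweedler (comul (R := k) h) fun a b => F a b u := by
  rw [hF.sweedler_left, hF.sweedler_right, Y.coact_coassoc]

/-- Subalgebras `H` and `R` of `K` that present `K` as the smash product `H ♯ R`. -/
structure RightSmashFactorization (Y : RightModuleAlgebra k H R) (K : Type*) [Ring K]
    [Algebra k K] where
  inH : H →ₐ[k] K
  inR : R →ₐ[k] K
  inR_mul_inH : ∀ a h, inR a * inH h =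
    sweedler (comul (R := k) h) fun h₁ h₂ => inH h₁ * inR (Y.act a h₂)
  bijective : Function.Bijective (TensorProduct.lift
    ((LinearMap.mul k K).compl₁₂ inH.toLinearMap inR.toLinearMap))

namespace RightSmashFactorization

variable {K : Type*} [Ring K] [Algebra k K]

section Basic

variable {Y : RightModuleAlgebra k H R} (M : RightSmashFactorization Y K)

/-- The bijection `H ⊗ R → K`, `h ⊗ a ↦ h a`. -/
def equiv : H ⊗[k] R ≃ₗ[k] K := LinearEquiv.ofBijective _ M.bijective

theorem equiv_tmul (h : H) (a : R) : M.equiv (h ⊗ₜ a) = M.inH h * M.inR a := rfl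

theorem equiv_symm_mul (h : H) (a : R) : M.equiv.symm (M.inH h * M.inR a) = h ⊗ₜ a := by
  rw [← equiv_tmul, LinearEquiv.symm_apply_apply]

theorem lin_ext {N : Type*} [AddCommGroup N] [Module k N] {f g : K →ₗ[k] N}
    (h : ∀ b a, f (M.inH b * M.inR a) = g (M.inH b * M.inR a)) : f = g := by
  have : f ∘ₗ M.equiv.toLinearMap = g ∘ₗ M.equiv.toLinearMap := TensorProduct.ext' h
  refine LinearMap.ext fun z => ?_
  obtain ⟨t, rfl⟩ := M.equiv.surjective z
  exact LinearMap.congr_fun this t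

/-- The universal property of the smash product. -/
def desc {B : Type*} [Ring B] [Algebra k B] (q : H →ₐ[k] B) (p : R →ₐ[k] B)
    (hpq : ∀ a h, p a * q h =
      sweedler (comul (R := k) h) fun h₁ h₂ => q h₁ * p (Y.act a h₂)) : K →ₐ[k] B :=
  let f : K →ₗ[k] B := TensorProduct.lift
    ((LinearMap.mul k B).compl₁₂ q.toLinearMap p.toLinearMap) ∘ₗ M.equiv.symm.toLinearMap
  have hf : ∀ h a, f (M.inH h * M.inR a) = q h * p a := fun h a => by
    simp [f, equiv_symm_mul]
  AlgHom.ofLinearMap f (by simpa using hf 1 1) (by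
    suffices (LinearMap.mul k K).compr₂ f = (LinearMap.mul k B).compl₁₂ f f from fun z w =>
      LinearMap.congr_fun₂ this z w
    refine M.lin_ext fun h a => M.lin_ext fun g b => ?_
    simp only [LinearMap.compr₂_apply, LinearMap.compl₁₂_apply, LinearMap.mul_apply', hf]
    have h1 : M.inH h * M.inR a * (M.inH g * M.inR b) =
        sweedler (comul (R := k) g) fun g₁ g₂ => M.inH (h * g₁) * M.inR (Y.act a g₂ * b) := by
      rw [mul_assoc, ← mul_assoc (M.inR a), M.inR_mul_inH, sweedler_mul, mul_sweedler]
      simp only [map_mul, mul_assoc]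
    have h2 : q h * p a * (q g * p b) =
        sweedler (comul (R := k) g) fun g₁ g₂ => q (h * g₁) * p (Y.act a g₂ * b) := by
      rw [mul_assoc, ← mul_assoc (p a), hpq, sweedler_mul, mul_sweedler]
      simp only [map_mul, mul_assoc]
    rw [h1, h2, map_sweedler]
    simp only [hf])

theorem desc_mul {B : Type*} [Ring B] [Algebra k B] (q : H →ₐ[k] B) (p : R →ₐ[k] B) (hpq)
    (h : H) (a : R) : M.desc q p hpq (M.inH h * M.inR a) = q h * p a := by
  change (TensorProduct.lift _) (M.equiv.symm _) = _
  rw [equiv_symm_mul]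
  rfl

end Basic

variable {Y : RightLeftYetterDrinfeld k H R}
  (M : RightSmashFactorization Y.toRightModuleAlgebra K)

/-- The coaction `a ↦ a_[-1] a_[0]` as a map `R → K`. -/
def lam : R →ₗ[k] K := M.equiv.toLinearMap ∘ₗ Y.coact

theorem lam_eq (x : R) : M.lam x = sweedler (Y.coact x) fun h u => M.inH h * M.inR u :=
  (sweedler_linear M.equiv.toLinearMap (Y.coact x)).symm

theorem lam_one : M.lam 1 = 1 := by simp [lam, Y.coact_one, equiv_tmul]

/-- Mirror image of `rho_mul_inL`: straightening produces x_[-2] (a ◂ x_[-1]) x_[0], and braided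
commutativity acts on the last two factors. -/
theorem inR_mul_lam (hY : Y.BraidedCommutative) (a x : R) :
    M.inR a * M.lam x = M.lam x * M.inR a := by
  simp only [lam_eq, sweedler_mul, mul_sweedler, ← mul_assoc, M.inR_mul_inH]
  rw [← sweedler_coact_coassoc' Y (fun c d u => M.inH c * M.inR (Y.act a d) * M.inR u)]
  refine sweedler_congr fun b v => ?_
  simp only [mul_assoc, ← map_mul, ← mul_sweedler, ← map_sweedler]
  congr 2
  rw [← hY a v]
  exact sweedler_linear (LinearMap.mul' k R ∘ₗ (Y.act a).rTensor R) (Y.coact v)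

/-- In y_[-1] y_[0] λ(x) the factor λ(x) passes y_[0], giving y_[-1] x_[-1] x_[0] y_[0]. -/
theorem lam_mul (hY : Y.BraidedCommutative) (x y : R) :
    M.lam (x * y) = M.lam y * M.lam x := by
  conv_rhs => rw [M.lam_eq y, sweedler_mul]
  simp only [mul_assoc, M.inR_mul_lam hY]
  rw [show M.lam (x * y) = M.equiv (Y.coact (x * y)) from rfl, Y.coact_mul, map₂_eq_sweedler,
    sweedler_comm, map_sweedler]
  refine sweedler_congr fun g v => ?_
  rw [map_sweedler, lam_eq, sweedler_mul, mul_sweedler]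
  simp [equiv_tmul, mul_assoc]

/-- The Yetter-Drinfeld condition. -/
theorem lam_mul_inH (x : R) (h : H) : M.lam x * M.inH h =
    sweedler (comul (R := k) h) fun h₁ h₂ => M.inH h₂ * M.lam (Y.act x h₁) := by
  have h1 := congrArg M.equiv (Y.yetter_drinfeld h x)
  rw [map₂_eq_sweedler, ← sweedler_linear (TensorProduct.lift _)] at h1
  simp only [map_sweedler] at h1
  refine (Eq.trans ?_ h1).trans ?_
  · rw [lam_eq, sweedler_mul]
    refine sweedler_congr fun g u => ?_
    rw [mul_assoc, M.inR_mul_inH, mul_sweedler]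
    simp [equiv_tmul, mul_assoc]
  · refine sweedler_congr fun p q => ?_
    change M.equiv ((LinearMap.mulLeft k q).rTensor R (Y.coact (Y.act x p))) = _
    rw [lam_eq, mul_sweedler, ← sweedler_linear ((LinearMap.mulLeft k q).rTensor R), map_sweedler]
    simp [equiv_tmul, mul_assoc]

end RightSmashFactorization
end RightFactorization

/-! ### The right bialgebroid over R of a factorization H ♯ R -/

section RightBialgebroidConstruction

open Coalgebra

/-- The endomorphism `t ↦ t u` of `K ⊗_A K`, for `u` with `(m α(a) ⊗ n) u = (m ⊗ n β(a)) u`. -/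
def SourceTarget.rEnd {k A K : Type*} [Field k] [Ring A] [Algebra k A] [Ring K] [Algebra k K]
    (B : SourceTarget k A K) (u : K ⊗[k] K)
    (hu : ∀ a m n, B.rmk (((m * B.source a) ⊗ₜ n) * u) = B.rmk ((m ⊗ₜ (n * B.tgt a)) * u)) :
    Module.End k B.RTensor :=
  BalTensor.lift (B.rmk ∘ₗ LinearMap.mulRight k u) hu

theorem SourceTarget.rEnd_ext {k A K N : Type*} [Field k] [Ring A] [Algebra k A] [Ring K]
    [Algebra k K] [AddCommGroup N] [Module k N] {B : SourceTarget k A K} {f g : B.RTensor →ₗ[k] N}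
    (h : ∀ t, f (B.rmk t) = g (B.rmk t)) : f = g := by
  refine LinearMap.ext fun x => ?_
  obtain ⟨t, rfl⟩ := BalTensor.mk_surjective x
  exact h t

variable {k H R : Type*} [Field k] [Ring H] [Bialgebra k H] [Ring R] [Algebra k R]

namespace RightSmashFactorization

variable {K : Type*} [Ring K] [Algebra k K] {Y : RightLeftYetterDrinfeld k H R}
  (M : RightSmashFactorization Y.toRightModuleAlgebra K) (hY : Y.BraidedCommutative)

/-- The source `a ↦ a` and the target `a ↦ a_[-1] a_[0]`. -/
def sourceTarget : SourceTarget k R K where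
  source := M.inR
  target := AlgHom.ofLinearMap ((MulOpposite.opLinearEquiv k).toLinearMap ∘ₗ M.lam)
    (by simp [M.lam_one]) (fun x y => by simp [M.lam_mul hY])
  commute a b := M.inR_mul_lam hY a b

theorem sourceTarget_source (a : R) : (M.sourceTarget hY).source a = M.inR a := rfl

theorem sourceTarget_tgt (a : R) : (M.sourceTarget hY).tgt a = M.lam a := rfl

/-- `h ↦ h₁ ⊗ h₂ ∈ K ⊗ K` -/
def comulH : H →ₐ[k] K ⊗[k] K :=
  (Algebra.TensorProduct.map M.inH M.inH).comp (Bialgebra.comulAlgHom k H)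

theorem comulH_eq (h : H) : M.comulH h =
    sweedler (comul (R := k) h) fun a b => M.inH a ⊗ₜ M.inH b :=
  (sweedler_linear (Algebra.TensorProduct.map M.inH M.inH).toLinearMap (comul (R := k) h)).symm

theorem rmk_balance (a : R) (m n : K) : (M.sourceTarget hY).rmk ((m * M.inR a) ⊗ₜ n) =
    (M.sourceTarget hY).rmk (m ⊗ₜ (n * M.lam a)) :=
  BalTensor.mk_balance (r := (M.sourceTarget hY).srcR) (l := (M.sourceTarget hY).tgtR) a m n

/-- The right-left Yetter-Drinfeld condition says precisely that right multiplication by h₁ ⊗ h₂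
respects the balancing: both sides become h₁ ⊗ λ(a)h₂ after sliding a ◂ h₂ across. -/
theorem comulH_balance (h : H) (a : R) (m n : K) :
    (M.sourceTarget hY).rmk (((m * M.inR a) ⊗ₜ n) * M.comulH h) =
      (M.sourceTarget hY).rmk ((m ⊗ₜ (n * M.lam a)) * M.comulH h) := by
  simp only [comulH_eq, mul_sweedler, Algebra.TensorProduct.tmul_mul_tmul, mul_assoc,
    M.lam_mul_inH, M.inR_mul_inH, map_sweedler, sweedler_tmul, tmul_sweedler]
  rw [← sweedler_coassoc fun p c d => (M.sourceTarget hY).rmk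
    ((m * M.inH p) ⊗ₜ (n * (M.inH d * M.lam (Y.act a c))))]
  simp only [← mul_assoc, rmk_balance]

theorem inR_balance (x a : R) (m n : K) :
    (M.sourceTarget hY).rmk (((m * M.inR a) ⊗ₜ n) * (1 ⊗ₜ M.inR x)) =
      (M.sourceTarget hY).rmk ((m ⊗ₜ (n * M.lam a)) * (1 ⊗ₜ M.inR x)) := by
  simp only [Algebra.TensorProduct.tmul_mul_tmul, mul_one, mul_assoc, ← M.inR_mul_lam hY]
  simp only [← mul_assoc, rmk_balance]

/-- Right multiplication by `1 ⊗ a` on `K ⊗_R K`. -/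
def algMul (x : R) : Module.End k (M.sourceTarget hY).RTensor :=
  (M.sourceTarget hY).rEnd (1 ⊗ₜ M.inR x) (M.inR_balance hY x)

theorem algMul_rmk (x : R) (t : K ⊗[k] K) : M.algMul hY x ((M.sourceTarget hY).rmk t) =
    (M.sourceTarget hY).rmk (t * (1 ⊗ₜ M.inR x)) := rfl

/-- Right multiplication by `h₁ ⊗ h₂` on `K ⊗_R K`. -/
def hopfMul (h : H) : Module.End k (M.sourceTarget hY).RTensor :=
  (M.sourceTarget hY).rEnd (M.comulH h) (M.comulH_balance hY h)

theorem hopfMul_rmk (h : H) (t : K ⊗[k] K) : M.hopfMul hY h ((M.sourceTarget hY).rmk t) =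
    (M.sourceTarget hY).rmk (t * M.comulH h) := rfl

/-- The right action of `K` on `K ⊗_R K`. -/
def action : K →ₐ[k] (Module.End k (M.sourceTarget hY).RTensor)ᵐᵒᵖ :=
  M.desc
    (AlgHom.ofLinearMap
      ((MulOpposite.opLinearEquiv k).toLinearMap ∘ₗ
      { toFun := M.hopfMul hY
        map_add' := fun x y => SourceTarget.rEnd_ext fun t => by
          simp [hopfMul_rmk, mul_add]
        map_smul' := fun c x => SourceTarget.rEnd_ext fun t => by
          simp [hopfMul_rmk] })
      (MulOpposite.unop_injective <| SourceTarget.rEnd_ext fun t => by simp [hopfMul_rmk])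
      (fun x y => MulOpposite.unop_injective <| SourceTarget.rEnd_ext fun t => by
        simp [hopfMul_rmk, mul_assoc]))
    (AlgHom.ofLinearMap
      ((MulOpposite.opLinearEquiv k).toLinearMap ∘ₗ
      { toFun := M.algMul hY
        map_add' := fun x y => SourceTarget.rEnd_ext fun t => by
          simp [algMul_rmk, TensorProduct.tmul_add, mul_add]
        map_smul' := fun c x => SourceTarget.rEnd_ext fun t => by
          simp [algMul_rmk, TensorProduct.tmul_smul] })
      (MulOpposite.unop_injective <| SourceTarget.rEnd_ext fun t => by
        simp [algMul_rmk, ← Algebra.TensorProduct.one_def])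
      (fun x y => MulOpposite.unop_injective <| SourceTarget.rEnd_ext fun t => by
        simp [algMul_rmk, mul_assoc]))
    (fun a h => MulOpposite.unop_injective <| SourceTarget.rEnd_ext fun t => by
      rw [unop_sweedler, sweedler_apply]
      simp only [AlgHom.ofLinearMap_apply, LinearMap.coe_mk, AddHom.coe_mk, Module.End.mul_apply,
        LinearMap.comp_apply, LinearEquiv.coe_coe, MulOpposite.coe_opLinearEquiv,
        MulOpposite.unop_mul, MulOpposite.unop_op, algMul_rmk, hopfMul_rmk, mul_assoc]
      simp only [← map_sweedler, ← mul_sweedler]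
      congr 2
      simp only [comulH_eq, sweedler_mul, mul_sweedler, Algebra.TensorProduct.tmul_mul_tmul,
        mul_one, one_mul, M.inR_mul_inH, tmul_sweedler]
      exact (sweedler_coassoc (fun c d b => M.inH c ⊗ₜ (M.inH d * M.inR (Y.act a b))) h).symm)

theorem action_rmk (h : H) (x : R) (t : K ⊗[k] K) :
    (M.action hY (M.inH h * M.inR x)).unop ((M.sourceTarget hY).rmk t) =
      (M.sourceTarget hY).rmk (t * (M.comulH h * (1 ⊗ₜ M.inR x))) := by
  rw [action, desc_mul, ← mul_assoc]
  rfl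

/-- `Δ(h a) = h₁ ⊗ h₂ a` -/
def comulR : K →ₗ[k] (M.sourceTarget hY).RTensor :=
  ((MulOpposite.opLinearEquiv k).symm.toLinearMap ∘ₗ (M.action hY).toLinearMap).flip
    ((M.sourceTarget hY).rmk 1)

theorem comulR_mul_mul (h : H) (x : R) : M.comulR hY (M.inH h * M.inR x) =
    (M.sourceTarget hY).rmk (M.comulH h * (1 ⊗ₜ M.inR x)) := by
  refine (M.action_rmk hY h x 1).trans ?_
  rw [one_mul]

theorem comulR_eq (h : H) (x : R) : M.comulR hY (M.inH h * M.inR x) =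
    sweedler (comul (R := k) h) fun a b =>
      (M.sourceTarget hY).rmk (M.inH a ⊗ₜ (M.inH b * M.inR x)) := by
  simp [comulR_mul_mul, comulH_eq, sweedler_mul, map_sweedler]

theorem action_eq (z : K) (t : K ⊗[k] K) :
    (M.action hY z).unop ((M.sourceTarget hY).rmk t) =
      (M.sourceTarget hY).rMul (M.comulR hY z) t := by
  suffices ((MulOpposite.opLinearEquiv k).symm.toLinearMap ∘ₗ (M.action hY).toLinearMap).flip
      ((M.sourceTarget hY).rmk t) = ((M.sourceTarget hY).rMul.flip t) ∘ₗ M.comulR hY from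
    LinearMap.congr_fun this z
  refine M.lin_ext fun h x => ?_
  refine (M.action_rmk hY h x t).trans ?_
  rw [LinearMap.comp_apply, comulR_mul_mul]
  rfl

theorem comulR_mul_inR (x : R) (z : K) : M.comulR hY (z * M.inR x) =
    (M.sourceTarget hY).rBimod 1 x (M.comulR hY z) := by
  suffices M.comulR hY ∘ₗ LinearMap.mulRight k (M.inR x) =
      (M.sourceTarget hY).rBimod 1 x ∘ₗ M.comulR hY from LinearMap.congr_fun this z
  refine M.lin_ext fun h y => ?_
  simp only [LinearMap.comp_apply, LinearMap.mulRight_apply]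
  rw [mul_assoc, ← map_mul, comulR_eq, comulR_eq, map_sweedler]
  simp [sourceTarget_source, sourceTarget_tgt, M.lam_one, mul_assoc]

/-- Mirror image of `comulL_rho_mul`: the second leg contains λ of the coacted element, which
crosses the tensor sign as that element and recombines to λ(x) in the first leg. -/
theorem comulR_mul_lam (x : R) (z : K) : M.comulR hY (z * M.lam x) =
    (M.sourceTarget hY).rBimod x 1 (M.comulR hY z) := by
  suffices M.comulR hY ∘ₗ LinearMap.mulRight k (M.lam x) =
      (M.sourceTarget hY).rBimod x 1 ∘ₗ M.comulR hY from LinearMap.congr_fun this z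
  refine M.lin_ext fun h y => ?_
  simp only [LinearMap.comp_apply, LinearMap.mulRight_apply]
  rw [mul_assoc, M.inR_mul_lam hY, comulR_eq, map_sweedler]
  have h1 : M.inH h * (M.lam x * M.inR y) =
      sweedler (Y.coact x) fun g u => M.inH (h * g) * M.inR (u * y) := by
    rw [lam_eq, sweedler_mul, mul_sweedler]
    simp [mul_assoc]
  rw [h1, map_sweedler]
  have h2 : ∀ g u, M.comulR hY (M.inH (h * g) * M.inR (u * y)) =
      sweedler (comul (R := k) g) fun c d => (M.sourceTarget hY).rmk
        (M.comulH h * (M.inH c ⊗ₜ M.inH d) * (1 ⊗ₜ M.inR (u * y))) := fun g u => by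
    rw [comulR_mul_mul, map_mul M.comulH, comulH_eq M g, mul_sweedler, sweedler_mul, map_sweedler]
  simp only [h2]
  rw [← sweedler_coact_coassoc' Y fun c d u => (M.sourceTarget hY).rmk
        (M.comulH h * (M.inH c ⊗ₜ M.inH d) * (1 ⊗ₜ M.inR (u * y)))]
  have h3 : ∀ c v, (sweedler (Y.coact v) fun d u => (M.sourceTarget hY).rmk
        (M.comulH h * (M.inH c ⊗ₜ M.inH d) * (1 ⊗ₜ M.inR (u * y)))) =
      sweedler (comul (R := k) h) fun a b => (M.sourceTarget hY).rmk
        ((M.inH a * (M.inH c * M.inR v)) ⊗ₜ (M.inH b * M.inR y)) := fun c v => by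
    have : ∀ a b, (M.sourceTarget hY).rmk
          ((M.inH a * (M.inH c * M.inR v)) ⊗ₜ (M.inH b * M.inR y)) =
        sweedler (Y.coact v) fun d u => (M.sourceTarget hY).rmk
          ((M.inH a ⊗ₜ M.inH b) * (M.inH c ⊗ₜ M.inH d) * (1 ⊗ₜ M.inR (u * y))) := fun a b => by
      rw [← mul_assoc (M.inH a), rmk_balance, mul_assoc (M.inH b), M.inR_mul_lam hY, lam_eq,
        sweedler_mul, mul_sweedler, tmul_sweedler, map_sweedler]
      simp [mul_assoc]
    simp only [this]
    rw [sweedler_comm]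
    refine sweedler_congr fun d u => ?_
    rw [comulH_eq, sweedler_mul, sweedler_mul, map_sweedler]
  simp only [h3]
  rw [sweedler_comm]
  refine sweedler_congr fun a b => ?_
  rw [SourceTarget.rBimod_mk, sourceTarget_source, sourceTarget_tgt, map_one, mul_one, lam_eq,
    mul_sweedler, sweedler_tmul, map_sweedler]

/-- `ε(h a) = ε(h) a` -/
def counitR : K →ₗ[k] R :=
  (TensorProduct.lid k R).toLinearMap ∘ₗ (counit (R := k) (A := H)).rTensor R ∘ₗ
    M.equiv.symm.toLinearMap

theorem counitR_mul (h : H) (x : R) :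
    M.counitR (M.inH h * M.inR x) = counit (R := k) h • x := by
  simp [counitR, equiv_symm_mul]

theorem counitR_lam (x : R) : M.counitR (M.lam x) = x := by
  simp [counitR, lam, Y.coact_counit]

/-- The right action of `K` on `R`, `x · (h a) = (x ◂ h) a`. -/
def actionBase : K →ₐ[k] (Module.End k R)ᵐᵒᵖ :=
  M.desc
    (AlgHom.ofLinearMap ((MulOpposite.opLinearEquiv k).toLinearMap ∘ₗ Y.act.flip)
      (MulOpposite.unop_injective <| LinearMap.ext Y.act_one)
      (fun g h => MulOpposite.unop_injective <| LinearMap.ext fun a => Y.act_mul a g h))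
    (AlgHom.ofLinearMap ((MulOpposite.opLinearEquiv k).toLinearMap ∘ₗ (LinearMap.mul k R).flip)
      (MulOpposite.unop_injective <| LinearMap.ext mul_one)
      (fun g h => MulOpposite.unop_injective <| LinearMap.ext fun a => (mul_assoc a g h).symm))
    (fun a h => MulOpposite.unop_injective <| LinearMap.ext fun b => by
      rw [unop_sweedler, sweedler_apply]
      refine (Y.mul_act b a h).trans ?_
      exact (sweedler_linear (LinearMap.mul' k R ∘ₗ TensorProduct.map (Y.act b)
        (Y.act a)) (comul (R := k) h)).symm)

theorem actionBase_mul (h : H) (x a : R) :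
    (M.actionBase (M.inH h * M.inR x)).unop a = Y.act a h * x := by
  rw [actionBase, desc_mul]
  rfl

/-- As on the left, this makes the counit action axiom a consequence of `actionBase` being an
algebra map, now into the opposite endomorphism algebra. -/
theorem counitR_inR_mul (z : K) (a : R) :
    M.counitR (M.inR a * z) = (M.actionBase z).unop a := by
  suffices M.counitR ∘ₗ LinearMap.mulLeft k (M.inR a) =
      ((MulOpposite.opLinearEquiv k).symm.toLinearMap ∘ₗ M.actionBase.toLinearMap).flip a from
    LinearMap.congr_fun this z
  refine M.lin_ext fun h x => ?_
  refine Eq.trans ?_ (M.actionBase_mul h x a).symm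
  rw [LinearMap.comp_apply, LinearMap.mulLeft_apply, ← mul_assoc, M.inR_mul_inH, sweedler_mul,
    map_sweedler]
  simp only [mul_assoc, ← map_mul, counitR_mul]
  exact sweedler_counit_left (LinearMap.mulRight k x ∘ₗ Y.act a) h

theorem counitR_mul_inR (a : R) (z : K) : M.counitR (z * M.inR a) = M.counitR z * a := by
  suffices M.counitR ∘ₗ LinearMap.mulRight k (M.inR a) = LinearMap.mulRight k a ∘ₗ M.counitR from
    LinearMap.congr_fun this z
  refine M.lin_ext fun h x => ?_
  simp only [LinearMap.comp_apply, LinearMap.mulRight_apply]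
  rw [mul_assoc, ← map_mul, counitR_mul, counitR_mul, smul_mul_assoc]

include hY in
theorem counitR_mul_lam (a : R) (z : K) : M.counitR (z * M.lam a) = a * M.counitR z := by
  suffices M.counitR ∘ₗ LinearMap.mulRight k (M.lam a) = LinearMap.mulLeft k a ∘ₗ M.counitR from
    LinearMap.congr_fun this z
  refine M.lin_ext fun h x => ?_
  simp only [LinearMap.comp_apply, LinearMap.mulLeft_apply, LinearMap.mulRight_apply]
  rw [mul_assoc, M.inR_mul_lam hY, ← mul_assoc, counitR_mul_inR, counitR_mul, lam_eq, mul_sweedler,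
    map_sweedler, mul_smul_comm]
  simp only [← mul_assoc, ← map_mul, counitR_mul, Bialgebra.counit_mul]
  have h1 : (sweedler (Y.coact a) fun (g : H) (u : R) => counit (R := k) g • u) = a := by
    conv_rhs => rw [← Y.coact_counit a]
    exact sweedler_linear ((TensorProduct.lid k R).toLinearMap ∘ₗ
      (counit (R := k) (A := H)).rTensor R) (Y.coact a)
  simp only [← smul_smul]
  rw [sweedler_smul, h1, smul_mul_assoc]

/-- The `R`-coring `H ♯ R`. -/
abbrev rightCoring : RightCoringData k R K where
  toSourceTarget := M.sourceTarget hY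
  comul := M.comulR hY
  counit := M.counitR
  comul_bimod b a z := by
    rw [sourceTarget_source, sourceTarget_tgt, comulR_mul_lam, comulR_mul_inR]
    refine (M.sourceTarget hY).rInd (M.comulR hY z) (by simp) (fun g h => ?_)
      (fun x y hx hy => by simp only [map_add, hx, hy])
    simp [SourceTarget.tgt_one]
  counit_bimod b a z := by
    rw [sourceTarget_source, sourceTarget_tgt, counitR_mul_lam M hY, counitR_mul_inR, mul_assoc]

theorem rightCoring_coassoc : (M.rightCoring hY).comulId ∘ₗ M.comulR hY =
    (M.rightCoring hY).idComul ∘ₗ M.comulR hY := by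
  refine M.lin_ext fun h x => ?_
  simp only [LinearMap.comp_apply, comulR_eq, map_sweedler]
  have h1 : ∀ a b, (M.rightCoring hY).comulId
      ((M.sourceTarget hY).rmk (M.inH a ⊗ₜ (M.inH b * M.inR x))) =
      sweedler (comul (R := k) a) fun c d => TripleTensor.mk _ _ _ _
        (M.inH c ⊗ₜ[k] (M.inH d ⊗ₜ[k] (M.inH b * M.inR x))) := fun a b => by
    change TripleTensor.ofLeft _ _ _ _ (M.comulR hY (M.inH a)) (M.inH b * M.inR x) = _
    rw [← mul_one (M.inH a), ← map_one M.inR, comulR_eq, map_sweedler, sweedler_apply]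
    simp only [map_one, mul_one]
    rfl
  have h2 : ∀ a b, (M.rightCoring hY).idComul
      ((M.sourceTarget hY).rmk (M.inH a ⊗ₜ (M.inH b * M.inR x))) =
      sweedler (comul (R := k) b) fun c d => TripleTensor.mk _ _ _ _
        (M.inH a ⊗ₜ[k] (M.inH c ⊗ₜ[k] (M.inH d * M.inR x))) := fun a b => by
    change TripleTensor.ofRight _ _ _ _ (M.inH a) (M.comulR hY (M.inH b * M.inR x)) = _
    rw [comulR_eq, map_sweedler]
    rfl
  simp only [h1, h2]
  exact sweedler_coassoc (fun c d b => TripleTensor.mk _ _ _ _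
    (M.inH c ⊗ₜ[k] (M.inH d ⊗ₜ[k] (M.inH b * M.inR x)))) h

theorem rightCoring_counitId : (M.rightCoring hY).counitId ∘ₗ M.comulR hY = LinearMap.id := by
  refine M.lin_ext fun h x => ?_
  simp only [LinearMap.comp_apply, comulR_eq, map_sweedler]
  have h1 : ∀ a b, (M.rightCoring hY).counitId
      ((M.sourceTarget hY).rmk (M.inH a ⊗ₜ (M.inH b * M.inR x))) =
      counit (R := k) a • (M.inH b * M.inR x) := fun a b => by
    change (M.inH b * M.inR x) * M.lam (M.counitR (M.inH a)) = _
    rw [← mul_one (M.inH a), ← map_one M.inR, counitR_mul, map_smul, lam_one, mul_smul_comm,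
      mul_one]
  simp only [h1]
  exact sweedler_counit_left (LinearMap.mulRight k (M.inR x) ∘ₗ M.inH.toLinearMap) h

theorem rightCoring_idCounit : (M.rightCoring hY).idCounit ∘ₗ M.comulR hY = LinearMap.id := by
  refine M.lin_ext fun h x => ?_
  simp only [LinearMap.comp_apply, comulR_eq, map_sweedler]
  have h1 : ∀ a b, (M.rightCoring hY).idCounit
      ((M.sourceTarget hY).rmk (M.inH a ⊗ₜ (M.inH b * M.inR x))) =
      counit (R := k) b • (M.inH a * M.inR x) := fun a b => by
    change M.inH a * M.inR (M.counitR (M.inH b * M.inR x)) = _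
    rw [counitR_mul, map_smul, mul_smul_comm]
  simp only [h1]
  exact sweedler_counit_right (LinearMap.mulRight k (M.inR x) ∘ₗ M.inH.toLinearMap) h

/-- The right bialgebroid `H ♯ R` over `R`. -/
abbrev rightBialgebroid : RightBialgebroid k R K where
  toRightCoringData := M.rightCoring hY
  coassoc := LinearMap.congr_fun (M.rightCoring_coassoc hY)
  counit_comul := LinearMap.congr_fun (M.rightCoring_counitId hY)
  comul_counit := LinearMap.congr_fun (M.rightCoring_idCounit hY)
  comul_action := ⟨M.action hY, M.action_eq hY⟩
  counit_action_one a := by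
    change M.counitR (M.inR a * 1) = a
    simpa using M.counitR_mul 1 a
  counit_action_mul x y a := by
    change M.counitR (M.inR a * (x * y)) = M.counitR (M.inR (M.counitR (M.inR a * x)) * y)
    simp only [counitR_inR_mul, map_mul, Module.End.mul_apply, MulOpposite.unop_mul]

end RightSmashFactorization

end RightBialgebroidConstruction

/-! ### Comparison of the two smash products -/

section Canonical

open Coalgebra

variable {k H L R : Type*} [Field k] [Ring H] [Bialgebra k H] [Ring L] [Algebra k L]
  [Ring R] [Algebra k R]

theorem LeftModuleAlgebra.hopfOp_eq (X : LeftModuleAlgebra k H L) (h : H) (a : L) (g : H) :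
    X.hopfOp h (a ⊗ₜ g) = sweedler (comul (R := k) h) fun p q => X.act p a ⊗ₜ (q * g) := by
  rw [hopfOp, LinearMap.comp_apply,
    ← sweedler_linear (TensorProduct.map₂ X.act (LinearMap.mul k H)), sweedler_apply]
  rfl

theorem LeftModuleAlgebra.inAlg_mul_inHopf (X : LeftModuleAlgebra k H L) (a : L) (h : H) :
    X.inAlg a * X.inHopf h = X.tmul a h := by
  refine (X.mulLin_tmul a 1 (1 ⊗ₜ h)).trans ?_
  rw [X.hopfOp_one, Module.End.one_apply]
  exact congrArg (· ⊗ₜ[k] h) (mul_one a)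

/-- The factorization of the smash product `L ♯ H`. -/
def LeftModuleAlgebra.factorization (X : LeftModuleAlgebra k H L) :
    LeftSmashFactorization X X.Smash where
  inL := AlgHom.ofLinearMap X.inAlg rfl fun a b => by
    refine Eq.symm ((X.mulLin_tmul a 1 (b ⊗ₜ 1)).trans ?_)
    rw [X.hopfOp_one]
    rfl
  inH := AlgHom.ofLinearMap X.inHopf rfl fun g h => by
    refine Eq.symm ((X.mulLin_tmul 1 g (1 ⊗ₜ h)).trans ?_)
    rw [X.algOp_one, Module.End.one_apply, X.hopfOp_eq]
    simp only [X.act_one, ← TensorProduct.smul_tmul']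
    exact sweedler_counit_left (TensorProduct.mk k L H 1 ∘ₗ LinearMap.mulRight k h) g
  inH_mul_inL h a := by
    refine ((X.mulLin_tmul 1 h (a ⊗ₜ 1)).trans (?_ : _ = X.hopfOp h (a ⊗ₜ 1))).trans
      ((X.hopfOp_eq h a 1).trans ?_)
    · rw [X.algOp_one, Module.End.one_apply]
    refine sweedler_congr fun p q => ?_
    refine Eq.symm ((X.mulLin_tmul (X.act p a) 1 (1 ⊗ₜ q)).trans ?_)
    rw [X.hopfOp_one, Module.End.one_apply, mul_one]
    exact congrArg (· ⊗ₜ[k] q) (mul_one (X.act p a))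
  bijective := by
    -- Since (a ♯ 1)(1 ♯ h) = a ♯ h, the multiplication map is the identity of L ⊗ H.
    convert X.ofTensor.bijective
    rw [← LinearEquiv.coe_toLinearMap, DFunLike.coe_fn_eq]
    exact TensorProduct.ext' X.inAlg_mul_inHopf

theorem RightModuleAlgebra.hopfOp_eq (Y : RightModuleAlgebra k H R) (h g : H) (a : R) :
    Y.hopfOp h (g ⊗ₜ a) = sweedler (comul (R := k) h) fun p q => (g * p) ⊗ₜ Y.act a q := by
  rw [hopfOp, LinearMap.comp_apply, LinearMap.flip_apply,
    ← sweedler_linear (TensorProduct.map₂ (LinearMap.mul k H) Y.act (g ⊗ₜ a))]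
  rfl

theorem RightModuleAlgebra.inHopf_mul_inAlg (Y : RightModuleAlgebra k H R) (h : H) (a : R) :
    Y.inHopf h * Y.inAlg a = Y.tmul h a := by
  refine (Y.rmulLin_tmul 1 a (h ⊗ₜ 1)).trans ?_
  rw [Y.hopfOp_one, Module.End.one_apply]
  exact congrArg (h ⊗ₜ[k] ·) (one_mul a)

/-- The factorization of the smash product `H ♯ R`. -/
def RightModuleAlgebra.factorization (Y : RightModuleAlgebra k H R) :
    RightSmashFactorization Y Y.Smash where
  inR := AlgHom.ofLinearMap Y.inAlg rfl fun a b => by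
    refine Eq.symm ((Y.rmulLin_tmul 1 b (1 ⊗ₜ a)).trans ?_)
    rw [Y.hopfOp_one]
    rfl
  inH := AlgHom.ofLinearMap Y.inHopf rfl fun g h => by
    refine Eq.symm ((Y.rmulLin_tmul h 1 (g ⊗ₜ 1)).trans ?_)
    rw [Y.algOp_one, Module.End.one_apply, Y.hopfOp_eq]
    simp only [Y.one_act, TensorProduct.tmul_smul]
    exact sweedler_counit_right ((TensorProduct.mk k H R).flip 1 ∘ₗ LinearMap.mulLeft k g) h
  inR_mul_inH a h := by
    refine ((Y.rmulLin_tmul h 1 (1 ⊗ₜ a)).trans (?_ : _ = Y.hopfOp h (1 ⊗ₜ a))).trans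
      ((Y.hopfOp_eq h 1 a).trans ?_)
    · rw [Y.algOp_one, Module.End.one_apply]
    refine sweedler_congr fun p q => ?_
    refine Eq.symm ((Y.rmulLin_tmul 1 (Y.act a q) (p ⊗ₜ 1)).trans ?_)
    rw [Y.hopfOp_one, Module.End.one_apply, one_mul]
    exact congrArg (p ⊗ₜ[k] ·) (one_mul (Y.act a q))
  bijective := by
    convert Y.ofTensor.bijective
    rw [← LinearEquiv.coe_toLinearMap, DFunLike.coe_fn_eq]
    exact TensorProduct.ext' Y.inHopf_mul_inAlg

end Canonical

/-! ### θ turns a factorization L ♯ H into a factorization H ♯ R -/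

section Comparison

open Coalgebra HopfAlgebra

variable {k H L R : Type*} [Field k] [Ring H] [HopfAlgebra k H] [Ring L] [Algebra k L]
  [Ring R] [Algebra k R]

theorem antiLin_mul (θ : R ≃ₐ[k] Lᵐᵒᵖ) (a b : R) :
    antiLin θ (a * b) = antiLin θ b * antiLin θ a := by
  simp [antiLin]

theorem antiLin_one (θ : R ≃ₐ[k] Lᵐᵒᵖ) : antiLin θ 1 = 1 := by
  simp [antiLin]

variable {X : LeftRightYetterDrinfeld k H L} {Y : RightLeftYetterDrinfeld k H R}
  {θ : R ≃ₐ[k] Lᵐᵒᵖ}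

theorem CompatibleVia.act_symm (hθ : CompatibleVia X Y θ) (x : L) (f : H) :
    Y.act ((antiLin θ).symm x) f = (antiLin θ).symm (X.act (antipode k f) x) := by
  rw [LinearEquiv.eq_symm_apply, hθ.act, LinearEquiv.apply_symm_apply]

theorem CompatibleVia.sweedler_coact (hθ : CompatibleVia X Y θ) {N : Type*} [AddCommGroup N]
    [Module k N] (F : L → H → N) (y : R)
    (hF : IsBilin k F := by
      constructor <;> intros <;> simp [mul_add, add_mul]) :
    sweedler (X.coact (antiLin θ y)) F =
      sweedler (Y.coact y) fun h u => F (antiLin θ u) (antipode k h) := by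
  rw [hθ.coact, hF.sweedler_map, IsBilin.sweedler_swap]
  · rfl
  · constructor <;> intros <;> simp [hF.add_left, hF.add_right, hF.smul_left, hF.smul_right]

theorem sweedler_coact_counit (X : LeftRightYetterDrinfeld k H L) {N : Type*} [AddCommGroup N]
    [Module k N] (f : L →ₗ[k] N) (x : L) :
    (sweedler (X.coact x) fun u g => counit (R := k) g • f u) = f x := by
  conv_rhs => rw [← X.coact_counit x]
  refine Eq.trans ?_ (sweedler_linear (f ∘ₗ (TensorProduct.rid k L).toLinearMap ∘ₗ
      (counit (R := k) (A := H)).lTensor L) (X.coact x))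
  exact sweedler_congr fun u g => by simp

theorem sweedler_coact_counit' (Y : RightLeftYetterDrinfeld k H R) {N : Type*} [AddCommGroup N]
    [Module k N] (f : R →ₗ[k] N) (x : R) :
    (sweedler (Y.coact x) fun g u => counit (R := k) g • f u) = f x := by
  conv_rhs => rw [← Y.coact_counit x]
  refine Eq.trans ?_ (sweedler_linear (f ∘ₗ (TensorProduct.lid k R).toLinearMap ∘ₗ
      (counit (R := k) (A := H)).rTensor R) (Y.coact x))
  exact sweedler_congr fun u g => by simp

namespace LeftSmashFactorization

variable {K K' : Type*} [Ring K] [Algebra k K] [Ring K'] [Algebra k K']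
  (M : LeftSmashFactorization X.toLeftModuleAlgebra K) (hX : X.BraidedCommutative)
  (N : RightSmashFactorization Y.toRightModuleAlgebra K')
  (hθ : CompatibleVia X Y θ)

/-- The embedding `y ↦ θ(y)_[0] θ(y)_[1]` of `R` into `K`. -/
def inR (θ : R ≃ₐ[k] Lᵐᵒᵖ) : R →ₐ[k] K :=
  AlgHom.ofLinearMap (M.rho ∘ₗ (antiLin θ).toLinearMap) (by simp [antiLin_one, M.rho_one])
    (fun x y => by simp [antiLin_mul, M.rho_mul hX])

theorem inR_apply (y : R) : M.inR hX θ y = M.rho (antiLin θ y) := rfl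

include hθ in
-- Reading from the right, θ(a ◂ h₂) = S(h₂) ▸ θ(a), and moving h₁ past ρ by the Yetter-Drinfeld
-- condition gives ρ(h₂S(h₃) ▸ θ(a)) h₁, where the antipode cancels.
theorem inR_mul_inH (a : R) (h : H) : M.inR hX θ a * M.inH h =
    sweedler (comul (R := k) h) fun h₁ h₂ => M.inH h₁ * M.inR hX θ (Y.act a h₂) := by
  simp only [inR_apply, hθ.act, M.inH_mul_rho, ← X.mul_act]
  rw [sweedler_coassoc fun c d b =>
    M.rho (X.act (d * antipode k b) (antiLin θ a)) * M.inH c]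
  simp only [← sweedler_mul]
  have h1 : ∀ r : H, (sweedler (comul (R := k) r) fun d b =>
      M.rho (X.act (d * antipode k b) (antiLin θ a))) =
      counit (R := k) r • M.rho (antiLin θ a) := fun r => by
    refine (sweedler_mul_antipode (M.rho ∘ₗ X.act.flip (antiLin θ a)) r).trans ?_
    simp [X.one_act]
  simp only [h1, smul_mul_assoc]
  exact (sweedler_counit_right (LinearMap.mulLeft k (M.rho (antiLin θ a)) ∘ₗ
    M.inH.toLinearMap) h).symm

/-- The algebra map `f y ↦ f · θ(y)_[0] θ(y)_[1]`. -/
def ofRight : K' →ₐ[k] K := N.desc M.inH (M.inR hX θ) (M.inR_mul_inH hX hθ)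

theorem ofRight_mul (f : H) (y : R) :
    M.ofRight hX N hθ (N.inH f * N.inR y) = M.inH f * M.rho (antiLin θ y) :=
  N.desc_mul _ _ _ f y

theorem ofRight_inH (f : H) : M.ofRight hX N hθ (N.inH f) = M.inH f := by
  simpa [antiLin_one, M.rho_one] using M.ofRight_mul hX N hθ f 1

theorem ofRight_inR (y : R) : M.ofRight hX N hθ (N.inR y) = M.rho (antiLin θ y) := by
  simpa using M.ofRight_mul hX N hθ 1 y

/-- `x ↦ θ⁻¹(x_[0]) · S(x_[1])` -/
def _root_.RightSmashFactorization.antiRho (N : RightSmashFactorization Y.toRightModuleAlgebra K')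
    (X : LeftRightYetterDrinfeld k H L) (θ : R ≃ₐ[k] Lᵐᵒᵖ) : L →ₗ[k] K' :=
  LinearMap.mul' k K' ∘ₗ TensorProduct.map (N.inR.toLinearMap ∘ₗ (antiLin θ).symm.toLinearMap)
    (N.inH.toLinearMap ∘ₗ antipode k) ∘ₗ X.coact

theorem _root_.RightSmashFactorization.antiRho_eq (x : L) : N.antiRho X θ x =
    sweedler (X.coact x) fun u g => N.inR ((antiLin θ).symm u) * N.inH (antipode k g) :=
  (sweedler_linear (LinearMap.mul' k K' ∘ₗ TensorProduct.map
    (N.inR.toLinearMap ∘ₗ (antiLin θ).symm.toLinearMap)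
    (N.inH.toLinearMap ∘ₗ antipode k)) (X.coact x)).symm

/-- The linear map `x f ↦ θ⁻¹(x_[0]) · S(x_[1]) f`. -/
def toRightLin (θ : R ≃ₐ[k] Lᵐᵒᵖ) : K →ₗ[k] K' :=
  TensorProduct.lift ((LinearMap.mul k K').compl₁₂ (N.antiRho X θ) N.inH.toLinearMap) ∘ₗ
    M.equiv.symm.toLinearMap

theorem toRightLin_mul (x : L) (f : H) :
    M.toRightLin N θ (M.inL x * M.inH f) = N.antiRho X θ x * N.inH f := by
  simp [toRightLin, equiv_symm_mul]

theorem toRightLin_mul_inH (z : K) (f : H) :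
    M.toRightLin N θ (z * M.inH f) = M.toRightLin N θ z * N.inH f := by
  suffices M.toRightLin N θ ∘ₗ LinearMap.mulRight k (M.inH f) =
      LinearMap.mulRight k (N.inH f) ∘ₗ M.toRightLin N θ from LinearMap.congr_fun this z
  refine M.lin_ext fun x h => ?_
  simp only [LinearMap.comp_apply, LinearMap.mulRight_apply]
  rw [mul_assoc, ← map_mul, toRightLin_mul, toRightLin_mul, map_mul, mul_assoc]

/-- Cancellation S(x_[1]) x_[2] leaves θ⁻¹(x). -/
theorem toRightLin_rho (x : L) : M.toRightLin N θ (M.rho x) = N.inR ((antiLin θ).symm x) := by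
  rw [rho_eq, map_sweedler]
  simp only [toRightLin_mul, N.antiRho_eq, sweedler_mul, mul_assoc, ← map_mul]
  rw [sweedler_coact_coassoc X
    (fun u a b => N.inR ((antiLin θ).symm u) * N.inH (antipode k a * b))]
  have h1 : ∀ (u : L) (h : H), (sweedler (comul (R := k) h) fun a b =>
      N.inR ((antiLin θ).symm u) * N.inH (antipode k a * b)) =
      counit (R := k) h • N.inR ((antiLin θ).symm u) := fun u h => by
    refine (sweedler_antipode_mul (LinearMap.mulLeft k (N.inR ((antiLin θ).symm u)) ∘ₗ
      N.inH.toLinearMap) h).trans ?_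
    simp
  simp only [h1]
  exact sweedler_coact_counit X (N.inR.toLinearMap ∘ₗ (antiLin θ).symm.toLinearMap) x

/-- Here ρ(x_[0]) S(x_[1]) = x_[0] x_[1] S(x_[2]), and the H-part cancels. No use is made of the
inverse of S. -/
theorem ofRight_antiRho (x : L) : M.ofRight hX N hθ (N.antiRho X θ x) = M.inL x := by
  rw [N.antiRho_eq, map_sweedler]
  simp only [map_mul, ofRight_inR, ofRight_inH, LinearEquiv.apply_symm_apply, rho_eq, sweedler_mul,
    mul_assoc]
  simp only [← map_mul]
  rw [sweedler_coact_coassoc X (fun u a b => M.inL u * M.inH (a * antipode k b))]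
  have h1 : ∀ (u : L) (h : H), (sweedler (comul (R := k) h) fun a b =>
      M.inL u * M.inH (a * antipode k b)) = counit (R := k) h • M.inL u := fun u h => by
    refine (sweedler_mul_antipode (LinearMap.mulLeft k (M.inL u) ∘ₗ M.inH.toLinearMap) h).trans ?_
    simp
  simp only [h1]
  exact sweedler_coact_counit X M.inL.toLinearMap x

theorem ofRight_toRightLin (z : K) : M.ofRight hX N hθ (M.toRightLin N θ z) = z := by
  suffices (M.ofRight hX N hθ).toLinearMap ∘ₗ M.toRightLin N θ = LinearMap.id from
    LinearMap.congr_fun this z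
  refine M.lin_ext fun x h => ?_
  simp [toRightLin_mul, ofRight_antiRho, ofRight_inH]

/-- The inverse is so far only linear, so f ρ(θ(y)) is first rewritten as ρ(f₂ ▸ θ(y)) f₁, on which
it is computable. Moving H back to the left produces S(f₂)f₃ ▸ θ(y), which collapses. -/
theorem toRightLin_ofRight (z : K') : M.toRightLin N θ (M.ofRight hX N hθ z) = z := by
  suffices M.toRightLin N θ ∘ₗ (M.ofRight hX N hθ).toLinearMap = LinearMap.id from
    LinearMap.congr_fun this z
  refine N.lin_ext fun h y => ?_
  simp only [LinearMap.comp_apply, AlgHom.toLinearMap_apply, ofRight_mul, LinearMap.id_apply]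
  rw [M.inH_mul_rho, map_sweedler]
  simp only [toRightLin_mul_inH, toRightLin_rho, N.inR_mul_inH, hθ.act_symm, ← X.mul_act]
  rw [sweedler_coassoc fun c d b =>
    N.inH c * N.inR ((antiLin θ).symm (X.act (antipode k d * b) (antiLin θ y)))]
  have h1 : ∀ c r : H, (sweedler (comul (R := k) r) fun d b =>
      N.inH c * N.inR ((antiLin θ).symm (X.act (antipode k d * b) (antiLin θ y)))) =
      counit (R := k) r • (N.inH c * N.inR y) := fun c r => by
    refine (sweedler_antipode_mul (LinearMap.mulLeft k (N.inH c) ∘ₗ N.inR.toLinearMap ∘ₗ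
      (antiLin θ).symm.toLinearMap ∘ₗ X.act.flip (antiLin θ y)) r).trans ?_
    simp [X.one_act]
  simp only [h1]
  exact sweedler_counit_right (LinearMap.mulRight k (N.inR y) ∘ₗ N.inH.toLinearMap) h

/-- The isomorphism `f y ↦ f · θ(y)_[0] θ(y)_[1]`. -/
def ofRightEquiv : K' ≃ₐ[k] K :=
  { M.ofRight hX N hθ with
    invFun := M.toRightLin N θ
    left_inv := M.toRightLin_ofRight hX N hθ
    right_inv := M.ofRight_toRightLin hX N hθ }

/-- The factorization of `K` as a smash product `H ♯ R`. -/
def toRight : RightSmashFactorization Y.toRightModuleAlgebra K where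
  inH := M.inH
  inR := M.inR hX θ
  inR_mul_inH := M.inR_mul_inH hX hθ
  bijective := by
    -- Bijectivity is borrowed from the smash product H ♯ R itself: the multiplication map H ⊗ R →
    -- `K` is its own factorization followed by the isomorphism.
    let N := Y.toRightModuleAlgebra.factorization
    convert (M.ofRightEquiv hX N hθ).bijective.comp N.bijective
    refine congrArg DFunLike.coe (TensorProduct.ext' fun f y => ?_ :
      _ = (M.ofRight hX N hθ).toLinearMap ∘ₗ N.equiv.toLinearMap)
    exact (M.ofRight_mul hX N hθ f y).symm

theorem toRight_inH (h : H) : (M.toRight hX hθ).inH h = M.inH h := rfl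

theorem toRight_inR (y : R) : (M.toRight hX hθ).inR y = M.rho (antiLin θ y) := rfl

/-- `h₁ x S(h₂) = h ▸ x` -/
theorem sweedler_adjoint (h : H) (x : L) : (sweedler (comul (R := k) h) fun a b =>
    M.inH a * M.inL x * M.inH (antipode k b)) = M.inL (X.act h x) := by
  simp only [M.inH_mul_inL, sweedler_mul, mul_assoc, ← map_mul]
  rw [sweedler_coassoc fun c d b => M.inL (X.act c x) * M.inH (d * antipode k b)]
  have h1 : ∀ c r : H, (sweedler (comul (R := k) r) fun d b =>
      M.inL (X.act c x) * M.inH (d * antipode k b)) =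
      counit (R := k) r • M.inL (X.act c x) := fun c r => by
    refine (sweedler_mul_antipode (LinearMap.mulLeft k (M.inL (X.act c x)) ∘ₗ
      M.inH.toLinearMap) r).trans ?_
    simp
  simp only [h1]
  exact sweedler_counit_right (M.inL.toLinearMap ∘ₗ X.act.flip x) h

include hθ in
theorem rho_antiLin (y : R) : M.rho (antiLin θ y) =
    sweedler (Y.coact y) fun h u => M.inL (antiLin θ u) * M.inH (antipode k h) := by
  rw [rho_eq, hθ.sweedler_coact fun u h => M.inL u * M.inH h]

end LeftSmashFactorization

/-- `y ↦ y_[-1] ▸ θ(y_[0])` -/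
def targetAct (X : LeftRightYetterDrinfeld k H L) (Y : RightLeftYetterDrinfeld k H R)
    (θ : R ≃ₐ[k] Lᵐᵒᵖ) : R →ₗ[k] L :=
  TensorProduct.lift (X.act.compl₂ (antiLin θ).toLinearMap) ∘ₗ Y.coact

theorem targetAct_eq (y : R) : targetAct X Y θ y =
    sweedler (Y.coact y) fun h u => X.act h (antiLin θ u) :=
  (sweedler_linear (TensorProduct.lift (X.act.compl₂ (antiLin θ).toLinearMap)) (Y.coact y)).symm

/-- `x ↦ θ⁻¹(x_[0]) ◂ S(x_[1])` -/
def targetActInv (X : LeftRightYetterDrinfeld k H L) (Y : RightLeftYetterDrinfeld k H R)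
    (θ : R ≃ₐ[k] Lᵐᵒᵖ) : L →ₗ[k] R :=
  TensorProduct.lift (Y.act.compl₁₂ (antiLin θ).symm.toLinearMap (antipode k)) ∘ₗ X.coact

theorem targetActInv_eq (x : L) : targetActInv X Y θ x =
    sweedler (X.coact x) fun u g => Y.act ((antiLin θ).symm u) (antipode k g) :=
  (sweedler_linear (TensorProduct.lift
    (Y.act.compl₁₂ (antiLin θ).symm.toLinearMap (antipode k))) (X.coact x)).symm

/-- λ carries the left action a ↦ a ◂ S(g) to the adjoint action of g. The Yetter-Drinfeld
condition, applied to S(d) with its reversed coproduct, gives λ(a)S(d) = S(d₁)λ(a ◂ S(d₂)), and the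
prefix c S(d₁) cancels. -/
theorem RightSmashFactorization.lam_act_antipode {K : Type*} [Ring K] [Algebra k K]
    (N : RightSmashFactorization Y.toRightModuleAlgebra K) (a : R) (g : H) :
    N.lam (Y.act a (antipode k g)) = sweedler (comul (R := k) g) fun c d =>
      N.inH c * N.lam a * N.inH (antipode k d) := by
  have h1 : ∀ d : H, N.lam a * N.inH (antipode k d) = sweedler (comul (R := k) d) fun e f =>
      N.inH (antipode k e) * N.lam (Y.act a (antipode k f)) := fun d => by
    rw [N.lam_mul_inH, sweedler_comul_antipode]
    constructor <;> intros <;> simp [mul_add, add_mul]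
  simp only [mul_assoc, h1, mul_sweedler]
  simp only [← mul_assoc, ← map_mul]
  rw [← sweedler_coassoc fun c e f =>
    N.inH (c * antipode k e) * N.lam (Y.act a (antipode k f))]
  have h2 : ∀ m f : H, (sweedler (comul (R := k) m) fun c e =>
      N.inH (c * antipode k e) * N.lam (Y.act a (antipode k f))) =
      counit (R := k) m • N.lam (Y.act a (antipode k f)) := fun m f => by
    refine (sweedler_mul_antipode (LinearMap.mulRight k (N.lam (Y.act a (antipode k f))) ∘ₗ
      N.inH.toLinearMap) m).trans ?_
    simp
  simp only [h2]
  exact (sweedler_counit_left (N.lam ∘ₗ Y.act a ∘ₗ antipode k) g).symm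

namespace LeftSmashFactorization

variable {K : Type*} [Ring K] [Algebra k K]
  (M : LeftSmashFactorization X.toLeftModuleAlgebra K) (hX : X.BraidedCommutative)
  (hθ : CompatibleVia X Y θ)

/-- Since ρ(θ(u)) = θ(u_[0]) S(u_[-1]), the element λ(y) is y_[-2] θ(y_[0]) S(y_[-1]), an adjoint
action on θ(y_[0]). Hence the right target takes its values in L. -/
theorem toRight_lam (y : R) : (M.toRight hX hθ).lam y = M.inL (targetAct X Y θ y) := by
  rw [RightSmashFactorization.lam_eq, targetAct_eq, map_sweedler]
  simp only [toRight_inH, toRight_inR, M.rho_antiLin hθ, mul_sweedler, ← mul_assoc]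
  rw [sweedler_coact_coassoc' Y fun h g v =>
    M.inH h * M.inL (antiLin θ v) * M.inH (antipode k g)]
  simp only [sweedler_adjoint]

theorem inL_injective : Function.Injective M.inL := fun a b h => by
  have := congrArg M.counitL h
  simpa using (M.counitL_mul a 1).symm.trans
    (by simpa using this.trans (by simpa using M.counitL_mul b 1))

include M hX hθ in
-- `K` is absent from the statement, but the proof is a computation there: both sides are the
-- adjoint action of g on λ(a), which lies in the embedded copy of L.
theorem targetAct_act_antipode (a : R) (g : H) :
    targetAct X Y θ (Y.act a (antipode k g)) = X.act g (targetAct X Y θ a) := by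
  apply M.inL_injective
  rw [← M.toRight_lam hX hθ, RightSmashFactorization.lam_act_antipode, toRight_lam,
    ← sweedler_adjoint]
  rfl

include M hX hθ in
-- With x = θ(y) the compatibility of coactions supplies S(y_[-1]) in the place of x_[1], so the two
-- actions compose to S(y_[-2]) y_[-1] ▸ θ(y_[0]) = θ(y). This one-sided inverse is all that is
-- needed, as it puts L inside the image of λ.
theorem targetAct_targetActInv (x : L) : targetAct X Y θ (targetActInv X Y θ x) = x := by
  obtain ⟨y, rfl⟩ := (antiLin θ).surjective x
  rw [targetActInv_eq, map_sweedler]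
  simp only [M.targetAct_act_antipode hX hθ]
  rw [hθ.sweedler_coact fun u g => X.act g (targetAct X Y θ ((antiLin θ).symm u))]
  simp only [LinearEquiv.symm_apply_apply, targetAct_eq, map_sweedler, ← X.mul_act]
  rw [sweedler_coact_coassoc' Y fun h g v => X.act (antipode k h * g) (antiLin θ v)]
  have h1 : ∀ (h : H) (v : R), (sweedler (comul (R := k) h) fun a b =>
      X.act (antipode k a * b) (antiLin θ v)) = counit (R := k) h • antiLin θ v := fun h v => by
    refine (sweedler_antipode_mul (X.act.flip (antiLin θ v)) h).trans ?_
    simp [X.one_act]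
  simp only [h1]
  exact sweedler_coact_counit' Y (antiLin θ).toLinearMap y

end LeftSmashFactorization

end Comparison

/-! ### The symmetric Hopf algebroid of a factorization -/

section SymmetricStructure

open Coalgebra HopfAlgebra

variable {k H L R : Type*} [Field k] [Ring H] [HopfAlgebra k H] [Ring L] [Algebra k L]
  [Ring R] [Algebra k R] {X : LeftRightYetterDrinfeld k H L} {Y : RightLeftYetterDrinfeld k H R}
  {θ : R ≃ₐ[k] Lᵐᵒᵖ}

namespace LeftSmashFactorization

variable {K K' : Type*} [Ring K] [Algebra k K] [Ring K'] [Algebra k K']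
  (M : LeftSmashFactorization X.toLeftModuleAlgebra K) (hX : X.BraidedCommutative)
  (N : RightSmashFactorization Y.toRightModuleAlgebra K') (hY : Y.BraidedCommutative)
  (hθ : CompatibleVia X Y θ)

/-- The antihomomorphism `f y ↦ θ(y) S(f)`. -/
def anti : K' →ₐ[k] Kᵐᵒᵖ :=
  N.desc
    (AlgHom.ofLinearMap ((MulOpposite.opLinearEquiv k).toLinearMap ∘ₗ M.inH.toLinearMap ∘ₗ
      antipode k) (by simp) (fun g h => by simp [antipode_mul_antidistrib]))
    (AlgHom.ofLinearMap ((MulOpposite.opLinearEquiv k).toLinearMap ∘ₗ M.inL.toLinearMap ∘ₗ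
      (antiLin θ).toLinearMap) (by simp [antiLin_one]) (fun a b => by simp [antiLin_mul]))
    (fun a h => MulOpposite.unop_injective (by
      rw [unop_sweedler]
      refine (M.inH_mul_inL (antipode k h) (antiLin θ a)).trans ?_
      rw [sweedler_comul_antipode (by constructor <;> intros <;> simp [mul_add, add_mul])]
      refine sweedler_congr fun p q => ?_
      rw [← hθ.act]
      rfl))

theorem anti_mul (f : H) (y : R) : (M.anti N hθ (N.inH f * N.inR y)).unop =
    M.inL (antiLin θ y) * M.inH (antipode k f) := by
  rw [anti, N.desc_mul]
  rfl

theorem anti_inH (f : H) : (M.anti N hθ (N.inH f)).unop = M.inH (antipode k f) := by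
  simpa [antiLin_one] using M.anti_mul N hθ f 1

theorem anti_inR (y : R) : (M.anti N hθ (N.inR y)).unop = M.inL (antiLin θ y) := by
  simpa using M.anti_mul N hθ 1 y

/-- Applied to y_[-1] y_[0] the antihomomorphism gives θ(y_[0]) S(y_[-1]), which is ρ(θ(y)) by
compatibility of the coactions. In the Hopf algebroid this is τβ_R = α_R. -/
theorem anti_lam (y : R) : (M.anti N hθ (N.lam y)).unop = M.rho (antiLin θ y) := by
  rw [N.lam_eq, map_sweedler, unop_sweedler, M.rho_antiLin hθ]
  simp only [anti_mul]

/-- With `inL_eq_lam`, this records the two coincidences of images, of β_L with α_R and of α_L with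
β_R. The axioms linking left and right structures rest on them. -/
theorem rho_eq_inR (x : L) :
    M.rho x = (M.toRight hX hθ).inR ((antiLin θ).symm x) := by
  rw [toRight_inR, LinearEquiv.apply_symm_apply]

theorem inL_eq_lam (x : L) : M.inL x = (M.toRight hX hθ).lam (targetActInv X Y θ x) := by
  rw [toRight_lam, M.targetAct_targetActInv hX hθ]

theorem counitR_inR {N : RightSmashFactorization Y.toRightModuleAlgebra K'} (y : R) :
    N.counitR (N.inR y) = y := by
  simpa using N.counitR_mul 1 y

theorem comulR_inH (N : RightSmashFactorization Y.toRightModuleAlgebra K') (h : H) :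
    N.comulR hY (N.inH h) = sweedler (comul (R := k) h) fun a b =>
      (N.sourceTarget hY).rmk (N.inH a ⊗ₜ N.inH b) := by
  simpa using N.comulR_eq hY h 1

theorem comulL_inH (h : H) : M.comulL hX (M.inH h) = sweedler (comul (R := k) h) fun a b =>
    (M.sourceTarget hX).lmk (M.inH a ⊗ₜ M.inH b) := by
  simpa using M.comulL_eq hX 1 h

/-- ρ is the target of the left bialgebroid, so right multiplication by ρ(x) only affects the second
leg. This is Δ_L in the coordinates of H ♯ R. -/
theorem comulL_mul_rho (h : H) (x : L) : M.comulL hX (M.inH h * M.rho x) =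
    sweedler (comul (R := k) h) fun a b =>
      (M.sourceTarget hX).lmk (M.inH a ⊗ₜ (M.inH b * M.rho x)) := by
  refine ((M.leftBialgebroid hX).comul_mul_target (M.inH h) x).trans ?_
  change (M.sourceTarget hX).lMul (M.comulL hX (M.inH h)) (1 ⊗ₜ M.rho x) = _
  rw [comulL_inH, map_sweedler, sweedler_apply]
  simp only [SourceTarget.lMul_mk, Algebra.TensorProduct.tmul_mul_tmul, mul_one]

include hX in
-- After h ρ(x) = ρ(h₂ ▸ x) h₁, right L-linearity of the counit leaves ε(h₁)(h₂ ▸ x).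
theorem counitL_mul_rho (h : H) (x : L) : M.counitL (M.inH h * M.rho x) = X.act h x := by
  rw [M.inH_mul_rho, map_sweedler]
  have h1 : ∀ g : H, M.counitL (M.inH g) = counit (R := k) g • (1 : L) := fun g => by
    simpa using M.counitL_mul 1 g
  simp only [M.counitL_rho_mul hX, h1, smul_mul_assoc, one_mul]
  exact sweedler_counit_left (X.act.flip x) h

/-- The element x of L is a value of the right target, so left multiplication by it affects only the
first leg of Δ_R(h) = h₁ ⊗ h₂. Therefore Δ_R has the same representative as Δ_L. -/
theorem toRight_comulR (x : L) (h : H) : (M.toRight hX hθ).comulR hY (M.inL x * M.inH h) =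
    sweedler (comul (R := k) h) fun a b =>
      ((M.toRight hX hθ).sourceTarget hY).rmk ((M.inL x * M.inH a) ⊗ₜ M.inH b) := by
  rw [M.inL_eq_lam hX hθ]
  refine (((M.toRight hX hθ).rightBialgebroid hY).comul_target_mul (M.inH h) _).trans ?_
  change ((M.toRight hX hθ).sourceTarget hY).rMul ((M.toRight hX hθ).comulR hY
    ((M.toRight hX hθ).inH h)) ((M.toRight hX hθ).lam _ ⊗ₜ 1) = _
  rw [comulR_inH, map_sweedler, sweedler_apply]
  simp only [SourceTarget.rMul_mk, Algebra.TensorProduct.tmul_mul_tmul, one_mul]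
  rfl

theorem toRight_antiRho (x : L) : (M.toRight hX hθ).antiRho X θ x = M.inL x := by
  -- When the right factorization is the one built on `K` itself, the comparison map is the
  -- identity, so the formula for its inverse becomes an identity in `K`.
  have h : (M.ofRight hX (M.toRight hX hθ) hθ).toLinearMap = LinearMap.id :=
    (M.toRight hX hθ).lin_ext fun f y => M.ofRight_mul hX _ hθ f y
  rw [← M.ofRight_antiRho hX (M.toRight hX hθ) hθ x]
  exact (LinearMap.congr_fun h _).symm

theorem toRight_counitR (x : L) (f : H) : (M.toRight hX hθ).counitR (M.inL x * M.inH f) =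
    sweedler (X.coact x) fun u g => Y.act ((antiLin θ).symm u) (antipode k g * f) := by
  rw [← M.toRight_antiRho hX hθ, RightSmashFactorization.antiRho_eq, sweedler_mul, map_sweedler]
  refine sweedler_congr fun u g => ?_
  rw [mul_assoc, ← M.toRight_inH hX hθ f, ← map_mul, RightSmashFactorization.counitR_inR_mul]
  simpa using (M.toRight hX hθ).actionBase_mul (antipode k g * f) 1 ((antiLin θ).symm u)

theorem anti_inL_mul (x : L) (f : H) :
    (M.anti (M.toRight hX hθ) hθ (M.inL x * M.inH f)).unop =
      sweedler (X.coact x) fun u g =>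
        M.inH (antipode k f * antipode k (antipode k g)) * M.inL u := by
  conv_lhs => rw [← M.toRight_antiRho hX hθ, RightSmashFactorization.antiRho_eq,
    ← M.toRight_inH hX hθ f]
  rw [map_mul, map_sweedler, MulOpposite.unop_mul, unop_sweedler, anti_inH, mul_sweedler]
  simp only [map_mul, MulOpposite.unop_mul, anti_inR, anti_inH, LinearEquiv.apply_symm_apply,
    mul_assoc]

/-- The Hopf algebroid data on `K = L ♯ H = H ♯ R`. -/
abbrev hopfAlgebroidData : HopfAlgebroidData k L R K where
  left := M.leftBialgebroid hX
  right := (M.toRight hX hθ).rightBialgebroid hY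
  antipode := M.anti (M.toRight hX hθ) hθ
  -- The next four fields share one reason: the value in question lies in the image of the source or
  -- target applied after the counit, and the counit splits that map.
  sourceL_counitL_targetR y := by
    change M.inL (M.counitL ((M.toRight hX hθ).lam y)) = (M.toRight hX hθ).lam y
    rw [toRight_lam]
    congr 1
    simpa using M.counitL_mul (targetAct X Y θ y) 1
  targetL_counitL_sourceR y := congrArg M.rho (M.counitL_rho (antiLin θ y))
  sourceR_counitR_targetL x := by
    change (M.toRight hX hθ).inR ((M.toRight hX hθ).counitR (M.rho x)) = M.rho x
    rw [M.rho_eq_inR hX hθ, counitR_inR]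
  targetR_counitR_sourceL x := by
    change (M.toRight hX hθ).lam ((M.toRight hX hθ).counitR (M.inL x)) = M.inL x
    rw [M.inL_eq_lam hX hθ, RightSmashFactorization.counitR_lam]
  antipode_targetL x := by
    change (M.anti (M.toRight hX hθ) hθ (M.rho x)).unop = M.inL x
    rw [M.rho_eq_inR hX hθ, anti_inR, LinearEquiv.apply_symm_apply]
  antipode_targetR y := M.anti_lam (M.toRight hX hθ) hθ y

/-- Since Δ_L and Δ_R are given by the same formula on x h, both sides are x h₁ ⊗ h₂ ⊗ h₃, bracketed
differently; the other mixed law is proved alike. -/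
theorem mixed_coassoc_RL :
    (M.hopfAlgebroidData hX hY hθ).comulRId ∘ₗ M.comulL hX =
      (M.hopfAlgebroidData hX hY hθ).idComulL ∘ₗ (M.toRight hX hθ).comulR hY := by
  refine M.lin_ext fun x h => ?_
  simp only [LinearMap.comp_apply]
  rw [comulL_eq, toRight_comulR, map_sweedler, map_sweedler]
  have h1 : ∀ a b, (M.hopfAlgebroidData hX hY hθ).comulRId
      ((M.sourceTarget hX).lmk ((M.inL x * M.inH a) ⊗ₜ M.inH b)) =
      sweedler (comul (R := k) a) fun c d => TripleTensor.mk _ _ _ _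
        ((M.inL x * M.inH c) ⊗ₜ[k] (M.inH d ⊗ₜ[k] M.inH b)) := fun a b => by
    change TripleTensor.ofLeft _ _ _ _ ((M.toRight hX hθ).comulR hY (M.inL x * M.inH a))
      (M.inH b) = _
    rw [toRight_comulR, map_sweedler, sweedler_apply]
    rfl
  have h2 : ∀ a b, (M.hopfAlgebroidData hX hY hθ).idComulL
      (((M.toRight hX hθ).sourceTarget hY).rmk ((M.inL x * M.inH a) ⊗ₜ M.inH b)) =
      sweedler (comul (R := k) b) fun c d => TripleTensor.mk _ _ _ _
        ((M.inL x * M.inH a) ⊗ₜ[k] (M.inH c ⊗ₜ[k] M.inH d)) := fun a b => by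
    change TripleTensor.ofRight _ _ _ _ (M.inL x * M.inH a) (M.comulL hX (M.inH b)) = _
    rw [comulL_inH, map_sweedler]
    rfl
  simp only [h1, h2]
  exact sweedler_coassoc (fun c d b => TripleTensor.mk _ _ _ _
    ((M.inL x * M.inH c) ⊗ₜ[k] (M.inH d ⊗ₜ[k] M.inH b))) h

theorem mixed_coassoc_LR :
    (M.hopfAlgebroidData hX hY hθ).comulLId ∘ₗ (M.toRight hX hθ).comulR hY =
      (M.hopfAlgebroidData hX hY hθ).idComulR ∘ₗ M.comulL hX := by
  refine M.lin_ext fun x h => ?_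
  simp only [LinearMap.comp_apply]
  rw [comulL_eq, toRight_comulR, map_sweedler, map_sweedler]
  have h1 : ∀ a b, (M.hopfAlgebroidData hX hY hθ).comulLId
      (((M.toRight hX hθ).sourceTarget hY).rmk ((M.inL x * M.inH a) ⊗ₜ M.inH b)) =
      sweedler (comul (R := k) a) fun c d => TripleTensor.mk _ _ _ _
        ((M.inL x * M.inH c) ⊗ₜ[k] (M.inH d ⊗ₜ[k] M.inH b)) := fun a b => by
    change TripleTensor.ofLeft _ _ _ _ (M.comulL hX (M.inL x * M.inH a)) (M.inH b) = _
    rw [comulL_eq, map_sweedler, sweedler_apply]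
    rfl
  have h2 : ∀ a b, (M.hopfAlgebroidData hX hY hθ).idComulR
      ((M.sourceTarget hX).lmk ((M.inL x * M.inH a) ⊗ₜ M.inH b)) =
      sweedler (comul (R := k) b) fun c d => TripleTensor.mk _ _ _ _
        ((M.inL x * M.inH a) ⊗ₜ[k] (M.inH c ⊗ₜ[k] M.inH d)) := fun a b => by
    change TripleTensor.ofRight _ _ _ _ (M.inL x * M.inH a)
      ((M.toRight hX hθ).comulR hY ((M.toRight hX hθ).inH b)) = _
    rw [comulR_inH, map_sweedler]
    rfl
  simp only [h1, h2]
  exact sweedler_coassoc (fun c d b => TripleTensor.mk _ _ _ _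
    ((M.inL x * M.inH c) ⊗ₜ[k] (M.inH d ⊗ₜ[k] M.inH b))) h

theorem mulAntipodeId_comulL : (M.hopfAlgebroidData hX hY hθ).mulAntipodeId ∘ₗ M.comulL hX =
    (M.toRight hX hθ).inR.toLinearMap ∘ₗ (M.toRight hX hθ).counitR := by
  -- The form h ρ(θ(y)) is chosen because there Δ_L leaves only h₁ in the first leg, on which the
  -- antipode is S. The other antipode axiom is checked on x h for the symmetric reason.
  refine (M.toRight hX hθ).lin_ext fun h y => ?_
  simp only [LinearMap.comp_apply, AlgHom.toLinearMap_apply]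
  rw [RightSmashFactorization.counitR_mul, map_smul, toRight_inR, toRight_inH, comulL_mul_rho,
    map_sweedler]
  have h1 : ∀ a b, (M.hopfAlgebroidData hX hY hθ).mulAntipodeId
      ((M.sourceTarget hX).lmk (M.inH a ⊗ₜ (M.inH b * M.rho (antiLin θ y)))) =
      M.inH (antipode k a * b) * M.rho (antiLin θ y) := fun a b => by
    change (M.anti (M.toRight hX hθ) hθ ((M.toRight hX hθ).inH a)).unop *
      (M.inH b * M.rho (antiLin θ y)) = _
    rw [anti_inH, map_mul, mul_assoc]
  simp only [h1]
  refine (sweedler_antipode_mul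
    (LinearMap.mulRight k (M.rho (antiLin θ y)) ∘ₗ M.inH.toLinearMap) h).trans ?_
  simp

theorem mulIdAntipode_comulR :
    (M.hopfAlgebroidData hX hY hθ).mulIdAntipode ∘ₗ (M.toRight hX hθ).comulR hY =
      M.inL.toLinearMap ∘ₗ M.counitL := by
  refine M.lin_ext fun x h => ?_
  simp only [LinearMap.comp_apply, AlgHom.toLinearMap_apply]
  rw [counitL_mul, map_smul, toRight_comulR, map_sweedler]
  have h1 : ∀ a b, (M.hopfAlgebroidData hX hY hθ).mulIdAntipode
      (((M.toRight hX hθ).sourceTarget hY).rmk ((M.inL x * M.inH a) ⊗ₜ M.inH b)) =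
      M.inL x * M.inH (a * antipode k b) := fun a b => by
    change M.inL x * M.inH a * (M.anti (M.toRight hX hθ) hθ ((M.toRight hX hθ).inH b)).unop = _
    rw [anti_inH, map_mul, mul_assoc]
  simp only [h1]
  refine (sweedler_mul_antipode (LinearMap.mulLeft k (M.inL x) ∘ₗ M.inH.toLinearMap) h).trans ?_
  simp

/-- The symmetric Hopf algebroid on `K = L ♯ H = H ♯ R`. -/
abbrev symmetricHopfAlgebroid : SymmetricHopfAlgebroid k L R K where
  toHopfAlgebroidData := M.hopfAlgebroidData hX hY hθ
  mixed_coassoc_RL := LinearMap.congr_fun (M.mixed_coassoc_RL hX hY hθ)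
  mixed_coassoc_LR := LinearMap.congr_fun (M.mixed_coassoc_LR hX hY hθ)
  antipode_comulL := LinearMap.congr_fun (M.mulAntipodeId_comulL hX hY hθ)
  antipode_comulR := LinearMap.congr_fun (M.mulIdAntipode_comulR hX hY hθ)

/-- Transport of a factorization along an isomorphism. -/
def transport (e : K' ≃ₐ[k] K) : LeftSmashFactorization X.toLeftModuleAlgebra K' where
  inL := e.symm.toAlgHom.comp M.inL
  inH := e.symm.toAlgHom.comp M.inH
  inH_mul_inL h a := by
    change e.symm (M.inH h) * e.symm (M.inL a) = _
    rw [← map_mul, M.inH_mul_inL, map_sweedler]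
    simp
  bijective := by
    convert e.symm.bijective.comp M.bijective
    refine congrArg DFunLike.coe (TensorProduct.ext' fun f y => ?_ :
      _ = e.symm.toLinearMap ∘ₗ M.equiv.toLinearMap)
    exact (map_mul e.symm _ _).symm

/-! ### Naturality of the construction under an isomorphism of total algebras -/

section Transport

variable (e : K' ≃ₐ[k] K)

theorem transport_inL (x : L) : e ((M.transport e).inL x) = M.inL x := e.apply_symm_apply _

theorem transport_inH (h : H) : e ((M.transport e).inH h) = M.inH h := e.apply_symm_apply _

/-- The coaction of L is unchanged and ρ is built from it by the two embeddings, both of which `e`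
intertwines. -/
theorem transport_rho (x : L) : e ((M.transport e).rho x) = M.rho x := by
  simp only [rho_eq, map_sweedler, map_mul, transport_inL, transport_inH]

theorem transport_lmk_balance (a : L) (m n : K') :
    ((M.sourceTarget hX).lmk ∘ₗ TensorProduct.map e.toLinearMap e.toLinearMap)
      (((M.transport e).sourceTarget hX).tgtL a m ⊗ₜ n) =
    ((M.sourceTarget hX).lmk ∘ₗ TensorProduct.map e.toLinearMap e.toLinearMap)
      (m ⊗ₜ ((M.transport e).sourceTarget hX).srcL a n) := by
  simp only [LinearMap.comp_apply, TensorProduct.map_tmul, LinearMap.mulLeft_apply,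
    AlgEquiv.toLinearMap_apply, map_mul, sourceTarget_tgt, sourceTarget_source, transport_rho,
    transport_inL, lmk_balance]

theorem transport_rmk_balance (a : R) (m n : K') :
    (((M.toRight hX hθ).sourceTarget hY).rmk ∘ₗ TensorProduct.map e.toLinearMap e.toLinearMap)
      ((((M.transport e).toRight hX hθ).sourceTarget hY).srcR a m ⊗ₜ n) =
    (((M.toRight hX hθ).sourceTarget hY).rmk ∘ₗ TensorProduct.map e.toLinearMap e.toLinearMap)
      (m ⊗ₜ (((M.transport e).toRight hX hθ).sourceTarget hY).tgtR a n) := by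
  simp only [LinearMap.comp_apply, TensorProduct.map_tmul, LinearMap.mulRight_apply,
    AlgEquiv.toLinearMap_apply, map_mul, RightSmashFactorization.sourceTarget_tgt,
    RightSmashFactorization.sourceTarget_source, toRight_lam, toRight_inR, transport_rho,
    transport_inL]
  exact BalTensor.mk_balance (r := ((M.toRight hX hθ).sourceTarget hY).srcR)
    (l := ((M.toRight hX hθ).sourceTarget hY).tgtR) a (e m) (e n) |>.trans (by
      rw [LinearMap.mulRight_apply, RightSmashFactorization.sourceTarget_tgt, toRight_lam]; rfl)

theorem transport_comulL : M.comulL hX ∘ₗ e.toLinearMap =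
    BalTensor.lift (r := ((M.transport e).sourceTarget hX).tgtL)
      (l := ((M.transport e).sourceTarget hX).srcL)
      ((M.sourceTarget hX).lmk ∘ₗ TensorProduct.map e.toLinearMap e.toLinearMap)
      (M.transport_lmk_balance hX e) ∘ₗ (M.transport e).comulL hX := by
  refine (M.transport e).lin_ext fun x h => ?_
  simp only [LinearMap.comp_apply, AlgEquiv.toLinearMap_apply, map_mul, transport_inL,
    transport_inH, comulL_eq, map_sweedler]
  refine sweedler_congr fun a b => Eq.symm ?_
  change (M.sourceTarget hX).lmk (e ((M.transport e).inL x * (M.transport e).inH a) ⊗ₜ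
    e ((M.transport e).inH b)) = _
  rw [map_mul, transport_inL, transport_inH, transport_inH]

theorem transport_comulR : (M.toRight hX hθ).comulR hY ∘ₗ e.toLinearMap =
    BalTensor.lift (r := (((M.transport e).toRight hX hθ).sourceTarget hY).srcR)
      (l := (((M.transport e).toRight hX hθ).sourceTarget hY).tgtR)
      (((M.toRight hX hθ).sourceTarget hY).rmk ∘ₗ TensorProduct.map e.toLinearMap e.toLinearMap)
      (M.transport_rmk_balance hX hY hθ e) ∘ₗ ((M.transport e).toRight hX hθ).comulR hY := by
  refine (M.transport e).lin_ext fun x h => ?_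
  simp only [LinearMap.comp_apply, AlgEquiv.toLinearMap_apply, map_mul, transport_inL,
    transport_inH, toRight_comulR, map_sweedler]
  refine sweedler_congr fun a b => Eq.symm ?_
  change ((M.toRight hX hθ).sourceTarget hY).rmk
    (e ((M.transport e).inL x * (M.transport e).inH a) ⊗ₜ e ((M.transport e).inH b)) = _
  rw [map_mul, transport_inL, transport_inH, transport_inH]

theorem transport_identifiedBy : ((M.transport e).symmetricHopfAlgebroid hX hY hθ).IdentifiedBy
    (M.symmetricHopfAlgebroid hX hY hθ) e where
  sourceL := M.transport_inL e
  targetL := M.transport_rho e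
  counitL := by
    -- The counits, coproducts and antipode are compared on products x h, where their formulas
    -- involve only the embeddings and the structures of L, R and H.
    refine LinearMap.congr_fun (f := M.counitL ∘ₗ e.toLinearMap) (g := (M.transport e).counitL)
      ((M.transport e).lin_ext fun x h => ?_)
    simp [transport_inL, transport_inH, counitL_mul]
  comulL := LinearMap.congr_fun (M.transport_comulL hX e)
  sourceR y := M.transport_rho e (antiLin θ y)
  targetR y := by
    change e (((M.transport e).toRight hX hθ).lam y) = (M.toRight hX hθ).lam y
    rw [toRight_lam, toRight_lam, transport_inL]
  counitR := by
    refine LinearMap.congr_fun (f := (M.toRight hX hθ).counitR ∘ₗ e.toLinearMap)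
      (g := ((M.transport e).toRight hX hθ).counitR) ((M.transport e).lin_ext fun x h => ?_)
    simp [transport_inL, transport_inH, toRight_counitR]
  comulR := LinearMap.congr_fun (M.transport_comulR hX hY hθ e)
  antipode z := by
    suffices ((MulOpposite.opLinearEquiv k).symm.toLinearMap ∘ₗ
        (M.anti (M.toRight hX hθ) hθ).toLinearMap) ∘ₗ e.toLinearMap =
        e.toLinearMap ∘ₗ ((MulOpposite.opLinearEquiv k).symm.toLinearMap ∘ₗ
          ((M.transport e).anti ((M.transport e).toRight hX hθ) hθ).toLinearMap) from
      LinearMap.congr_fun this z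
    refine (M.transport e).lin_ext fun x h => ?_
    simp only [LinearMap.comp_apply, AlgEquiv.toLinearMap_apply, AlgHom.toLinearMap_apply,
      LinearEquiv.coe_coe, MulOpposite.coe_opLinearEquiv_symm]
    rw [map_mul e, transport_inL, transport_inH, anti_inL_mul, anti_inL_mul, map_sweedler]
    simp only [map_mul, transport_inL, transport_inH]

end Transport

end LeftSmashFactorization

end SymmetricStructure

/-! ### The theorem for the concrete smash products -/

theorem theorem4p7 {k H L R : Type*} [Field k] [Ring H] [HopfAlgebra k H]
    [Ring L] [Algebra k L] [Ring R] [Algebra k R]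
    (X : LeftRightYetterDrinfeld k H L) (hX : X.BraidedCommutative)
    (Y : RightLeftYetterDrinfeld k H R) (hY : Y.BraidedCommutative)
    (θ : R ≃ₐ[k] Lᵐᵒᵖ) (hθ : CompatibleVia X Y θ) :
    ∃ (Ψ : Y.Smash ≃ₐ[k] X.Smash) (Φ : Y.Smash →ₐ[k] X.Smashᵐᵒᵖ)
      (A : SymmetricHopfAlgebroid k L R X.Smash) (A' : SymmetricHopfAlgebroid k L R Y.Smash),
      -- `Ψ(f ♯ y) = f · θ(y)_[0] ♯ θ(y)_[1]`
      (∀ f y, Ψ (Y.tmul f y) = X.inHopf f * X.rho (antiLin θ y)) ∧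
      -- `Ψ⁻¹(x ♯ f) = θ⁻¹(x_[0]) · S(x_[1]) f`
      (∀ x f, Ψ.symm (X.tmul x f) = LinearMap.mul' k Y.Smash (TensorProduct.map
        (Y.inAlg ∘ₗ (antiLin θ).symm.toLinearMap)
        (Y.inHopf ∘ₗ LinearMap.mulRight k f ∘ₗ HopfAlgebra.antipode k) (X.coact x))) ∧
      -- `Ψ(1 ♯ R) = Im ρ` and `Ψ⁻¹(L ♯ 1) = Im λ`
      Ψ '' Set.range Y.inAlg = Set.range X.rho ∧
      Ψ.symm '' Set.range X.inAlg = Set.range Y.lam ∧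
      -- `Φ(f ♯ y) = θ(y) ♯ S f`
      (∀ f y, (Φ (Y.tmul f y)).unop = X.tmul (antiLin θ y) (HopfAlgebra.antipode k f)) ∧
      -- `τ ∘ Ψ = Ψ ∘ τ' = Φ`
      (∀ z, A.antipodeLin (Ψ z) = (Φ z).unop) ∧
      (∀ z, Ψ (A'.antipodeLin z) = (Φ z).unop) ∧
      -- the two symmetric Hopf algebroids correspond to each other under `Ψ`
      A'.IdentifiedBy A Ψ ∧
      -- the left bialgebroid in terms of `L ♯ H`
      (∀ x, A.left.source x = X.tmul x 1) ∧
      (∀ x, A.left.tgt x = X.rho x) ∧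
      (∀ x f, A.left.comul (X.tmul x f) =
        A.left.lmk (TensorProduct.map (X.tmul x) (X.tmul 1) (Coalgebra.comul f))) ∧
      (∀ x f, A.left.counit (X.tmul x f) = (Coalgebra.counit f : k) • x) ∧
      -- the right bialgebroid in terms of `L ♯ H`:
      -- `α_R(y) = ρ(θ(y)) = θ(y_[0]) ♯ S(y_[-1])`, `β_R(y) = y_[-1] ▸ θ(y_[0])`,
      -- `ε_R(x ♯ f) = θ⁻¹(x_[0]) ◂ S(x_[1]) f`
      (∀ y, A.right.source y = X.rho (antiLin θ y)) ∧
      (∀ y, A.right.source y = X.ofTensor (TensorProduct.map (antiLin θ).toLinearMap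
        (HopfAlgebra.antipode k) (TensorProduct.comm k H R (Y.coact y)))) ∧
      (∀ y, A.right.tgt y =
        X.inAlg (TensorProduct.lift (X.act.compl₂ (antiLin θ).toLinearMap) (Y.coact y))) ∧
      (∀ x f, A.right.comul (X.tmul x f) =
        A.right.rmk (TensorProduct.map (X.tmul x) (X.tmul 1) (Coalgebra.comul f))) ∧
      (∀ x f, A.right.counit (X.tmul x f) = TensorProduct.lift
        (Y.act.compl₁₂ (antiLin θ).symm.toLinearMap
          (LinearMap.mulRight k f ∘ₗ HopfAlgebra.antipode k)) (X.coact x)) ∧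
      -- `τ(x ♯ f) = S f S²(x_[1]) · x_[0]`
      (∀ x f, A.antipodeLin (X.tmul x f) = LinearMap.mul' k X.Smash (TensorProduct.map
        (X.inHopf ∘ₗ LinearMap.mulLeft k (HopfAlgebra.antipode k f) ∘ₗ
          HopfAlgebra.antipode k ∘ₗ HopfAlgebra.antipode k) X.inAlg
        (TensorProduct.comm k L H (X.coact x)))) ∧
      -- the left bialgebroid in terms of `H ♯ R`:
      -- `α'_L(x) = θ⁻¹(x_[0]) · S(x_[1])`, `β'_L(x) = 1 ♯ θ⁻¹(x)`, `ε'_L(f ♯ y) = f ▸ θ(y)`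
      (∀ x, A'.left.source x = LinearMap.mul' k Y.Smash (TensorProduct.map
        (Y.inAlg ∘ₗ (antiLin θ).symm.toLinearMap) (Y.inHopf ∘ₗ HopfAlgebra.antipode k)
        (X.coact x))) ∧
      (∀ x, A'.left.tgt x = Y.tmul 1 ((antiLin θ).symm x)) ∧
      (∀ f y, A'.left.comul (Y.tmul f y) =
        A'.left.lmk (TensorProduct.map (Y.tmul.flip 1) (Y.tmul.flip y) (Coalgebra.comul f))) ∧
      (∀ f y, A'.left.counit (Y.tmul f y) = X.act f (antiLin θ y)) ∧
      -- the right bialgebroid in terms of `H ♯ R`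
      (∀ y, A'.right.source y = Y.tmul 1 y) ∧
      (∀ y, A'.right.tgt y = Y.lam y) ∧
      (∀ f y, A'.right.comul (Y.tmul f y) =
        A'.right.rmk (TensorProduct.map (Y.tmul.flip 1) (Y.tmul.flip y) (Coalgebra.comul f))) ∧
      (∀ f y, A'.right.counit (Y.tmul f y) = (Coalgebra.counit f : k) • y) ∧
      -- `τ'(f ♯ y) = y_[0] · S²(y_[-1]) S f`
      (∀ f y, A'.antipodeLin (Y.tmul f y) = LinearMap.mul' k Y.Smash (TensorProduct.map
        Y.inAlg (Y.inHopf ∘ₗ LinearMap.mulRight k (HopfAlgebra.antipode k f) ∘ₗ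
          HopfAlgebra.antipode k ∘ₗ HopfAlgebra.antipode k)
        (TensorProduct.comm k H R (Y.coact y)))) ∧
      -- `θ = ε_L ∘ α_R = ε'_L ∘ α'_R` and `θ⁻¹ = ε_R ∘ β_L = ε'_R ∘ β'_L`
      (∀ y, A.left.counit (A.right.source y) = antiLin θ y) ∧
      (∀ y, A'.left.counit (A'.right.source y) = antiLin θ y) ∧
      (∀ x, A.right.counit (A.left.tgt x) = (antiLin θ).symm x) ∧
      (∀ x, A'.right.counit (A'.left.tgt x) = (antiLin θ).symm x) := by
  let M := X.toLeftModuleAlgebra.factorization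
  let N := Y.toRightModuleAlgebra.factorization
  let Ψ := M.ofRightEquiv hX N hθ
  -- The algebra H ♯ R is regarded as a smash product L ♯ H through Ψ. Its Hopf algebroid is then
  -- identified with that of L ♯ H for free, and the remaining work is to recognise its maps in the
  -- coordinates of H ♯ R.
  let M' := M.transport Ψ
  have hL : ∀ x f, X.tmul x f = M.inL x * M.inH f := fun x f =>
    (X.inAlg_mul_inHopf x f).symm
  have hR : ∀ f y, Y.tmul f y = N.inH f * N.inR y := fun f y =>
    (Y.inHopf_mul_inAlg f y).symm
  have hX' : ∀ t, M.equiv t = X.ofTensor t :=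
    LinearMap.congr_fun (f := M.equiv.toLinearMap) (g := X.ofTensor.toLinearMap)
      (TensorProduct.ext' X.inAlg_mul_inHopf)
  have hY' : ∀ t, N.equiv t = Y.ofTensor t :=
    LinearMap.congr_fun (f := N.equiv.toLinearMap) (g := Y.ofTensor.toLinearMap)
      (TensorProduct.ext' Y.inHopf_mul_inAlg)
  have hrho : ∀ x, M.rho x = X.rho x := fun x => hX' (X.coact x)
  have hlamN : ∀ y, N.lam y = Y.lam y := fun y => hY' (Y.coact y)
  have hΨH : ∀ f, Ψ (N.inH f) = M.inH f := M.ofRight_inH hX N hθ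
  have hΨR : ∀ y, Ψ (N.inR y) = M.rho (antiLin θ y) := M.ofRight_inR hX N hθ
  have hΨA : ∀ x, Ψ (N.antiRho X θ x) = M.inL x := M.ofRight_antiRho hX N hθ
  -- The pulled-back embeddings are identified after applying the injective Ψ: H and R are the
  -- standard ones, and L sits as θ⁻¹(x_[0]) S(x_[1]).
  have hH' : ∀ f, M'.inH f = N.inH f := fun f => Ψ.injective (by
    rw [hΨH]; exact M.transport_inH Ψ f)
  have hR' : ∀ y, M'.rho (antiLin θ y) = N.inR y := fun y => Ψ.injective (by
    rw [hΨR]; exact M.transport_rho Ψ _)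
  have hL' : ∀ x, M'.inL x = N.antiRho X θ x := fun x => Ψ.injective (by
    rw [hΨA]; exact M.transport_inL Ψ x)
  have hlam : ∀ y, (M'.toRight hX hθ).lam y = N.lam y := fun y => by
    rw [RightSmashFactorization.lam_eq, N.lam_eq]
    refine sweedler_congr fun h u => ?_
    rw [LeftSmashFactorization.toRight_inH, LeftSmashFactorization.toRight_inR, hH', hR']
  have hRM : ∀ f y, Y.tmul f y = M'.inH f * (M'.toRight hX hθ).inR y := fun f y => by
    rw [hR, hH', LeftSmashFactorization.toRight_inR, hR']
  -- This is τ ∘ Ψ = Φ. On f ♯ y both sides are θ(y) S(f), since Ψ sends it to the product of f and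
  -- the embedded y in the factorization H ♯ R of `X.Smash`.
  have hanti : ∀ z, (M.anti (M.toRight hX hθ) hθ (Ψ z)).unop = (M.anti N hθ z).unop := by
    refine LinearMap.congr_fun (f := (MulOpposite.opLinearEquiv k).symm.toLinearMap ∘ₗ
      (M.anti (M.toRight hX hθ) hθ).toLinearMap ∘ₗ Ψ.toLinearMap)
      (g := (MulOpposite.opLinearEquiv k).symm.toLinearMap ∘ₗ (M.anti N hθ).toLinearMap)
      (N.lin_ext fun f y => ?_)
    refine Eq.trans (congrArg (fun z => (M.anti (M.toRight hX hθ) hθ z).unop)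
      (M.ofRight_mul hX N hθ f y)) ?_
    exact (M.anti_mul (M.toRight hX hθ) hθ f y).trans (M.anti_mul N hθ f y).symm
  refine ⟨Ψ, M.anti N hθ, M.symmetricHopfAlgebroid hX hY hθ, M'.symmetricHopfAlgebroid hX hY hθ,
    fun f y => ?_, fun x f => ?_, ?_, ?_, fun f y => ?_, hanti, fun z => ?_,
    M.transport_identifiedBy hX hY hθ Ψ, fun x => ?_, hrho, fun x f => ?_, fun x f => ?_,
    fun y => ?_, fun y => ?_, M.toRight_lam hX hθ, fun x f => ?_, fun x f => ?_, fun x f => ?_,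
    fun x => ?_, fun x => ?_, fun f y => ?_, fun f y => ?_, fun y => ?_, fun y => ?_,
    fun f y => ?_, fun f y => ?_, fun f y => ?_, fun y => ?_, fun y => ?_, fun x => ?_,
    fun x => ?_⟩
  · rw [hR, ← hrho]; exact M.ofRight_mul hX N hθ f y
  · rw [hL]
    refine (M.toRightLin_mul N x f).trans ?_
    rw [N.antiRho_eq, sweedler_mul]
    refine Eq.trans (sweedler_congr fun u g => ?_) (sweedler_linear (LinearMap.mul' k Y.Smash ∘ₗ
      TensorProduct.map (Y.inAlg ∘ₗ (antiLin θ).symm.toLinearMap)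
        (Y.inHopf ∘ₗ LinearMap.mulRight k f ∘ₗ HopfAlgebra.antipode k)) (X.coact x))
    change N.inR _ * N.inH _ * N.inH f = N.inR _ * N.inH (HopfAlgebra.antipode k g * f)
    rw [map_mul, mul_assoc]
    rfl
  · refine Set.ext fun z => ⟨?_, ?_⟩
    · rintro ⟨_, ⟨y, rfl⟩, rfl⟩
      exact ⟨antiLin θ y, (hrho _).symm.trans (hΨR y).symm⟩
    · rintro ⟨x, rfl⟩
      refine ⟨_, ⟨(antiLin θ).symm x, rfl⟩, ?_⟩
      exact (hΨR _).trans ((hrho _).trans (congrArg X.rho ((antiLin θ).apply_symm_apply x)))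
  · refine Set.ext fun z => ⟨?_, ?_⟩
    · rintro ⟨_, ⟨x, rfl⟩, rfl⟩
      -- Seen in H ♯ R, the copy of L is the image of λ: `targetActInv` provides the preimage here
      -- and `targetAct` the one for the converse.
      refine ⟨targetActInv X Y θ x, ?_⟩
      refine (hlamN _).symm.trans ((hlam _).symm.trans ?_)
      exact (M'.inL_eq_lam hX hθ x).symm
    · rintro ⟨y, rfl⟩
      refine ⟨_, ⟨targetAct X Y θ y, rfl⟩, ?_⟩
      exact (M'.toRight_lam hX hθ y).symm.trans ((hlam y).trans (hlamN y))
  · rw [hR, hL]; exact M.anti_mul N hθ f y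
  · refine Eq.trans ?_ (hanti z)
    exact ((M.transport_identifiedBy hX hY hθ Ψ).antipode z).symm
  · rfl
  · rw [hL]
    refine (M.comulL_eq hX x f).trans ?_
    refine Eq.trans (sweedler_congr fun a b => ?_) (sweedler_linear
      ((M.sourceTarget hX).lmk ∘ₗ TensorProduct.map (X.tmul x) (X.tmul 1)) (Coalgebra.comul f))
    change _ = (M.sourceTarget hX).lmk (X.tmul x a ⊗ₜ X.tmul 1 b)
    rw [hL, hL, map_one, one_mul]
  · rw [hL]; exact M.counitL_mul x f
  · exact (M.toRight_inR hX hθ y).trans (hrho _)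
  · exact (M.toRight_inR hX hθ y).trans ((hrho _).trans
      (congrArg X.ofTensor (hθ.coact y)))
  · rw [hL]
    refine (M.toRight_comulR hX hY hθ x f).trans ?_
    refine Eq.trans (sweedler_congr fun a b => ?_) (sweedler_linear
      (((M.toRight hX hθ).sourceTarget hY).rmk ∘ₗ TensorProduct.map (X.tmul x) (X.tmul 1))
      (Coalgebra.comul f))
    change _ = ((M.toRight hX hθ).sourceTarget hY).rmk (X.tmul x a ⊗ₜ X.tmul 1 b)
    rw [hL, hL, map_one, one_mul]
  · rw [hL]
    refine (M.toRight_counitR hX hθ x f).trans ?_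
    exact sweedler_linear (TensorProduct.lift (Y.act.compl₁₂ (antiLin θ).symm.toLinearMap
      (LinearMap.mulRight k f ∘ₗ HopfAlgebra.antipode k))) (X.coact x)
  · rw [hL]
    refine (M.anti_inL_mul hX hθ x f).trans ?_
    exact sweedler_linear (LinearMap.mul' k X.Smash ∘ₗ TensorProduct.map
      (X.inHopf ∘ₗ LinearMap.mulLeft k (HopfAlgebra.antipode k f) ∘ₗ
        HopfAlgebra.antipode k ∘ₗ HopfAlgebra.antipode k) X.inAlg ∘ₗ
      (TensorProduct.comm k L H).toLinearMap) (X.coact x)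
  · exact hL' x
  · refine Eq.trans ?_ (hR' ((antiLin θ).symm x))
    rw [LinearEquiv.apply_symm_apply]
    rfl
  · rw [hRM]
    -- The element 1 ♯ y is the left target of θ(y) in `M'`, which is why it stays in the second
    -- leg.
    refine (M'.comulL_mul_rho hX f (antiLin θ y)).trans ?_
    refine Eq.trans (sweedler_congr fun a b => ?_) (sweedler_linear
      ((M'.sourceTarget hX).lmk ∘ₗ TensorProduct.map (Y.tmul.flip 1) (Y.tmul.flip y))
      (Coalgebra.comul f))
    change _ = (M'.sourceTarget hX).lmk (Y.tmul a 1 ⊗ₜ Y.tmul b y)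
    rw [hRM, hRM, map_one, mul_one]
    rfl
  · rw [hRM]; exact M'.counitL_mul_rho hX f (antiLin θ y)
  · exact hR' y
  · exact (hlam y).trans (hlamN y)
  · rw [hRM]
    refine ((M'.toRight hX hθ).comulR_eq hY f y).trans ?_
    refine Eq.trans (sweedler_congr fun a b => ?_) (sweedler_linear
      (((M'.toRight hX hθ).sourceTarget hY).rmk ∘ₗ TensorProduct.map (Y.tmul.flip 1) (Y.tmul.flip y))
      (Coalgebra.comul f))
    change _ = ((M'.toRight hX hθ).sourceTarget hY).rmk (Y.tmul a 1 ⊗ₜ Y.tmul b y)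
    rw [hRM, hRM, map_one, mul_one]
    rfl
  · rw [hRM]; exact (M'.toRight hX hθ).counitR_mul f y
  · rw [hRM]
    refine (M'.anti_mul (M'.toRight hX hθ) hθ f y).trans ?_
    -- The antipode is first θ(y) S(f) with θ(y) in the copy of L, that is θ⁻¹(θ(y)_[0]) S(θ(y)_[1])
    -- S(f). Compatibility replaces θ(y)_[1] by S(y_[-1]), which accounts for S².
    rw [hL', hH', N.antiRho_eq,
      hθ.sweedler_coact fun u g => N.inR ((antiLin θ).symm u) * N.inH (HopfAlgebra.antipode k g),
      sweedler_mul]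
    refine Eq.trans (sweedler_congr fun h u => ?_) (sweedler_linear (LinearMap.mul' k Y.Smash ∘ₗ
      TensorProduct.map Y.inAlg (Y.inHopf ∘ₗ LinearMap.mulRight k (HopfAlgebra.antipode k f) ∘ₗ
        HopfAlgebra.antipode k ∘ₗ HopfAlgebra.antipode k) ∘ₗ
      (TensorProduct.comm k H R).toLinearMap) (Y.coact y))
    change _ = N.inR u *
      N.inH (HopfAlgebra.antipode k (HopfAlgebra.antipode k h) * HopfAlgebra.antipode k f)
    rw [LinearEquiv.symm_apply_apply, map_mul, mul_assoc]
  · exact M.counitL_rho _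
  · exact M'.counitL_rho _
  · change (M.toRight hX hθ).counitR (M.rho x) = _
    rw [M.rho_eq_inR hX hθ, LeftSmashFactorization.counitR_inR]
  · change (M'.toRight hX hθ).counitR (M'.rho x) = _
    rw [M'.rho_eq_inR hX hθ, LeftSmashFactorization.counitR_inR]

end
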